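/- Let $\mathcal G$ be a connected compact metric graph with finitely many edges, each of finite positive length (and at least one edge). Let $0=\mu_1(\mathcal G)<\mu_2(\mathcal G)\le\dots$ be the eigenvalues, counted with multiplicity, of the Laplacian on $\mathcal G$ with natural (continuity and Kirchhoff) vertex conditions, i.e. of the operator on $L^2(\mathcal G)$ associated with the form $a(u,v)=\int_{\mathcal G}u'v'\,dx$ on $H^1(\mathcal G)$. A cut of $\mathcal G$ is a metric graph obtained by inserting finitely many dummy vertices and then splitting vertices, i.e. replacing the equivalence relation that glues the edge endpoints by a finer one. A $k$-partition $\mathcal P=\{\mathcal G_1,\dots,\mathcal G_k\}$ consists of $k$ distinct connected components (clusters) of a cut of $\mathcal G$; it is exhaustive if these are all the components. The support $\Omega_i\subset\mathcal G$ is the image of $\mathcal G_i$ in $\mathcal G$, and $\Omega=\bigcup_i\Omega_i$. The cut set of $\mathcal P$ consists of the points of $\Omega$ that are nontrivially cut; $\mathcal P$ is rigid if its cut set equals $\bigcup_i\partial\Omega_i$, and internally connected if moreover the interior of every $\Omega_i$ is connected. Let $\lambda_1(\mathcal G_i)$ be the first eigenvalue of the Laplacian on $\mathcal G_i$ with Dirichlet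 conditions at all its cut points and natural conditions elsewhere, and put $\Lambda^D_\infty(\mathcal P)=\max_i\lambda_1(\mathcal G_i)$ and $$\mathcal L^D_{k,\infty}(\mathcal G)=\inf\{\Lambda^D_\infty(\mathcal P):\ \mathcal P\text{ an exhaustive rigid }k\text{-partition of }\mathcal G\}.$$ A partition is the nodal partition associated with an eigenfunction $\psi$ of the natural Laplacian on $\mathcal G$ if it is internally connected, its support is the union of the edges of $\mathcal G$ on which $\psi$ does not vanish identically, and its cut set is the zero set of $\psi$ on that support. A $k$-partition $\{\mathcal G_1,\dots,\mathcal G_k\}$ of $\mathcal G$ is a generalised nodal partition if there are eigenfunctions $\psi_i$ for $\lambda_1(\mathcal G_i)$ and cuts $\widetilde{\mathcal G}_i$ of $\mathcal G_i$ such that (1) on each connected component of $\widetilde{\mathcal G}_i$ either $\psi_i$ is identically zero, or the component is the closure of a nodal domain of $\psi_i$ on $\mathcal G_i$; and (2) the $k_0$-partition of $\mathcal G$, $k_0\ge k$, that consists of all components of $\widetilde{\mathcal G}_1,\dots,\widetilde{\mathcal G}_k$ on which the corresponding $\psi_i$ is not identically zero is the nodal partition associated with some eigenfunction of $\mathcal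 G$. Then $\mu_2(\mathcal G)=\mathcal L^D_{2,\infty}(\mathcal G)$. Moreover, every exhaustive rigid $2$-partition $\mathcal P=\{\mathcal G_1,\mathcal G_2\}$ of $\mathcal G$ with $\Lambda^D_\infty(\mathcal P)=\mathcal L^D_{2,\infty}(\mathcal G)$ is a generalised nodal partition; it is a Dirichlet equipartition, i.e. $\lambda_1(\mathcal G_1)=\lambda_1(\mathcal G_2)$, and the eigenfunction of $\mathcal G$ in (2) can be chosen to belong to the eigenvalue $\mu_2(\mathcal G)$. -/

import Mathlib

open Set MeasureTheory

/-- A finite compact metric graph: finitely many edges, the edge `e` being a copy of the compact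
interval `[0, len e]`, and an equivalence relation on the set of all edge endpoints, whose classes
are the vertices. The endpoint `(e, false)` is the initial point `0` of `e`, and `(e, true)` is its
terminal point `len e`. Loops, multiple edges and dummy vertices are allowed. Connectedness is not
part of the structure. -/
structure MetricGraph where
  /-- the edge set -/
  E : Type
  [fintypeE : Fintype E]
  /-- the edge lengths -/
  len : E → ℝ
  len_pos : ∀ e, 0 < len e
  /-- the gluing of the edge endpoints -/
  glue : Setoid (E × Bool)

attribute [instance] MetricGraph.fintypeE

namespace MetricGraph

noncomputable section

/-! ### The graph as a topological space -/

/-- The disjoint union of the edges, before gluing. -/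
abbrev EdgePoint (G : MetricGraph) : Type := Σ e : G.E, Icc (0 : ℝ) (G.len e)

/-- The endpoint of an edge with a given label, as a point of that edge. -/
def endpoint (G : MetricGraph) (a : G.E × Bool) : G.EdgePoint :=
  ⟨a.1, ⟨if a.2 then G.len a.1 else 0, by
    have := G.len_pos a.1
    split_ifs <;> constructor <;> linarith⟩⟩

theorem endpoint_injective (G : MetricGraph) : Function.Injective G.endpoint := by
  rintro ⟨e, b⟩ ⟨e2, b2⟩ h
  have he : e = e2 := congrArg Sigma.fst h
  subst he
  have hp := G.len_pos e
  have hx : (if b then G.len e else 0) = (if b2 then G.len e else 0) :=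
    congrArg Subtype.val (eq_of_heq (Sigma.mk.inj h).2)
  cases b <;> cases b2 <;> simp_all [hp.ne, hp.ne']

/-- The extension of the gluing of endpoints to all points: a point in the interior of an edge is
equivalent only to itself. -/
def pointSetoid (G : MetricGraph) : Setoid G.EdgePoint where
  r p q := p = q ∨ ∃ a b, G.glue a b ∧ G.endpoint a = p ∧ G.endpoint b = q
  iseqv := by
    refine ⟨fun p => Or.inl rfl, ?_, ?_⟩
    · rintro p q (h | ⟨a, b, h, ha, hb⟩)
      · exact Or.inl h.symm
      · exact Or.inr ⟨b, a, G.glue.symm h, hb, ha⟩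
    · rintro p q r (rfl | ⟨a, b, h, ha, hb⟩) (rfl | ⟨c, d, h2, hc, hd⟩)
      · exact Or.inl rfl
      · exact Or.inr ⟨c, d, h2, hc, hd⟩
      · exact Or.inr ⟨a, b, h, ha, hb⟩
      · have hbc : b = c := G.endpoint_injective (hb.trans hc.symm)
        subst hbc
        exact Or.inr ⟨a, d, G.glue.trans h h2, ha, hd⟩

/-- The set of points of a metric graph. -/
def Point (G : MetricGraph) : Type := Quotient G.pointSetoid

/-- The quotient topology; since there are finitely many edges, it is the topology of the path
distance. -/
instance (G : MetricGraph) : TopologicalSpace G.Point :=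
  inferInstanceAs (TopologicalSpace (Quotient G.pointSetoid))

/-- The point of the edge `e` with coordinate `x ∈ [0, len e]` (coordinates outside that interval
are moved to the nearest endpoint). -/
def pt (G : MetricGraph) (e : G.E) (x : ℝ) : G.Point :=
  Quotient.mk G.pointSetoid ⟨e, projIcc 0 (G.len e) (G.len_pos e).le x⟩

/-- A closed edge as a subset of the graph. -/
def edgeSet (G : MetricGraph) (e : G.E) : Set G.Point := G.pt e '' Icc 0 (G.len e)

/-! ### Function spaces, the Laplacian and its eigenvalues -/

/-- The restriction of a function to an edge, as a function of the coordinate. -/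
def onEdge (G : MetricGraph) (u : G.Point → ℝ) (e : G.E) : ℝ → ℝ := fun x => u (G.pt e x)

/-- The Sobolev space `H¹(G)`: continuous functions on the graph that belong to `H¹` on every edge,
that is, are absolutely continuous there with a square integrable (almost everywhere, equivalently
weak) derivative. -/
def MemH1 (G : MetricGraph) (u : G.Point → ℝ) : Prop :=
  Continuous u ∧ ∀ e, AbsolutelyContinuousOnInterval (G.onEdge u e) 0 (G.len e) ∧
    MemLp (deriv (G.onEdge u e)) 2 (volume.restrict (Ioo 0 (G.len e)))

/-- The space `H¹₀(G; D)` of functions in `H¹(G)` that vanish on `D`. -/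
def MemH10 (G : MetricGraph) (D : Set G.Point) (u : G.Point → ℝ) : Prop :=
  G.MemH1 u ∧ ∀ p ∈ D, u p = 0

/-- The form `a(u, v) = ∫_G u' v' dx`. -/
def form (G : MetricGraph) (u v : G.Point → ℝ) : ℝ :=
  ∑ e, ∫ x in (0 : ℝ)..G.len e, deriv (G.onEdge u e) x * deriv (G.onEdge v e) x

/-- The inner product `∫_G u v dx` of `L²(G)`. -/
def innerL2 (G : MetricGraph) (u v : G.Point → ℝ) : ℝ :=
  ∑ e, ∫ x in (0 : ℝ)..G.len e, G.onEdge u e x * G.onEdge v e x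

/-- `u` is an eigenfunction for the eigenvalue `t` of the Laplacian with Dirichlet conditions on `D`
and natural conditions elsewhere, the operator associated with the form `a` on `H¹₀(G; D)`. -/
def IsEigenfunction (G : MetricGraph) (D : Set G.Point) (t : ℝ) (u : G.Point → ℝ) : Prop :=
  G.MemH10 D u ∧ u ≠ 0 ∧ ∀ v, G.MemH10 D v → G.form u v = t * G.innerL2 u v

/-- The `k`-th eigenvalue (`k = 1, 2, …`), counted with multiplicity, of the Laplacian with
Dirichlet conditions on `D` and natural conditions elsewhere: the least `t` such that there are `k`
linearly independent eigenfunctions with eigenvalues at most `t`. -/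
def eigenvalue (G : MetricGraph) (D : Set G.Point) (k : ℕ) : ℝ :=
  sInf {t : ℝ | ∃ u : Fin k → G.Point → ℝ, LinearIndependent ℝ u ∧
    ∀ i, ∃ s ≤ t, G.IsEigenfunction D s (u i)}

/-- The eigenvalues `μ_k(G)` of the Laplacian with natural vertex conditions. -/
def mu (G : MetricGraph) (k : ℕ) : ℝ := G.eigenvalue ∅ k

/-! ### Cuts -/

/-- A representative of `G` obtained by inserting dummy vertices: each edge `e` of `G` is tiled by
finitely many intervals `[offset e₁, offset e₁ + len e₁]` with `parent e₁ = e`, which are the new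
edges. -/
structure Subdivision (G : MetricGraph) where
  /-- the new edges -/
  E : Type
  [fintypeE : Fintype E]
  len : E → ℝ
  len_pos : ∀ e, 0 < len e
  /-- the edge of `G` that contains a given new edge -/
  parent : E → G.E
  /-- the coordinate in the old edge of the initial point of the new edge -/
  offset : E → ℝ
  offset_nonneg : ∀ e, 0 ≤ offset e
  offset_add_len_le : ∀ e, offset e + len e ≤ G.len (parent e)
  cover : ∀ (e : G.E), ∀ x ∈ Icc 0 (G.len e),
    ∃ e₁, parent e₁ = e ∧ x ∈ Icc (offset e₁) (offset e₁ + len e₁)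
  disjoint : ∀ e₁ e₂, e₁ ≠ e₂ → parent e₁ = parent e₂ →
    Disjoint (Ioo (offset e₁) (offset e₁ + len e₁)) (Ioo (offset e₂) (offset e₂ + len e₂))

attribute [instance] Subdivision.fintypeE

/-- The point of `G` at which an endpoint of a new edge lies. -/
def Subdivision.endpointImage {G : MetricGraph} (S : G.Subdivision) (a : S.E × Bool) : G.Point :=
  G.pt (S.parent a.1) (S.offset a.1 + if a.2 then S.len a.1 else 0)

/-- The subdivided graph: endpoints are glued precisely if they are the same point of `G`. -/
def Subdivision.graph {G : MetricGraph} (S : G.Subdivision) : MetricGraph where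
  E := S.E
  len := S.len
  len_pos := S.len_pos
  glue := Setoid.ker S.endpointImage

/-- A cut of `G`: a representative of `G` together with a second metric graph that has the same
edges, and each of whose vertices (as a set of edge endpoints) is contained in a vertex of that
representative. -/
structure Cut (G : MetricGraph) extends Subdivision G where
  glue : Setoid (E × Bool)
  glue_le : glue ≤ toSubdivision.graph.glue

namespace Cut

variable {G : MetricGraph}

/-- The metric graph obtained by a cut. -/
def graph (C : G.Cut) : MetricGraph where
  E := C.E
  len := C.len
  len_pos := C.len_pos
  glue := C.glue

/-- The natural map from the cut graph onto `G`, which glues the cut vertices together again. -/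
def proj (C : G.Cut) : C.graph.Point → G.Point :=
  Quotient.lift
    (fun p : C.graph.EdgePoint => G.pt (C.parent p.1) (C.offset p.1 + (p.2 : ℝ))) (by
      rintro p q (rfl | ⟨a, b, h, rfl, rfl⟩)
      · rfl
      · exact C.glue_le h)

/-- A point of the cut graph arises by nontrivially cutting through a vertex if another point of
the cut graph corresponds to the same point of `G`. -/
def IsCutVertex (C : G.Cut) (p : C.graph.Point) : Prop := ∃ q, q ≠ p ∧ C.proj q = C.proj p

end Cut

/-! ### Connected components as metric graphs -/

open Classical in
/-- The subgraph formed by a set of edges, glued as in the ambient graph. -/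
def restrict (G : MetricGraph) (S : Set G.E) : MetricGraph where
  E := S
  fintypeE := Fintype.ofFinite S
  len e := G.len e
  len_pos e := G.len_pos e
  glue := Setoid.comap (fun a : S × Bool => ((a.1 : G.E), a.2)) G.glue

/-- The natural map from the subgraph formed by a set of edges to the ambient graph. -/
def inclRestrict (G : MetricGraph) (S : Set G.E) : (G.restrict S).Point → G.Point :=
  Quotient.lift
    (fun p : (G.restrict S).EdgePoint => G.pt (Subtype.val p.1) (p.2 : ℝ)) (by
      rintro p q (rfl | ⟨a, b, h, rfl, rfl⟩)
      · rfl
      · refine Quotient.sound (s := G.pointSetoid)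
          (Or.inr ⟨(Subtype.val a.1, a.2), (Subtype.val b.1, b.2), h, ?_, ?_⟩)
        · exact Sigma.ext rfl (heq_of_eq (projIcc_of_mem (G.len_pos _).le
            ((G.restrict S).endpoint a).2.2).symm)
        · exact Sigma.ext rfl (heq_of_eq (projIcc_of_mem (G.len_pos _).le
            ((G.restrict S).endpoint b).2.2).symm))

/-- The edges contained in a connected component. -/
def componentEdges (G : MetricGraph) (c : ConnectedComponents G.Point) : Set G.E :=
  {e | ConnectedComponents.mk (G.pt e 0) = c}

/-- The points of a connected component. -/
def componentSet (G : MetricGraph) (c : ConnectedComponents G.Point) : Set G.Point :=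
  {p | ConnectedComponents.mk p = c}

end

end MetricGraph

/-! ### Partitions -/

/-- A (loose, not necessarily exhaustive) `k`-partition of `G`: a cut of `G`, and `k` distinct
connected components of the cut graph, the clusters. -/
structure GraphPartition (G : MetricGraph) (k : ℕ) where
  cut : G.Cut
  cluster : Fin k → ConnectedComponents cut.graph.Point
  cluster_injective : Function.Injective cluster

namespace GraphPartition

noncomputable section

variable {G : MetricGraph} {k : ℕ}

/-- The points of the cut graph that lie in the `i`-th cluster. -/
def clusterSet (P : GraphPartition G k) (i : Fin k) : Set P.cut.graph.Point :=
  P.cut.graph.componentSet (P.cluster i)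

/-- The `i`-th cluster as a metric graph in its own right. -/
def clusterGraph (P : GraphPartition G k) (i : Fin k) : MetricGraph :=
  P.cut.graph.restrict (P.cut.graph.componentEdges (P.cluster i))

/-- The inclusion of the `i`-th cluster into the cut graph. -/
def clusterIncl (P : GraphPartition G k) (i : Fin k) :
    (P.clusterGraph i).Point → P.cut.graph.Point :=
  P.cut.graph.inclRestrict (P.cut.graph.componentEdges (P.cluster i))

/-- The natural map from the `i`-th cluster to `G`. -/
def clusterProj (P : GraphPartition G k) (i : Fin k) : (P.clusterGraph i).Point → G.Point :=
  fun p => P.cut.proj (P.clusterIncl i p)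

/-- The cluster supports `Ω_i`. -/
def clusterSupport (P : GraphPartition G k) (i : Fin k) : Set G.Point :=
  P.cut.proj '' P.clusterSet i

/-- The support `Ω` of the partition. -/
def support (P : GraphPartition G k) : Set G.Point := ⋃ i, P.clusterSupport i

/-- The cut set: the points of the support that are nontrivially cut. -/
def cutSet (P : GraphPartition G k) : Set G.Point :=
  {x | x ∈ P.support ∧ ∃ p, P.cut.IsCutVertex p ∧ P.cut.proj p = x}

/-- The cut points of the `i`-th cluster, at which Dirichlet conditions are imposed. -/
def dirichletVertices (P : GraphPartition G k) (i : Fin k) : Set (P.clusterGraph i).Point :=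
  {p | P.cut.IsCutVertex (P.clusterIncl i p)}

/-- The separation set: the union of the topological boundaries of the cluster supports. -/
def separationSet (P : GraphPartition G k) : Set G.Point := ⋃ i, frontier (P.clusterSupport i)

/-- A partition is exhaustive if its clusters are all the components of the cut graph. -/
def IsExhaustive (P : GraphPartition G k) : Prop := Function.Surjective P.cluster

/-- A partition is rigid if its cut set and its separation set agree. -/
def IsRigid (P : GraphPartition G k) : Prop := P.cutSet = P.separationSet

/-- A partition is internally connected if it is rigid and the interiors of all cluster supports
are connected. -/
def IsInternallyConnected (P : GraphPartition G k) : Prop :=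
  P.IsRigid ∧ ∀ i, IsConnected (interior (P.clusterSupport i))

/-! ### Dirichlet energies -/

/-- The first eigenvalue `λ₁(G_i)` of the `i`-th cluster, with Dirichlet conditions at its cut
points. -/
def lambda1 (P : GraphPartition G k) (i : Fin k) : ℝ :=
  (P.clusterGraph i).eigenvalue (P.dirichletVertices i) 1

/-- The energy `Λ^D_∞(P) = max_i λ₁(G_i)`. -/
def dirichletEnergy (P : GraphPartition G k) : ℝ := ⨆ i, P.lambda1 i

/-- The partition is a Dirichlet equipartition. -/
def IsDirichletEquipartition (P : GraphPartition G k) : Prop :=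
  ∀ i j, P.lambda1 i = P.lambda1 j

/-! ### Nodal and generalised nodal partitions -/

/-- `P` is the nodal partition associated with the function `ψ` on `G`: it is internally connected,
its support is the union of the edges on which `ψ` does not vanish identically, and its cut set is
the zero set of `ψ` on the support. -/
def IsNodalFor (P : GraphPartition G k) (ψ : G.Point → ℝ) : Prop :=
  P.IsInternallyConnected ∧
  P.support = (⋃ e ∈ {e : G.E | ∃ p ∈ G.edgeSet e, ψ p ≠ 0}, G.edgeSet e) ∧
  P.cutSet = {p | p ∈ P.support ∧ ψ p = 0}

/-- The closed nodal domains of a function `ψ` on a metric graph: the closures of the connected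
components of the set where it does not vanish. -/
def IsClosedNodalDomain (H : MetricGraph) (ψ : H.Point → ℝ) (A : Set H.Point) : Prop :=
  ∃ x, ψ x ≠ 0 ∧ A = closure (connectedComponentIn {y | ψ y ≠ 0} x)

/-- The connected components of cuts `C i` of the clusters on which `ψ i` is not identically
zero. -/
abbrev NonzeroComponent (P : GraphPartition G k) (ψ : ∀ i, (P.clusterGraph i).Point → ℝ)
    (C : ∀ i, (P.clusterGraph i).Cut) : Type :=
  {s : Σ i, ConnectedComponents (C i).graph.Point //
    ∃ p ∈ (C s.1).graph.componentSet s.2, ψ s.1 ((C s.1).proj p) ≠ 0}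

/-- `P` is a generalised nodal partition of `G`, the eigenfunction of `G` in question belonging to
the eigenvalue `t` (of the Laplacian with natural conditions).

There are eigenfunctions `ψ i` for the first eigenvalues of the clusters, and cuts `C i` of the
clusters, such that (1) on each connected component of `C i` either `ψ i` is identically zero, or
the component is a closed nodal domain of `ψ i`; and (2) the partition `Q` of `G` that consists of
all the components on which `ψ i` is not identically zero (for all `i`) is the nodal partition
associated with some eigenfunction of `G`. That a cluster of `Q` is a given component of `C i` is
expressed by a homeomorphism that respects the natural maps to `G`; as these maps preserve length
along edges, it identifies the two as metric graphs over `G`. -/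
def IsGeneralisedNodalFor (P : GraphPartition G k) (t : ℝ) : Prop :=
  ∃ (ψ : ∀ i, (P.clusterGraph i).Point → ℝ) (C : ∀ i, (P.clusterGraph i).Cut),
    (∀ i, (P.clusterGraph i).IsEigenfunction (P.dirichletVertices i) (P.lambda1 i) (ψ i)) ∧
    (∀ i, ∀ c : ConnectedComponents (C i).graph.Point,
      (∀ p ∈ (C i).graph.componentSet c, ψ i ((C i).proj p) = 0) ∨
      IsClosedNodalDomain (P.clusterGraph i) (ψ i) ((C i).proj '' (C i).graph.componentSet c)) ∧
    ∃ (k₀ : ℕ) (Q : GraphPartition G k₀) (σ : Fin k₀ ≃ P.NonzeroComponent ψ C),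
      k ≤ k₀ ∧
      (∀ j, ∃ h : Q.clusterSet j ≃ₜ (C (σ j).1.1).graph.componentSet (σ j).1.2,
        ∀ p, P.clusterProj (σ j).1.1 ((C (σ j).1.1).proj (h p)) = Q.cut.proj p) ∧
      ∃ φ : G.Point → ℝ, G.IsEigenfunction ∅ t φ ∧ Q.IsNodalFor φ

/-- `P` is a generalised nodal partition of `G`. -/
def IsGeneralisedNodal (P : GraphPartition G k) : Prop := ∃ t, P.IsGeneralisedNodalFor t

end

end GraphPartition

namespace MetricGraph

noncomputable section

/-- The minimal energy `L^D_{k,∞}(G)`: the infimum of `Λ^D_∞` over all exhaustive rigid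
`k`-partitions. -/
def dirichletOptEnergy (G : MetricGraph) (k : ℕ) : ℝ :=
  sInf {t : ℝ | ∃ P : GraphPartition G k, P.IsExhaustive ∧ P.IsRigid ∧ P.dirichletEnergy = t}

end

end MetricGraph

/-!
The proof rests on two variational principles (`first_eigenvalue`, `second_eigenvalue`): the first
Dirichlet eigenvalue of a cluster is the minimum of the Rayleigh quotient on `H¹₀`, attained by a
nonnegative function, and the second eigenvalue `μ₂` of a connected graph is the minimum of the
Rayleigh quotient on the functions in `H¹` with mean zero, all minimizers being eigenfunctions. Both
follow from the direct method (`exists_minimizer`).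

*The energy of every exhaustive `2`-partition is at least `μ₂`* (`mu_two_le_and_eq`). First
eigenfunctions `ψ 0, ψ 1 ≥ 0` of the clusters vanish at the cut points, so that they can be glued to
a function `φ` on the graph, equal to `c i * ψ i` on the `i`-th cluster. The coefficients
`c 0 > 0 > c 1` can be chosen such that `φ` has mean zero. The Rayleigh quotient of `φ` is a
weighted mean of the two first eigenvalues, hence at most the energy. If the energy is `μ₂`, both
first eigenvalues equal `μ₂`, and `φ` is an eigenfunction for `μ₂`.

*The energy `μ₂` is attained* (`exists_dirichletEnergy_le`). An eigenfunction `ψ` for `μ₂` takes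
both signs, and on each edge it is a solution of `f'' = -μ₂ f`, so that it has finitely many zeros
or vanishes identically. After a subdivision at the zeros, the graph can be cut at zeros of `ψ` into
exactly two connected parts, on both of which `ψ` is not identically zero (`exists_bisection`): take
a component of the complement of a nodal domain, and all the rest. The restrictions of `ψ` to the
two clusters have Rayleigh quotient `μ₂`, which bounds their first eigenvalues.

*Optimal partitions are generalised nodal partitions* (`isGeneralisedNodalFor_of_glued`). Cut each
cluster along the zero set of `ψ i`. The components on which `ψ i` is not identically zero are
closed nodal domains of `ψ i` (`isClosedNodalDomain_nodalCut`), and the cuts of the clusters combine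
to one cut of the graph (`combine`). The partition obtained in this way is the nodal partition of
the glued function `φ` (`isNodalFor_of_closed_nodal_domains`): by the Kirchhoff condition, an
eigenfunction that does not change its sign near a zero vanishes on all edges through that point
(`eq_zero_of_nonneg`), so that every zero in the support lies in clusters of both signs, and thus is
both a cut point and a boundary point of a cluster support.
-/

open Filter Topology

/-! ### The space `H¹` of an interval -/

/-- The space `H¹(0, L)` of absolutely continuous functions on `[0, L]` with square integrable
derivative. -/
def MemH1Interval (L : ℝ) (f : ℝ → ℝ) : Prop :=
  AbsolutelyContinuousOnInterval f 0 L ∧ MemLp (deriv f) 2 (volume.restrict (Ioo 0 L))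

theorem AbsolutelyContinuousOnInterval.congr_of_eqOn {f g : ℝ → ℝ} {a b : ℝ}
    (hf : AbsolutelyContinuousOnInterval f a b) (h : EqOn f g (uIcc a b)) :
    AbsolutelyContinuousOnInterval g a b := by
  rw [absolutelyContinuousOnInterval_iff] at hf ⊢
  intro ε hε
  obtain ⟨δ, hδ, H⟩ := hf ε hε
  refine ⟨δ, hδ, fun E hE hE2 => ?_⟩
  have := H E hE hE2
  convert this using 1
  refine Finset.sum_congr rfl fun i hi => ?_
  rw [h (hE.1 i hi).1, h (hE.1 i hi).2]

theorem AbsolutelyContinuousOnInterval.abs' {f : ℝ → ℝ} {a b : ℝ}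
    (hf : AbsolutelyContinuousOnInterval f a b) :
    AbsolutelyContinuousOnInterval (fun x => |f x|) a b := by
  rw [absolutelyContinuousOnInterval_iff] at hf ⊢
  intro ε hε
  obtain ⟨δ, hδ, H⟩ := hf ε hε
  refine ⟨δ, hδ, fun E hE hE2 => lt_of_le_of_lt ?_ (H E hE hE2)⟩
  refine Finset.sum_le_sum fun i _ => ?_
  exact abs_abs_sub_abs_le_abs_sub _ _

theorem MeasureTheory.MemLp.intervalIntegrable_of_Ioo {g : ℝ → ℝ} {L : ℝ} (hL : 0 ≤ L)
    (hg : MemLp g 2 (volume.restrict (Ioo 0 L))) : IntervalIntegrable g volume 0 L := by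
  rw [intervalIntegrable_iff_integrableOn_Ioo_of_le hL]
  exact hg.integrable (by norm_num)

theorem integral_eq_integral_Ioo {L : ℝ} (hL : 0 ≤ L) (f : ℝ → ℝ) :
    ∫ x in (0 : ℝ)..L, f x = ∫ x in Ioo 0 L, f x := by
  rw [intervalIntegral.integral_of_le hL, integral_Ioc_eq_integral_Ioo]

theorem uIcc_subset_of_mem_Icc {a b x y : ℝ} (hx : x ∈ Icc a b) (hy : y ∈ Icc a b) :
    uIcc x y ⊆ uIcc a b := by
  rw [uIcc_of_le (hx.1.trans hx.2)]
  exact uIcc_subset_Icc hx hy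

namespace MemH1Interval

variable {L : ℝ} {f g : ℝ → ℝ}

theorem integral_deriv (hf : MemH1Interval L f) {x y : ℝ} (hx : x ∈ Icc 0 L) (hy : y ∈ Icc 0 L) :
    ∫ t in x..y, deriv f t = f y - f x :=
  (hf.1.mono (uIcc_subset_of_mem_Icc hx hy)).integral_deriv_eq_sub

theorem continuousOn (hL : 0 ≤ L) (hf : MemH1Interval L f) : ContinuousOn f (Icc 0 L) := by
  simpa [uIcc_of_le hL] using hf.1.continuousOn

/-- Functions with a square integrable weak derivative `g` are in `H¹`, and `g` is their classical
derivative almost everywhere. -/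
theorem of_integral (hL : 0 < L) (hg : MemLp g 2 (volume.restrict (Ioo 0 L)))
    (h : ∀ x ∈ Icc 0 L, f x = f 0 + ∫ t in (0 : ℝ)..x, g t) :
    MemH1Interval L f ∧ deriv f =ᵐ[volume.restrict (Ioo 0 L)] g := by
  have hi := hg.intervalIntegrable_of_Ioo hL.le
  have hac : AbsolutelyContinuousOnInterval (fun x => f 0 + ∫ t in (0 : ℝ)..x, g t) 0 L := by
    have h1 : AbsolutelyContinuousOnInterval (fun _ : ℝ => f 0) 0 L :=
      (LipschitzWith.const (f 0)).lipschitzOnWith.absolutelyContinuousOnInterval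
    exact h1.add (hi.absolutelyContinuousOnInterval_intervalIntegral (c := 0) (by simp))
  have hae : deriv f =ᵐ[volume.restrict (Ioo 0 L)] g := by
    rw [Filter.EventuallyEq, ae_restrict_iff' measurableSet_Ioo]
    filter_upwards [hi.ae_hasDerivAt_integral] with x hx hx2
    have hx3 : x ∈ uIcc 0 L := by rw [uIcc_of_le hL.le]; exact Ioo_subset_Icc_self hx2
    have h1 := ((hx hx3 0 (by simp)).const_add (f 0))
    refine HasDerivAt.deriv (h1.congr_of_eventuallyEq ?_)
    filter_upwards [Ioo_mem_nhds hx2.1 hx2.2] with y hy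
    exact h y (Ioo_subset_Icc_self hy)
  refine ⟨⟨hac.congr_of_eqOn ?_, (memLp_congr_ae hae).2 hg⟩, hae⟩
  intro x hx
  rw [uIcc_of_le hL.le] at hx
  exact (h x hx).symm

theorem deriv_eqOn (h : EqOn f g (Icc 0 L)) : EqOn (deriv f) (deriv g) (Ioo 0 L) := by
  intro x hx
  refine Filter.EventuallyEq.deriv_eq ?_
  filter_upwards [Ioo_mem_nhds hx.1 hx.2] with y hy using h (Ioo_subset_Icc_self hy)

theorem ae_eq_of_eqOn {u v : ℝ → ℝ} (h : EqOn u v (Ioo 0 L)) :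
    u =ᵐ[volume.restrict (Ioo 0 L)] v :=
  (ae_restrict_iff' measurableSet_Ioo).2 (Eventually.of_forall fun _ hx => h hx)

theorem congr (hL : 0 ≤ L) (hf : MemH1Interval L f) (h : EqOn f g (Icc 0 L)) :
    MemH1Interval L g := by
  refine ⟨hf.1.congr_of_eqOn (by rwa [uIcc_of_le hL]), ?_⟩
  exact (memLp_congr_ae (ae_eq_of_eqOn (deriv_eqOn h))).1 hf.2

theorem ae_differentiableAt (hL : 0 ≤ L) (hf : MemH1Interval L f) :
    ∀ᵐ x ∂(volume.restrict (Ioo 0 L)), DifferentiableAt ℝ f x := by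
  rw [ae_restrict_iff' measurableSet_Ioo]
  filter_upwards [hf.1.ae_differentiableAt] with x hx hx2
  exact hx (by rw [uIcc_of_le hL]; exact Ioo_subset_Icc_self hx2)

theorem deriv_add_ae (hL : 0 ≤ L) (hf : MemH1Interval L f) (hg : MemH1Interval L g) :
    deriv (fun x => f x + g x) =ᵐ[volume.restrict (Ioo 0 L)] fun x => deriv f x + deriv g x := by
  filter_upwards [hf.ae_differentiableAt hL, hg.ae_differentiableAt hL] with x h1 h2
  exact (h1.hasDerivAt.add h2.hasDerivAt).deriv

theorem deriv_const_mul (c : ℝ) (f : ℝ → ℝ) :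
    deriv (fun x => c * f x) = fun x => c * deriv f x := by
  ext x
  exact deriv_const_mul_field c

theorem add (hL : 0 ≤ L) (hf : MemH1Interval L f) (hg : MemH1Interval L g) :
    MemH1Interval L (fun x => f x + g x) := by
  refine ⟨hf.1.add hg.1, (memLp_congr_ae (hf.deriv_add_ae hL hg)).2 (hf.2.add hg.2)⟩

theorem const_mul (c : ℝ) (hf : MemH1Interval L f) : MemH1Interval L (fun x => c * f x) := by
  refine ⟨hf.1.const_mul c, ?_⟩
  rw [deriv_const_mul]
  exact hf.2.const_mul c

theorem of_contDiff (hf : ContDiff ℝ 1 f) : MemH1Interval L f := by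
  refine ⟨hf.contDiffOn.absolutelyContinuousOnInterval, ?_⟩
  have hc : ContinuousOn (deriv f) (Icc 0 L) := (hf.continuous_deriv le_rfl).continuousOn
  obtain ⟨C, hC⟩ := isCompact_Icc.exists_bound_of_continuousOn hc
  refine MemLp.of_bound (hf.continuous_deriv le_rfl).aestronglyMeasurable C ?_
  rw [ae_restrict_iff' measurableSet_Ioo]
  exact Eventually.of_forall fun x hx => hC x (Ioo_subset_Icc_self hx)

theorem memLp (hf : ContinuousOn f (Icc 0 L)) :
    MemLp f 2 (volume.restrict (Ioo 0 L)) := by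
  obtain ⟨C, hC⟩ := isCompact_Icc.exists_bound_of_continuousOn hf
  refine MemLp.of_bound ((hf.mono Ioo_subset_Icc_self).aestronglyMeasurable measurableSet_Ioo) C ?_
  rw [ae_restrict_iff' measurableSet_Ioo]
  exact Eventually.of_forall fun x hx => hC x (Ioo_subset_Icc_self hx)

theorem integrable_mul {u v : ℝ → ℝ} (hu : MemLp u 2 (volume.restrict (Ioo 0 L)))
    (hv : MemLp v 2 (volume.restrict (Ioo 0 L))) :
    Integrable (fun x => u x * v x) (volume.restrict (Ioo 0 L)) :=
  hu.integrable_mul hv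

/-- The absolute value preserves `H¹` and does not increase the derivative in absolute value. At a
zero of `f` the derivative of `|f|` is zero, either by minimality or as a junk value. -/
theorem abs (hf : MemH1Interval L f) (hc : ContinuousOn f (Ioo 0 L)) :
    MemH1Interval L (fun x => |f x|) ∧
      ∀ x ∈ Ioo 0 L, |deriv (fun x => |f x|) x| ≤ |deriv f x| := by
  have key : ∀ x ∈ Ioo 0 L, |deriv (fun x => |f x|) x| ≤ |deriv f x| := by
    intro x hx
    have hcx : ContinuousAt f x := hc.continuousAt (Ioo_mem_nhds hx.1 hx.2)
    rcases lt_trichotomy (f x) 0 with h | h | h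
    · have : (fun x => |f x|) =ᶠ[𝓝 x] fun x => - f x := by
        filter_upwards [hcx.eventually_lt continuousAt_const h] with y hy
        exact abs_of_neg hy
      rw [this.deriv_eq, deriv.fun_neg, abs_neg]
    · have : IsLocalMin (fun x => |f x|) x := by
        refine Eventually.of_forall fun y => ?_
        simp [h]
      rw [this.deriv_eq_zero]
      simp
    · have : (fun x => |f x|) =ᶠ[𝓝 x] fun x => f x := by
        filter_upwards [continuousAt_const.eventually_lt hcx h] with y hy
        exact abs_of_pos hy
      rw [this.deriv_eq]
  refine ⟨⟨hf.1.abs', hf.2.of_le (measurable_deriv _).aestronglyMeasurable ?_⟩, key⟩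
  rw [ae_restrict_iff' measurableSet_Ioo]
  exact Eventually.of_forall fun x hx => key x hx

/-- The embedding of `H¹(0, L)` into the Hölder space of exponent `1 / 2`. -/
theorem sq_sub_le (hL : 0 ≤ L) (hf : MemH1Interval L f) {x y : ℝ} (hx : x ∈ Icc 0 L)
    (hy : y ∈ Icc 0 L) : (f y - f x) ^ 2 ≤ |y - x| * ∫ t in (0 : ℝ)..L, deriv f t * deriv f t := by
  wlog hxy : x ≤ y generalizing x y
  · have := this hy hx (le_of_not_ge hxy)
    rw [abs_sub_comm, ← neg_sub (f x), neg_sq]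
    exact this
  rcases hxy.eq_or_lt with rfl | hlt
  · simp
  have hsub : Ioo x y ⊆ Ioo 0 L := Ioo_subset_Ioo hx.1 hy.2
  have hm : MemLp (deriv f) 2 (volume.restrict (Ioo x y)) :=
    hf.2.mono_measure (Measure.restrict_mono hsub le_rfl)
  have hint : f y - f x = ∫ t in Ioo x y, deriv f t := by
    rw [← hf.integral_deriv hx hy, intervalIntegral.integral_of_le hxy,
      integral_Ioc_eq_integral_Ioo]
  have hi1 : Integrable (deriv f) (volume.restrict (Ioo x y)) := hm.integrable (by norm_num)
  have hi2 : Integrable (fun t => deriv f t * deriv f t) (volume.restrict (Ioo x y)) :=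
    hm.integrable_mul hm
  have hmono : ∫ t in Ioo x y, deriv f t * deriv f t ≤ ∫ t in Ioo 0 L, deriv f t * deriv f t := by
    refine setIntegral_mono_set (integrable_mul hf.2 hf.2) ?_ hsub.eventuallyLE
    exact Eventually.of_forall fun t => mul_self_nonneg _
  rw [integral_eq_integral_Ioo hL, abs_of_pos (sub_pos.2 hlt)]
  refine le_trans ?_ (mul_le_mul_of_nonneg_left hmono (sub_pos.2 hlt).le)
  set I := ∫ t in Ioo x y, deriv f t * deriv f t
  set c := (f y - f x) / (y - x) with hc
  -- expand the integral of the square of the deviation of the derivative from its mean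
  have h0 : 0 ≤ ∫ t in Ioo x y, (deriv f t * deriv f t - 2 * c * deriv f t + c ^ 2) :=
    integral_nonneg fun t => by
      change 0 ≤ deriv f t * deriv f t - 2 * c * deriv f t + c ^ 2
      nlinarith [sq_nonneg (deriv f t - c)]
  have hvol : (volume.restrict (Ioo x y)).real univ = y - x := by
    simp [Measure.real, hxy]
  have hexp : ∫ t in Ioo x y, (deriv f t * deriv f t - 2 * c * deriv f t + c ^ 2) =
      I - 2 * c * (f y - f x) + (y - x) * c ^ 2 := by
    have h1 := integral_add (μ := volume.restrict (Ioo x y))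
      (f := fun t => deriv f t * deriv f t - 2 * c * deriv f t) (g := fun _ => c ^ 2)
      (hi2.sub (hi1.const_mul _)) (integrable_const _)
    have h2 := integral_sub (μ := volume.restrict (Ioo x y))
      (f := fun t => deriv f t * deriv f t) (g := fun t => 2 * c * deriv f t)
      hi2 (hi1.const_mul _)
    rw [h1, h2, integral_const_mul, ← hint, integral_const, hvol, smul_eq_mul]
  rw [hexp] at h0
  have hd : 0 < y - x := sub_pos.2 hlt
  have hc2 : c * (y - x) = f y - f x := by rw [hc]; field_simp
  rw [← hc2] at h0 ⊢
  nlinarith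

end MemH1Interval

/-! ### Topology of metric graphs -/

namespace MetricGraph

variable {G : MetricGraph} {X : Type*}

/-- The coordinate of an endpoint on its edge. -/
noncomputable def pos (G : MetricGraph) (a : G.E × Bool) : ℝ := if a.2 then G.len a.1 else 0

/-- The vertex to which an edge endpoint belongs. -/
noncomputable def vertex (G : MetricGraph) (a : G.E × Bool) : G.Point := G.pt a.1 (G.pos a)

@[simp] theorem pos_false (e : G.E) : G.pos (e, false) = 0 := rfl

@[simp] theorem pos_true (e : G.E) : G.pos (e, true) = G.len e := rfl

theorem pos_mem (a : G.E × Bool) : G.pos a ∈ Icc 0 (G.len a.1) := by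
  have := (G.len_pos a.1).le
  unfold pos
  split_ifs <;> constructor <;> linarith

theorem zero_mem (e : G.E) : (0 : ℝ) ∈ Icc 0 (G.len e) := ⟨le_rfl, (G.len_pos e).le⟩

theorem len_mem (e : G.E) : G.len e ∈ Icc 0 (G.len e) := ⟨(G.len_pos e).le, le_rfl⟩

theorem pt_of_mem {e : G.E} {x : ℝ} (hx : x ∈ Icc 0 (G.len e)) :
    G.pt e x = Quotient.mk G.pointSetoid ⟨e, ⟨x, hx⟩⟩ := by
  unfold pt
  rw [projIcc_of_mem _ hx]

theorem mk_endpoint (a : G.E × Bool) :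
    Quotient.mk G.pointSetoid (G.endpoint a) = G.vertex a :=
  (pt_of_mem (G.pos_mem a)).symm

theorem exists_pt (p : G.Point) : ∃ e, ∃ x ∈ Icc 0 (G.len e), G.pt e x = p := by
  induction p using Quotient.inductionOn with
  | h q =>
    obtain ⟨e, x, hx⟩ := q
    exact ⟨e, x, hx, pt_of_mem hx⟩

theorem continuous_mk : Continuous (Quotient.mk G.pointSetoid : G.EdgePoint → G.Point) :=
  continuous_quot_mk

theorem continuous_pt (G : MetricGraph) (e : G.E) : Continuous (G.pt e) :=
  continuous_mk.comp (continuous_sigmaMk.comp continuous_projIcc)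

instance : CompactSpace G.Point := inferInstanceAs (CompactSpace (Quotient G.pointSetoid))

theorem vertex_eq_of_glue {a b : G.E × Bool} (h : G.glue a b) : G.vertex a = G.vertex b := by
  rw [← mk_endpoint, ← mk_endpoint]
  exact Quotient.sound (s := G.pointSetoid) (Or.inr ⟨a, b, h, rfl, rfl⟩)

theorem pt_eq_pt {e f : G.E} {x y : ℝ} (hx : x ∈ Icc 0 (G.len e)) (hy : y ∈ Icc 0 (G.len f))
    (h : G.pt e x = G.pt f y) :
    (e = f ∧ x = y) ∨ ∃ b c, G.glue (e, b) (f, c) ∧ x = G.pos (e, b) ∧ y = G.pos (f, c) := by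
  rw [pt_of_mem hx, pt_of_mem hy] at h
  rcases Quotient.exact (s := G.pointSetoid) h with h | ⟨⟨a, b⟩, ⟨c, d⟩, hab, ha, hb⟩
  · left
    obtain ⟨rfl, h2⟩ := Sigma.mk.inj h
    exact ⟨rfl, congrArg Subtype.val (eq_of_heq h2)⟩
  · right
    obtain ⟨rfl, h2⟩ := Sigma.mk.inj ha
    obtain ⟨rfl, h3⟩ := Sigma.mk.inj hb
    exact ⟨b, d, hab, (congrArg Subtype.val (eq_of_heq h2)).symm,
      (congrArg Subtype.val (eq_of_heq h3)).symm⟩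

theorem pos_notMem_Ioo (a : G.E × Bool) : G.pos a ∉ Ioo 0 (G.len a.1) := by
  unfold pos
  split_ifs <;> simp

theorem pt_eq_pt_of_mem_Ioo {e f : G.E} {x y : ℝ} (hx : x ∈ Ioo 0 (G.len e))
    (hy : y ∈ Icc 0 (G.len f)) (h : G.pt e x = G.pt f y) : e = f ∧ x = y := by
  rcases pt_eq_pt (Ioo_subset_Icc_self hx) hy h with h | ⟨b, c, -, rfl, -⟩
  · exact h
  · exact absurd hx (pos_notMem_Ioo _)

theorem eq_pos_of_notMem_Ioo {e : G.E} {x : ℝ} (hx : x ∈ Icc 0 (G.len e))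
    (h : x ∉ Ioo 0 (G.len e)) : ∃ b, x = G.pos (e, b) := by
  by_cases h0 : x = 0
  · exact ⟨false, h0⟩
  · refine ⟨true, ?_⟩
    by_contra h1
    exact h ⟨lt_of_le_of_ne hx.1 (Ne.symm h0), lt_of_le_of_ne hx.2 h1⟩

/-- Every point lies in the interior of an edge or is a vertex. -/
theorem pt_or_vertex (p : G.Point) :
    (∃ e, ∃ x ∈ Ioo 0 (G.len e), G.pt e x = p) ∨ ∃ a, G.vertex a = p := by
  obtain ⟨e, x, hx, rfl⟩ := exists_pt p
  by_cases h : x ∈ Ioo 0 (G.len e)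
  · exact Or.inl ⟨e, x, h, rfl⟩
  · obtain ⟨b, rfl⟩ := eq_pos_of_notMem_Ioo hx h
    exact Or.inr ⟨(e, b), rfl⟩

theorem continuous_of_continuousOn_pt [TopologicalSpace X] {u : G.Point → X}
    (h : ∀ e, ContinuousOn (fun x => u (G.pt e x)) (Icc 0 (G.len e))) : Continuous u := by
  refine (isQuotientMap_quotient_mk' (s := G.pointSetoid)).continuous_iff.2 ?_
  refine continuous_sigma fun e => ?_
  have h1 := continuousOn_iff_continuous_domRestrict.1 (h e)
  convert h1 using 1
  ext x
  simp only [domRestrict_apply, pt_of_mem x.2]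
  rfl

/-- A set is closed if its trace on every edge is closed in the coordinate. -/
theorem isClosed_of_preimage {A : Set G.Point}
    (h : ∀ e, IsClosed {x : ℝ | x ∈ Icc 0 (G.len e) ∧ G.pt e x ∈ A}) : IsClosed A := by
  refine (isQuotientMap_quotient_mk' (s := G.pointSetoid)).isClosed_preimage.1 ?_
  refine isClosed_sigma_iff.2 fun e => ?_
  convert (h e).preimage (continuous_subtype_val) using 1
  ext x
  simp only [mem_preimage, mem_ofPred_eq, x.2, true_and, pt_of_mem x.2]
  rfl

theorem isCompact_edgeSet (e : G.E) : IsCompact (G.edgeSet e) :=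
  isCompact_Icc.image (G.continuous_pt e)

theorem pt_mem_edgeSet (e : G.E) (x : ℝ) : G.pt e x ∈ G.edgeSet e := by
  refine ⟨projIcc 0 (G.len e) (G.len_pos e).le x, (projIcc _ _ _ x).2, ?_⟩
  unfold pt
  rw [projIcc_val]

/-- The points of a set of edges. -/
def edgesSet (G : MetricGraph) (T : Set G.E) : Set G.Point := ⋃ e ∈ T, G.edgeSet e

theorem mem_edgesSet {T : Set G.E} {p : G.Point} :
    p ∈ G.edgesSet T ↔ ∃ e ∈ T, ∃ x ∈ Icc 0 (G.len e), G.pt e x = p := by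
  simp only [edgesSet, mem_iUnion, edgeSet, mem_image, exists_prop]

theorem pt_mem_edgesSet {T : Set G.E} {e : G.E} (he : e ∈ T) (x : ℝ) :
    G.pt e x ∈ G.edgesSet T :=
  mem_iUnion₂.2 ⟨e, he, G.pt_mem_edgeSet e x⟩

/-- A set of edges that share vertices only with each other is a union of components. -/
theorem isClopen_edgesSet {T : Set G.E}
    (hT : ∀ a b : G.E × Bool, G.glue a b → a.1 ∈ T → b.1 ∈ T) :
    IsClopen (G.edgesSet T) ∧ ∀ e x, G.pt e x ∈ G.edgesSet T → e ∈ T := by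
  have key : ∀ (T : Set G.E), (∀ a b : G.E × Bool, G.glue a b → a.1 ∈ T → b.1 ∈ T) →
      ∀ e, ∀ x, G.pt e x ∈ G.edgesSet T → e ∈ T := by
    intro T hT e x h
    obtain ⟨f, hf, y, hy, h⟩ := mem_edgesSet.1 h
    obtain ⟨z, hz, hz2⟩ := G.pt_mem_edgeSet e x
    rw [← hz2] at h
    rcases pt_eq_pt hy hz h with ⟨rfl, -⟩ | ⟨b, c, hbc, -, -⟩
    · exact hf
    · exact hT _ _ hbc hf
  have key2 : ∀ (T : Set G.E), (∀ a b : G.E × Bool, G.glue a b → a.1 ∈ T → b.1 ∈ T) →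
      IsClosed (G.edgesSet T) := by
    intro T hT
    exact T.toFinite.isClosed_biUnion fun e _ => by
      refine isClosed_of_preimage fun f => ?_
      by_cases h : f = e
      · subst h
        convert isClosed_Icc (a := (0 : ℝ)) (b := G.len f) using 1
        ext x
        simp [G.pt_mem_edgeSet f x]
      · refine (Set.Finite.subset (s := {0, G.len f}) (by simp) ?_).isClosed
        rintro x ⟨hx, y, hy, hxy⟩
        rcases pt_eq_pt hx hy hxy.symm with ⟨h1, -⟩ | ⟨b, c, -, h1, -⟩
        · exact absurd h1 h
        · rw [h1]; cases b <;> simp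
  have hcompl : (G.edgesSet T)ᶜ = G.edgesSet Tᶜ := by
    have hT2 : ∀ a b : G.E × Bool, G.glue a b → a.1 ∈ Tᶜ → b.1 ∈ Tᶜ := fun a b h ha hb =>
      ha (hT _ _ (G.glue.symm h) hb)
    ext p
    obtain ⟨e, x, hx, rfl⟩ := exists_pt p
    constructor
    · intro h
      by_cases he : e ∈ T
      · exact absurd (pt_mem_edgesSet he x) h
      · exact pt_mem_edgesSet (T := Tᶜ) he x
    · intro h h2
      exact key _ hT2 _ _ h (key _ hT _ _ h2)
  refine ⟨⟨key2 T hT, ?_⟩, key T hT⟩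
  rw [← isClosed_compl_iff, hcompl]
  exact key2 _ fun a b h ha hb => ha (hT _ _ (G.glue.symm h) hb)

/-! ### Functions given edge by edge -/

/-- The function on a graph that is given by a formula on each edge. -/
noncomputable def edgewise (G : MetricGraph) (f : G.E → ℝ → X)
    (h : ∀ a b : G.E × Bool, G.glue a b → f a.1 (G.pos a) = f b.1 (G.pos b)) : G.Point → X :=
  Quotient.lift (fun p : G.EdgePoint => f p.1 p.2) (by
    rintro p q (rfl | ⟨a, b, hab, rfl, rfl⟩)
    · rfl
    · exact h a b hab)

theorem edgewise_pt {f : G.E → ℝ → X}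
    {h : ∀ a b : G.E × Bool, G.glue a b → f a.1 (G.pos a) = f b.1 (G.pos b)} {e : G.E} {x : ℝ}
    (hx : x ∈ Icc 0 (G.len e)) : G.edgewise f h (G.pt e x) = f e x := by
  rw [pt_of_mem hx]
  rfl

theorem continuous_edgewise [TopologicalSpace X] {f : G.E → ℝ → X}
    {h : ∀ a b : G.E × Bool, G.glue a b → f a.1 (G.pos a) = f b.1 (G.pos b)}
    (hf : ∀ e, ContinuousOn (f e) (Icc 0 (G.len e))) : Continuous (G.edgewise f h) :=
  continuous_of_continuousOn_pt fun e => (hf e).congr fun _ hx => edgewise_pt hx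

open Classical in
/-- The function that is given by `g` on the edge `e` and vanishes on all other edges. -/
noncomputable def onSingleEdge (G : MetricGraph) (e : G.E) (g : ℝ → ℝ) (h0 : g 0 = 0)
    (h1 : g (G.len e) = 0) : G.Point → ℝ :=
  G.edgewise (fun e' x => if e' = e then g x else 0) (by
    have : ∀ a : G.E × Bool, (if a.1 = e then g (G.pos a) else 0) = 0 := by
      rintro ⟨a, b⟩
      split_ifs with h
      · simp only at h
        subst h
        cases b <;> simpa
      · rfl
    intro a b _
    rw [this, this])

theorem onSingleEdge_self {e : G.E} {g : ℝ → ℝ} {h0 : g 0 = 0} {h1 : g (G.len e) = 0} {x : ℝ}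
    (hx : x ∈ Icc 0 (G.len e)) : G.onSingleEdge e g h0 h1 (G.pt e x) = g x := by
  rw [onSingleEdge, edgewise_pt hx, if_pos rfl]

theorem onSingleEdge_of_ne {e f : G.E} {g : ℝ → ℝ} {h0 : g 0 = 0} {h1 : g (G.len e) = 0} {x : ℝ}
    (hx : x ∈ Icc 0 (G.len f)) (h : f ≠ e) : G.onSingleEdge e g h0 h1 (G.pt f x) = 0 := by
  rw [onSingleEdge, edgewise_pt hx, if_neg h]

theorem onSingleEdge_vertex {e : G.E} {g : ℝ → ℝ} {h0 : g 0 = 0} {h1 : g (G.len e) = 0}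
    (a : G.E × Bool) : G.onSingleEdge e g h0 h1 (G.vertex a) = 0 := by
  obtain ⟨f, b⟩ := a
  by_cases h : f = e
  · subst h
    refine (onSingleEdge_self (pos_mem (f, b))).trans ?_
    cases b <;> simpa
  · exact onSingleEdge_of_ne (pos_mem _) h

theorem continuous_onSingleEdge {e : G.E} {g : ℝ → ℝ} {h0 : g 0 = 0} {h1 : g (G.len e) = 0}
    (hg : ContinuousOn g (Icc 0 (G.len e))) : Continuous (G.onSingleEdge e g h0 h1) :=
  continuous_edgewise fun f => by
    by_cases h : f = e
    · subst h; simp only [if_true]; exact hg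
    · simp only [h, if_false]; exact continuousOn_const

/-- The function that is affine on each edge, with given values at the vertices. -/
noncomputable def affine (G : MetricGraph) (α : G.E × Bool → ℝ)
    (h : ∀ a b, G.glue a b → α a = α b) : G.Point → ℝ :=
  G.edgewise (fun e x => α (e, false) + (α (e, true) - α (e, false)) / G.len e * x) (by
    have : ∀ a : G.E × Bool,
        α (a.1, false) + (α (a.1, true) - α (a.1, false)) / G.len a.1 * G.pos a = α a := by
      rintro ⟨e, b⟩
      have := (G.len_pos e).ne'
      cases b
      · simp
      · simp only [pos_true]; field_simp; ring
    intro a b hab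
    rw [this, this, h a b hab])

theorem affine_pt {α : G.E × Bool → ℝ} {h : ∀ a b, G.glue a b → α a = α b} {e : G.E} {x : ℝ}
    (hx : x ∈ Icc 0 (G.len e)) : G.affine α h (G.pt e x) =
      α (e, false) + (α (e, true) - α (e, false)) / G.len e * x := by
  rw [affine, edgewise_pt hx]

theorem affine_vertex {α : G.E × Bool → ℝ} {h : ∀ a b, G.glue a b → α a = α b}
    (a : G.E × Bool) : G.affine α h (G.vertex a) = α a := by
  obtain ⟨e, b⟩ := a
  rw [vertex, affine, edgewise_pt (pos_mem _)]
  have := (G.len_pos e).ne'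
  cases b
  · simp
  · simp only [pos_true]; field_simp; ring

theorem continuous_affine {α : G.E × Bool → ℝ} {h : ∀ a b, G.glue a b → α a = α b} :
    Continuous (G.affine α h) :=
  continuous_edgewise fun e => by fun_prop

open Classical in
/-- Points are separated by continuous functions: bumps on a single edge for interior points, and
edgewise affine functions for vertices. -/
instance : T2Space G.Point := by
  have key : ∀ p q : G.Point, p ≠ q → ∃ f : G.Point → ℝ, Continuous f ∧ f p ≠ f q := by
    have hint : ∀ (e : G.E) (x : ℝ) (q : G.Point), x ∈ Ioo 0 (G.len e) → G.pt e x ≠ q →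
        ∃ f : G.Point → ℝ, Continuous f ∧ f (G.pt e x) ≠ f q := by
      intro e x q hx hpq
      obtain ⟨f, y, hy, rfl⟩ := exists_pt q
      have hxp : 0 < x * (G.len e - x) := mul_pos hx.1 (sub_pos.2 hx.2)
      let B1 := G.onSingleEdge e (fun x => x * (G.len e - x)) (by simp) (by simp)
      let B2 := G.onSingleEdge e (fun x => x * (x * (G.len e - x))) (by simp) (by simp)
      have hB1 : Continuous B1 := continuous_onSingleEdge (Continuous.continuousOn (by fun_prop))
      have hB2 : Continuous B2 := continuous_onSingleEdge (Continuous.continuousOn (by fun_prop))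
      have hB1x : B1 (G.pt e x) = x * (G.len e - x) := onSingleEdge_self (Ioo_subset_Icc_self hx)
      have hB2x : B2 (G.pt e x) = x * (x * (G.len e - x)) :=
        onSingleEdge_self (Ioo_subset_Icc_self hx)
      by_cases hfe : f = e
      · subst hfe
        have hB1y : B1 (G.pt f y) = y * (G.len f - y) := onSingleEdge_self hy
        have hB2y : B2 (G.pt f y) = y * (y * (G.len f - y)) := onSingleEdge_self hy
        by_contra! hcon
        have h1 := hcon B1 hB1
        have h2 := hcon B2 hB2
        rw [hB1x, hB1y] at h1
        rw [hB2x, hB2y, ← h1] at h2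
        exact hpq (by rw [mul_right_cancel₀ hxp.ne' h2])
      · refine ⟨B1, hB1, ?_⟩
        rw [hB1x, show B1 (G.pt f y) = 0 from onSingleEdge_of_ne hy hfe]
        exact hxp.ne'
    intro p q hpq
    rcases pt_or_vertex p with ⟨e, x, hx, rfl⟩ | ⟨a, rfl⟩
    · exact hint e x q hx hpq
    rcases pt_or_vertex q with ⟨e, x, hx, rfl⟩ | ⟨b, rfl⟩
    · obtain ⟨f, hf, hf2⟩ := hint e x _ hx hpq.symm
      exact ⟨f, hf, hf2.symm⟩
    refine ⟨G.affine (fun c => if G.glue a c then 1 else 0) ?_, continuous_affine, ?_⟩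
    · intro c d hcd
      have : G.glue a c ↔ G.glue a d :=
        ⟨fun h => G.glue.trans h hcd, fun h => G.glue.trans h (G.glue.symm hcd)⟩
      simp [this]
    · rw [affine_vertex, affine_vertex, if_pos (G.glue.refl a),
        if_neg fun h => hpq (vertex_eq_of_glue h)]
      exact one_ne_zero
  refine ⟨fun p q hpq => ?_⟩
  obtain ⟨f, hf, hf2⟩ := key p q hpq
  exact separated_by_continuous hf hf2

/-! ### Connected components -/

theorem mk_pt (e : G.E) (x : ℝ) :
    ConnectedComponents.mk (G.pt e x) = ConnectedComponents.mk (G.pt e 0) := by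
  rw [ConnectedComponents.coe_eq_coe']
  exact (isPreconnected_range (G.continuous_pt e)).subset_connectedComponent ⟨0, rfl⟩ ⟨x, rfl⟩

theorem mk_vertex (a : G.E × Bool) :
    ConnectedComponents.mk (G.vertex a) = ConnectedComponents.mk (G.pt a.1 0) :=
  mk_pt _ _

theorem mem_componentSet_pt {c : ConnectedComponents G.Point} {e : G.E} {x : ℝ} :
    G.pt e x ∈ G.componentSet c ↔ e ∈ G.componentEdges c := by
  simp only [componentSet, componentEdges, mem_ofPred_eq, mk_pt]

theorem componentSet_eq (c : ConnectedComponents G.Point) :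
    G.componentSet c = G.edgesSet (G.componentEdges c) := by
  ext p
  constructor
  · intro h
    obtain ⟨e, x, hx, rfl⟩ := exists_pt p
    exact pt_mem_edgesSet (mem_componentSet_pt.1 h) x
  · intro h
    obtain ⟨e, he, x, -, rfl⟩ := mem_edgesSet.1 h
    exact mem_componentSet_pt.2 he

theorem componentEdges_glue (c : ConnectedComponents G.Point) (a b : G.E × Bool)
    (h : G.glue a b) (ha : a.1 ∈ G.componentEdges c) : b.1 ∈ G.componentEdges c := by
  have h1 := vertex_eq_of_glue h
  rw [← mem_componentSet_pt (x := G.pos b)]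
  change G.vertex b ∈ _
  rw [← h1]
  exact mem_componentSet_pt.2 ha

theorem isClopen_componentSet (c : ConnectedComponents G.Point) : IsClopen (G.componentSet c) := by
  rw [componentSet_eq]
  exact (isClopen_edgesSet (componentEdges_glue c)).1

theorem componentSet_mk (p : G.Point) :
    G.componentSet (ConnectedComponents.mk p) = connectedComponent p := by
  ext q
  simp only [componentSet, mem_ofPred_eq, ConnectedComponents.coe_eq_coe']

theorem componentSet_nonempty (c : ConnectedComponents G.Point) : (G.componentSet c).Nonempty := by
  obtain ⟨p, rfl⟩ := ConnectedComponents.surjective_coe c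
  exact ⟨p, rfl⟩

instance : Finite (ConnectedComponents G.Point) := by
  refine Finite.of_surjective (fun e : G.E => ConnectedComponents.mk (G.pt e 0)) fun c => ?_
  obtain ⟨p, rfl⟩ := ConnectedComponents.surjective_coe c
  obtain ⟨e, x, -, rfl⟩ := exists_pt p
  exact ⟨e, (mk_pt e x).symm⟩

end MetricGraph

/-! ### The space `H¹` of a metric graph and its forms -/

namespace MetricGraph

variable {G : MetricGraph} {u v w : G.Point → ℝ}

theorem continuous_onEdge (hu : Continuous u) (e : G.E) : Continuous (G.onEdge u e) :=
  hu.comp (G.continuous_pt e)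

theorem memLp_onEdge (hu : Continuous u) (e : G.E) :
    MemLp (G.onEdge u e) 2 (volume.restrict (Ioo 0 (G.len e))) :=
  MemH1Interval.memLp (continuous_onEdge hu e).continuousOn

namespace MemH1

theorem interval (hu : G.MemH1 u) (e : G.E) : MemH1Interval (G.len e) (G.onEdge u e) := hu.2 e

theorem add (hu : G.MemH1 u) (hv : G.MemH1 v) : G.MemH1 (u + v) :=
  ⟨hu.1.add hv.1, fun e => (hu.interval e).add (G.len_pos e).le (hv.interval e)⟩

theorem const_smul (c : ℝ) (hu : G.MemH1 u) : G.MemH1 (c • u) :=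
  ⟨hu.1.const_smul c, fun e => (hu.interval e).const_mul c⟩

theorem neg (hu : G.MemH1 u) : G.MemH1 (-u) := by
  rw [← neg_one_smul ℝ u]
  exact hu.const_smul _

theorem sub (hu : G.MemH1 u) (hv : G.MemH1 v) : G.MemH1 (u - v) := by
  rw [sub_eq_add_neg]
  exact hu.add hv.neg

theorem const (c : ℝ) : G.MemH1 (fun _ => c) :=
  ⟨continuous_const, fun _ => MemH1Interval.of_contDiff contDiff_const⟩

theorem abs (hu : G.MemH1 u) : G.MemH1 (fun p => |u p|) :=
  ⟨hu.1.abs, fun e => ((hu.interval e).abs (continuous_onEdge hu.1 e).continuousOn).1⟩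

theorem onSingleEdge {e : G.E} {g : ℝ → ℝ} {h0 : g 0 = 0} {h1 : g (G.len e) = 0}
    (hg : MemH1Interval (G.len e) g) : G.MemH1 (G.onSingleEdge e g h0 h1) := by
  refine ⟨continuous_onSingleEdge (hg.continuousOn (G.len_pos e).le), fun f => ?_⟩
  by_cases h : f = e
  · subst h
    exact hg.congr (G.len_pos f).le fun x hx => (onSingleEdge_self hx).symm
  · exact (MemH1Interval.of_contDiff (f := fun _ => 0) contDiff_const).congr (G.len_pos f).le
      fun x hx => (onSingleEdge_of_ne hx h).symm

theorem affine {α : G.E × Bool → ℝ} {h : ∀ a b, G.glue a b → α a = α b} :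
    G.MemH1 (G.affine α h) := by
  refine ⟨continuous_affine, fun e => ?_⟩
  refine (MemH1Interval.of_contDiff
    (f := fun x => α (e, false) + (α (e, true) - α (e, false)) / G.len e * x) ?_).congr
    (G.len_pos e).le fun x hx => (affine_pt hx).symm
  fun_prop

end MemH1

theorem form_comm (u v : G.Point → ℝ) : G.form u v = G.form v u := by
  simp only [form, mul_comm]

theorem innerL2_comm (u v : G.Point → ℝ) : G.innerL2 u v = G.innerL2 v u := by
  simp only [innerL2, mul_comm]

theorem form_eq (u v : G.Point → ℝ) : G.form u v =
    ∑ e, ∫ x in Ioo 0 (G.len e), deriv (G.onEdge u e) x * deriv (G.onEdge v e) x := by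
  simp only [form, integral_eq_integral_Ioo (G.len_pos _).le]

theorem innerL2_eq (u v : G.Point → ℝ) : G.innerL2 u v =
    ∑ e, ∫ x in Ioo 0 (G.len e), G.onEdge u e x * G.onEdge v e x := by
  simp only [innerL2, integral_eq_integral_Ioo (G.len_pos _).le]

theorem form_add_left (hu : G.MemH1 u) (hv : G.MemH1 v) (hw : G.MemH1 w) :
    G.form (u + v) w = G.form u w + G.form v w := by
  simp only [form_eq]
  rw [← Finset.sum_add_distrib]
  refine Finset.sum_congr rfl fun e _ => ?_
  rw [← integral_add (MemH1Interval.integrable_mul (hu.interval e).2 (hw.interval e).2)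
    (MemH1Interval.integrable_mul (hv.interval e).2 (hw.interval e).2)]
  refine integral_congr_ae ?_
  filter_upwards [(hu.interval e).deriv_add_ae (G.len_pos e).le (hv.interval e)] with x hx
  rw [← add_mul, ← hx]
  rfl

theorem form_smul_left (c : ℝ) (u w : G.Point → ℝ) :
    G.form (c • u) w = c * G.form u w := by
  simp only [form]
  rw [Finset.mul_sum]
  refine Finset.sum_congr rfl fun e _ => ?_
  rw [← intervalIntegral.integral_const_mul]
  have : G.onEdge (c • u) e = fun x => c * G.onEdge u e x := rfl
  rw [this, MemH1Interval.deriv_const_mul]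
  simp only [mul_assoc]

theorem innerL2_add_left (hu : Continuous u) (hv : Continuous v) (hw : Continuous w) :
    G.innerL2 (u + v) w = G.innerL2 u w + G.innerL2 v w := by
  simp only [innerL2]
  rw [← Finset.sum_add_distrib]
  refine Finset.sum_congr rfl fun e _ => ?_
  have h1 := intervalIntegral.integral_add (μ := volume) (a := 0) (b := G.len e)
    (f := fun x => G.onEdge u e x * G.onEdge w e x) (g := fun x => G.onEdge v e x * G.onEdge w e x)
    (((continuous_onEdge hu e).mul (continuous_onEdge hw e)).intervalIntegrable _ _)
    (((continuous_onEdge hv e).mul (continuous_onEdge hw e)).intervalIntegrable _ _)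
  rw [← h1]
  simp only [← add_mul]
  rfl

theorem innerL2_smul_left (c : ℝ) (u w : G.Point → ℝ) :
    G.innerL2 (c • u) w = c * G.innerL2 u w := by
  simp only [innerL2]
  rw [Finset.mul_sum]
  refine Finset.sum_congr rfl fun e _ => ?_
  rw [← intervalIntegral.integral_const_mul]
  simp only [← mul_assoc]
  rfl

theorem form_add_right (hu : G.MemH1 u) (hv : G.MemH1 v) (hw : G.MemH1 w) :
    G.form w (u + v) = G.form w u + G.form w v := by
  rw [form_comm, form_add_left hu hv hw, form_comm u, form_comm v]

theorem form_smul_right (c : ℝ) (u w : G.Point → ℝ) :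
    G.form w (c • u) = c * G.form w u := by
  rw [form_comm, form_smul_left, form_comm]

theorem innerL2_add_right (hu : Continuous u) (hv : Continuous v) (hw : Continuous w) :
    G.innerL2 w (u + v) = G.innerL2 w u + G.innerL2 w v := by
  rw [innerL2_comm, innerL2_add_left hu hv hw, innerL2_comm u, innerL2_comm v]

theorem innerL2_smul_right (c : ℝ) (u w : G.Point → ℝ) :
    G.innerL2 w (c • u) = c * G.innerL2 w u := by
  rw [innerL2_comm, innerL2_smul_left, innerL2_comm]

theorem form_add_smul_self (hu : G.MemH1 u) (hv : G.MemH1 v) (s : ℝ) :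
    G.form (u + s • v) (u + s • v) = G.form u u + 2 * s * G.form u v + s ^ 2 * G.form v v := by
  have hs := hv.const_smul s
  rw [form_add_left hu hs (hu.add hs), form_add_right hu hs hu, form_add_right hu hs hs,
    form_smul_left, form_smul_left, form_smul_right, form_smul_right, form_comm v u]
  ring

theorem innerL2_add_smul_self (hu : Continuous u) (hv : Continuous v) (s : ℝ) :
    G.innerL2 (u + s • v) (u + s • v) =
      G.innerL2 u u + 2 * s * G.innerL2 u v + s ^ 2 * G.innerL2 v v := by
  have hs : Continuous (s • v) := hv.const_smul s
  rw [innerL2_add_left hu hs (hu.add hs), innerL2_add_right hu hs hu, innerL2_add_right hu hs hs,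
    innerL2_smul_left, innerL2_smul_left, innerL2_smul_right, innerL2_smul_right,
    innerL2_comm v u]
  ring

theorem form_self_nonneg (u : G.Point → ℝ) : 0 ≤ G.form u u :=
  Finset.sum_nonneg fun e _ => intervalIntegral.integral_nonneg (G.len_pos e).le
    fun _ _ => mul_self_nonneg _

theorem innerL2_pos (hu : Continuous u) (hv : Continuous v) (h : ∀ p, 0 ≤ u p * v p)
    (h2 : ∃ p, 0 < u p * v p) : 0 < G.innerL2 u v := by
  obtain ⟨p, hp⟩ := h2
  obtain ⟨e, x, hx, rfl⟩ := exists_pt p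
  refine Finset.sum_pos' (fun e _ => intervalIntegral.integral_nonneg (G.len_pos e).le
    fun _ _ => h _) ⟨e, Finset.mem_univ _, ?_⟩
  exact intervalIntegral.integral_pos (G.len_pos e)
    ((continuous_onEdge hu e).mul (continuous_onEdge hv e)).continuousOn
    (fun _ _ => h _) ⟨x, hx, hp⟩

theorem innerL2_self_pos (hu : Continuous u) (h : u ≠ 0) : 0 < G.innerL2 u u := by
  obtain ⟨p, hp⟩ := Function.ne_iff.1 h
  exact innerL2_pos hu hu (fun _ => mul_self_nonneg _) ⟨p, mul_self_pos.2 hp⟩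

theorem form_abs_le (hu : G.MemH1 u) :
    G.form (fun p => |u p|) (fun p => |u p|) ≤ G.form u u := by
  simp only [form_eq]
  refine Finset.sum_le_sum fun e _ => ?_
  have h := (hu.interval e).abs (continuous_onEdge hu.1 e).continuousOn
  refine setIntegral_mono_on (MemH1Interval.integrable_mul h.1.2 h.1.2)
    (MemH1Interval.integrable_mul (hu.interval e).2 (hu.interval e).2) measurableSet_Ioo ?_
  intro x hx
  exact abs_le_iff_mul_self_le.1 (h.2 x hx)

theorem innerL2_abs (u : G.Point → ℝ) :
    G.innerL2 (fun p => |u p|) (fun p => |u p|) = G.innerL2 u u := by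
  simp only [innerL2, onEdge, abs_mul_abs_self]

theorem edge_le_form (u : G.Point → ℝ) (e : G.E) :
    ∫ x in (0 : ℝ)..G.len e, deriv (G.onEdge u e) x * deriv (G.onEdge u e) x ≤ G.form u u :=
  Finset.single_le_sum (f := fun e => ∫ x in (0 : ℝ)..G.len e,
    deriv (G.onEdge u e) x * deriv (G.onEdge u e) x)
    (fun e _ => intervalIntegral.integral_nonneg (G.len_pos e).le fun _ _ => mul_self_nonneg _)
    (Finset.mem_univ e)

theorem edge_le_innerL2 (u : G.Point → ℝ) (e : G.E) :
    ∫ x in (0 : ℝ)..G.len e, G.onEdge u e x * G.onEdge u e x ≤ G.innerL2 u u :=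
  Finset.single_le_sum (f := fun e => ∫ x in (0 : ℝ)..G.len e, G.onEdge u e x * G.onEdge u e x)
    (fun e _ => intervalIntegral.integral_nonneg (G.len_pos e).le fun _ _ => mul_self_nonneg _)
    (Finset.mem_univ e)

theorem sq_sub_le (hu : G.MemH1 u) {e : G.E} {x y : ℝ} (hx : x ∈ Icc 0 (G.len e))
    (hy : y ∈ Icc 0 (G.len e)) :
    (u (G.pt e y) - u (G.pt e x)) ^ 2 ≤ |y - x| * G.form u u :=
  ((hu.interval e).sq_sub_le (G.len_pos e).le hx hy).trans
    (mul_le_mul_of_nonneg_left (edge_le_form u e) (abs_nonneg _))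

/-- The embedding of `H¹` into the bounded functions. -/
theorem sq_le (hu : G.MemH1 u) {e : G.E} {x : ℝ} (hx : x ∈ Icc 0 (G.len e)) :
    u (G.pt e x) ^ 2 ≤ 2 / G.len e * G.innerL2 u u + 2 * G.len e * G.form u u := by
  have hL := G.len_pos e
  set A := G.form u u
  have hA : 0 ≤ A := form_self_nonneg u
  have h1 : ∀ y ∈ Icc 0 (G.len e),
      u (G.pt e x) ^ 2 - 2 * G.len e * A ≤ 2 * (G.onEdge u e y * G.onEdge u e y) := by
    intro y hy
    have h2 := sq_sub_le hu hy hx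
    have h3 : |x - y| ≤ G.len e := abs_le.2 ⟨by linarith [hx.1, hy.2], by linarith [hx.2, hy.1]⟩
    have h4 := mul_le_mul_of_nonneg_right h3 hA
    change _ ≤ 2 * (u (G.pt e y) * u (G.pt e y))
    nlinarith [sq_nonneg (u (G.pt e x) - 2 * u (G.pt e y))]
  have h2 := intervalIntegral.integral_mono_on hL.le (intervalIntegrable_const (μ := volume))
    (g := fun y => 2 * (G.onEdge u e y * G.onEdge u e y))
    ((continuous_const.mul ((continuous_onEdge hu.1 e).mul
      (continuous_onEdge hu.1 e))).intervalIntegrable (μ := volume) 0 (G.len e)) h1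
  rw [intervalIntegral.integral_const, intervalIntegral.integral_const_mul, smul_eq_mul,
    sub_zero] at h2
  have h3 := edge_le_innerL2 u e
  have h4 : G.len e * (u (G.pt e x) ^ 2 - 2 * G.len e * A) ≤ 2 * G.innerL2 u u := by linarith
  have h5 : u (G.pt e x) ^ 2 - 2 * G.len e * A ≤ 2 * G.innerL2 u u / G.len e := by
    rw [le_div_iff₀ hL]; linarith
  have h6 : 2 / G.len e * G.innerL2 u u = 2 * G.innerL2 u u / G.len e := by ring
  linarith

/-- On a connected graph, only the constants have zero energy. -/
theorem eq_const_of_form_eq_zero [ConnectedSpace G.Point] (hu : G.MemH1 u)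
    (h : G.form u u = 0) (p q : G.Point) : u p = u q := by
  have hloc : ∀ e x, x ∈ Icc 0 (G.len e) → u (G.pt e x) = u (G.pt e 0) := by
    intro e x hx
    have h1 := sq_sub_le hu (G.zero_mem e) hx
    rw [h, mul_zero] at h1
    exact sub_eq_zero.1 (pow_eq_zero_iff two_ne_zero |>.1 (le_antisymm h1 (sq_nonneg _)))
  -- a continuous function with finitely many values on a connected space is constant
  have hfin : (range u).Finite := by
    refine (finite_range fun e : G.E => u (G.pt e 0)).subset ?_
    rintro _ ⟨p, rfl⟩
    obtain ⟨e, x, hx, rfl⟩ := exists_pt p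
    exact ⟨e, (hloc e x hx).symm⟩
  by_contra hne
  exact (isPreconnected_range hu.1).infinite_of_nontrivial
    ⟨_, ⟨p, rfl⟩, _, ⟨q, rfl⟩, hne⟩ hfin

theorem form_const_left (c : ℝ) (u : G.Point → ℝ) : G.form (fun _ => c) u = 0 := by
  have : ∀ e, G.onEdge (fun _ => c) e = fun _ => c := fun _ => rfl
  simp [form, this]

end MetricGraph

/-! ### The direct method of the calculus of variations -/

namespace MetricGraph

variable {G : MetricGraph} {u v w : G.Point → ℝ}

/-- Boundedness in `H¹` implies uniform convergence of a subsequence, by the theorem of Arzelà and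
Ascoli: the Hölder bound `sq_sub_le` yields equicontinuity. The theorem is applied on the disjoint
union of the edges. -/
theorem exists_tendstoUniformly_subseq {u : ℕ → G.Point → ℝ} (hu : ∀ n, G.MemH1 (u n)) {M A : ℝ}
    (hM : ∀ n p, |u n p| ≤ M) (hA : ∀ n, G.form (u n) (u n) ≤ A) :
    ∃ (w : G.Point → ℝ) (φ : ℕ → ℕ), StrictMono φ ∧
      TendstoUniformly (fun n => u (φ n)) w atTop := by
  let F : ℕ → BoundedContinuousFunction G.EdgePoint ℝ := fun n =>
    BoundedContinuousFunction.mkOfCompact ⟨fun q => u n (Quotient.mk G.pointSetoid q),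
      (hu n).1.comp continuous_mk⟩
  have hFapp : ∀ n q, F n q = u n (Quotient.mk G.pointSetoid q) := fun _ _ => rfl
  have hcomp : IsCompact (closure (range F)) := by
    refine BoundedContinuousFunction.arzela_ascoli (Icc (-M) M) isCompact_Icc _ ?_ ?_
    · rintro _ q ⟨n, rfl⟩
      exact abs_le.1 (hM n _)
    · rintro ⟨e, x⟩
      rw [Metric.equicontinuousAt_iff_right]
      intro ε hε
      have hA1 : 0 < |A| + 1 := by positivity
      have hev : ∀ᶠ y : Icc (0 : ℝ) (G.len e) in 𝓝 x, |(y : ℝ) - x| * (|A| + 1) < ε ^ 2 := by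
        have hc : Continuous fun y : Icc (0 : ℝ) (G.len e) => |(y : ℝ) - x| * (|A| + 1) := by
          fun_prop
        refine hc.continuousAt.eventually_lt continuousAt_const ?_
        simp only [sub_self, abs_zero, zero_mul]
        positivity
      rw [Sigma.nhds_mk]
      refine Filter.eventually_map.2 ?_
      filter_upwards [hev]
      rintro y hy ⟨_, n, rfl⟩
      have h1 := sq_sub_le (hu n) y.2 x.2
      rw [pt_of_mem y.2, pt_of_mem x.2] at h1
      change dist (u n _) (u n _) < ε
      rw [Real.dist_eq]
      refine abs_lt_of_sq_lt_sq ?_ hε.le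
      refine h1.trans_lt (lt_of_le_of_lt ?_ hy)
      rw [abs_sub_comm]
      exact mul_le_mul_of_nonneg_left (by linarith [hA n, le_abs_self A]) (abs_nonneg _)
  obtain ⟨g, -, φ, hφ, hlim⟩ := hcomp.tendsto_subseq fun n => subset_closure ⟨n, rfl⟩
  rw [tendsto_iff_norm_sub_tendsto_zero] at hlim
  have hu_lim : ∀ ε > 0, ∀ᶠ n in atTop, ∀ q, |F (φ n) q - g q| < ε := by
    intro ε hε
    filter_upwards [hlim.eventually_lt_const hε] with n hn q
    exact lt_of_le_of_lt ((F (φ n) - g).norm_coe_le_norm q) hn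
  refine ⟨fun p => g (Quotient.out (s := G.pointSetoid) p), φ, hφ, ?_⟩
  rw [Metric.tendstoUniformly_iff]
  intro ε hε
  filter_upwards [hu_lim ε hε] with n hn p
  have h1 := hn (Quotient.out (s := G.pointSetoid) p)
  have h2 : Quotient.mk G.pointSetoid (Quotient.out (s := G.pointSetoid) p) = p :=
    Quotient.out_eq (s := G.pointSetoid) p
  rw [hFapp, h2] at h1
  rw [dist_comm]
  exact h1

/-- Uniform convergence implies convergence of the `L²` norms. -/
theorem tendsto_innerL2 {u : ℕ → G.Point → ℝ} (hu : ∀ n, Continuous (u n))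
    (h : TendstoUniformly u w atTop) :
    Tendsto (fun n => G.innerL2 (u n) (u n)) atTop (𝓝 (G.innerL2 w w)) := by
  have hw : Continuous w := h.continuous (Frequently.of_forall hu)
  refine tendsto_finsetSum _ fun e _ => ?_
  have h2 : TendstoUniformly (fun n x => G.onEdge (u n) e x) (G.onEdge w e) atTop :=
    h.comp (G.pt e)
  have hwc := continuous_onEdge hw e
  obtain ⟨C, hC⟩ := (isCompact_Icc (a := (0 : ℝ)) (b := G.len e)).exists_bound_of_continuousOn
    hwc.continuousOn
  have hev : ∀ᶠ n in atTop, ∀ x, dist (G.onEdge w e x) (G.onEdge (u n) e x) < 1 :=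
    Metric.tendstoUniformly_iff.1 h2 1 one_pos
  refine intervalIntegral.tendsto_integral_filter_of_dominated_convergence
    (fun _ => (C + 1) * (C + 1)) ?_ ?_ ?_ ?_
  · exact Eventually.of_forall fun n =>
      ((continuous_onEdge (hu n) e).mul (continuous_onEdge (hu n) e)).aestronglyMeasurable
  · filter_upwards [hev] with n hn
    refine Eventually.of_forall fun x hx => ?_
    rw [uIoc_of_le (G.len_pos e).le] at hx
    have h3 : ‖G.onEdge (u n) e x‖ ≤ C + 1 := by
      have h4 := hC x (Ioc_subset_Icc_self hx)
      have h5 := hn x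
      rw [dist_comm, dist_eq_norm] at h5
      have := norm_add_le (G.onEdge (u n) e x - G.onEdge w e x) (G.onEdge w e x)
      rw [sub_add_cancel] at this
      linarith
    rw [norm_mul]
    exact mul_le_mul h3 h3 (norm_nonneg _) ((norm_nonneg _).trans h3)
  · exact intervalIntegrable_const
  · exact Eventually.of_forall fun x _ => (h2.tendsto_at x).mul (h2.tendsto_at x)

/-- A uniformly convergent sequence in `H¹` whose derivatives form a Cauchy sequence in `L²`
converges in `H¹`: the fundamental theorem of calculus identifies the `L²` limit of the derivatives
as the derivative of the uniform limit. -/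
theorem memH1_of_cauchy {u : ℕ → G.Point → ℝ} (hu : ∀ n, G.MemH1 (u n))
    (h : TendstoUniformly u w atTop)
    (hA : ∀ ε > 0, ∃ N, ∀ m ≥ N, ∀ n ≥ N, G.form (u m - u n) (u m - u n) < ε) :
    G.MemH1 w ∧ Tendsto (fun n => G.form (u n) (u n)) atTop (𝓝 (G.form w w)) := by
  have hw : Continuous w := h.continuous (Frequently.of_forall fun n => (hu n).1)
  let D : ∀ e, ℕ → Lp ℝ 2 (volume.restrict (Ioo 0 (G.len e))) :=
    fun e n => ((hu n).interval e).2.toLp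
  have hnorm : ∀ e (f : Lp ℝ 2 (volume.restrict (Ioo 0 (G.len e)))) (k : ℝ → ℝ),
      f =ᵐ[volume.restrict (Ioo 0 (G.len e))] k →
      ‖f‖ ^ 2 = ∫ x in (0 : ℝ)..G.len e, k x * k x := by
    intro e f k hk
    rw [← real_inner_self_eq_norm_sq, L2.inner_def, integral_eq_integral_Ioo (G.len_pos e).le]
    refine integral_congr_ae ?_
    filter_upwards [hk] with x hx
    rw [hx]
    rfl
  have hcauchy : ∀ e, CauchySeq (D e) := by
    intro e
    rw [Metric.cauchySeq_iff]
    intro ε hε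
    obtain ⟨N, hN⟩ := hA (ε ^ 2) (by positivity)
    refine ⟨N, fun m hm n hn => ?_⟩
    rw [dist_eq_norm]
    refine lt_of_pow_lt_pow_left₀ 2 hε.le (lt_of_le_of_lt ?_ (hN m hm n hn))
    rw [hnorm e _ (deriv (G.onEdge (u m - u n) e)) ?_]
    · exact edge_le_form _ e
    · have h3 : G.onEdge (u m) e = fun x => G.onEdge (u m - u n) e x + G.onEdge (u n) e x := by
        ext x
        simp [onEdge]
      have h4 := (((hu m).sub (hu n)).interval e).deriv_add_ae (G.len_pos e).le ((hu n).interval e)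
      rw [← h3] at h4
      filter_upwards [Lp.coeFn_sub (D e m) (D e n), ((hu m).interval e).2.coeFn_toLp,
        ((hu n).interval e).2.coeFn_toLp, h4] with x h5 h6 h7 h8
      rw [h5, Pi.sub_apply, h6, h7, h8]
      ring
  choose g hg using fun e => cauchySeq_tendsto_of_complete (hcauchy e)
  have hint : ∀ e, ∀ x ∈ Icc 0 (G.len e),
      G.onEdge w e x = G.onEdge w e 0 + ∫ t in (0 : ℝ)..x, g e t := by
    intro e x hx
    have hT : Tendsto (fun n => ∫ t in (0 : ℝ)..x, deriv (G.onEdge (u n) e) t) atTop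
        (𝓝 (∫ t in (0 : ℝ)..x, g e t)) := by
      have hsub : Ioc 0 x ⊆ Ioc 0 (G.len e) := Ioc_subset_Ioc_right hx.2
      -- integration over `(0, x)` is the inner product with an indicator function
      have hIeq : ∀ f : Lp ℝ 2 (volume.restrict (Ioo 0 (G.len e))),
          ∫ t in (0 : ℝ)..x, f t = inner ℝ (indicatorConstLp 2 (measurableSet_Ioc (a := 0) (b := x))
            (measure_ne_top (volume.restrict (Ioo 0 (G.len e))) _) (1 : ℝ)) f := by
        intro f
        rw [L2.inner_indicatorConstLp_one, intervalIntegral.integral_of_le hx.1,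
          Measure.restrict_restrict measurableSet_Ioc]
        refine setIntegral_congr_set ?_
        have h6 : Ioc 0 x ∩ Ioc 0 (G.len e) = Ioc 0 x := inter_eq_left.2 hsub
        have h7 : (Ioc 0 x ∩ Ioo 0 (G.len e) : Set ℝ) =ᵐ[volume]
            (Ioc 0 x ∩ Ioc 0 (G.len e) : Set ℝ) :=
          (ae_eq_refl _).inter Ioo_ae_eq_Ioc
        rw [h6] at h7
        exact h7.symm
      have hconv := (continuous_const.inner continuous_id (𝕜 := ℝ)
        (f := fun _ : Lp ℝ 2 (volume.restrict (Ioo 0 (G.len e))) =>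
          indicatorConstLp 2 (measurableSet_Ioc (a := 0) (b := x))
            (measure_ne_top (volume.restrict (Ioo 0 (G.len e))) _) (1 : ℝ))).continuousAt.tendsto
        |>.comp (hg e)
      simp only [Function.comp_def, id, ← hIeq] at hconv
      refine hconv.congr fun n => ?_
      refine intervalIntegral.integral_congr_ae ?_
      have h8 := ((hu n).interval e).2.coeFn_toLp
      rw [Filter.EventuallyEq, ae_restrict_iff' measurableSet_Ioo] at h8
      have h9 : ∀ᵐ t : ℝ, t ≠ G.len e := by simp [ae_iff]
      filter_upwards [h8, h9] with t ht ht2 ht3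
      rw [uIoc_of_le hx.1] at ht3
      exact ht ⟨ht3.1, lt_of_le_of_ne (ht3.2.trans hx.2) ht2⟩
    have hp1 := (h.tendsto_at (G.pt e x)).sub (h.tendsto_at (G.pt e 0))
    have := tendsto_nhds_unique hT (hp1.congr fun n =>
      (((hu n).interval e).integral_deriv (G.zero_mem e) hx).symm)
    rw [this]
    simp [onEdge]
  have hH := fun e => MemH1Interval.of_integral (G.len_pos e) (Lp.memLp (g e)) (hint e)
  refine ⟨⟨hw, fun e => (hH e).1⟩, ?_⟩
  refine tendsto_finsetSum _ fun e _ => ?_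
  rw [← hnorm e (g e) _ (hH e).2.symm]
  refine ((hg e).norm.pow 2).congr fun n => ?_
  exact hnorm e _ _ ((hu n).interval e).2.coeFn_toLp

/-- The Rayleigh quotient attains its infimum on every nonzero subspace of `H¹` that is closed
under uniform limits.

A normalized minimizing sequence is bounded in `H¹`, and hence has a uniformly convergent
subsequence `u n`. By the parallelogram identity for the form and the bound
`a(u k + u n, u k + u n) ≥ m ‖u k + u n‖²`, its derivatives form a Cauchy sequence in `L²`. -/
theorem exists_minimizer (V : Submodule ℝ (G.Point → ℝ)) (hV : ∀ v ∈ V, G.MemH1 v)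
    (hclosed : ∀ (u : ℕ → G.Point → ℝ) (w : G.Point → ℝ), (∀ n, u n ∈ V) → G.MemH1 w →
      TendstoUniformly u w atTop → w ∈ V) (hne : ∃ v ∈ V, v ≠ 0) :
    ∃ m : ℝ, 0 ≤ m ∧ (∀ v ∈ V, m * G.innerL2 v v ≤ G.form v v) ∧
      ∃ u ∈ V, u ≠ 0 ∧ G.form u u = m * G.innerL2 u u := by
  let S : Set ℝ := {a | ∃ v ∈ V, G.innerL2 v v = 1 ∧ G.form v v = a}
  have hnormalize : ∀ v ∈ V, v ≠ 0 → G.form v v / G.innerL2 v v ∈ S := by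
    intro v hv hv0
    have hN := innerL2_self_pos (hV v hv).1 hv0
    refine ⟨(√(G.innerL2 v v))⁻¹ • v, V.smul_mem _ hv, ?_, ?_⟩
    · rw [innerL2_smul_left, innerL2_smul_right, ← mul_assoc, ← mul_inv,
        Real.mul_self_sqrt hN.le, inv_mul_cancel₀ hN.ne']
    · rw [form_smul_left, form_smul_right, ← mul_assoc, ← mul_inv, Real.mul_self_sqrt hN.le]
      ring
  have hSne : S.Nonempty := by
    obtain ⟨v, hv, hv0⟩ := hne
    exact ⟨_, hnormalize v hv hv0⟩
  have hSnn : ∀ a ∈ S, 0 ≤ a := by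
    rintro _ ⟨v, -, -, rfl⟩
    exact form_self_nonneg v
  have hSbdd : BddBelow S := ⟨0, hSnn⟩
  set m := sInf S with hm
  have hm0 : 0 ≤ m := le_csInf hSne hSnn
  have hmle : ∀ v ∈ V, m * G.innerL2 v v ≤ G.form v v := by
    intro v hv
    by_cases hv0 : v = 0
    · subst hv0
      have h1 : G.innerL2 (0 : G.Point → ℝ) 0 = 0 := by
        have := innerL2_smul_left (G := G) 0 0 0
        simpa using this
      rw [h1, mul_zero]
      exact form_self_nonneg _
    · have hN := innerL2_self_pos (hV v hv).1 hv0
      have := csInf_le hSbdd (hnormalize v hv hv0)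
      rwa [le_div_iff₀ hN] at this
  obtain ⟨a, -, ha, haS⟩ := exists_seq_tendsto_sInf hSne hSbdd
  choose u huV huN huA using haS
  have hu1 : ∀ n, G.MemH1 (u n) := fun n => hV _ (huV n)
  obtain ⟨B, hB⟩ := ha.bddAbove_range
  have hAB : ∀ n, G.form (u n) (u n) ≤ B := fun n => by rw [huA]; exact hB ⟨n, rfl⟩
  have hB0 : 0 ≤ B := (form_self_nonneg _).trans (hAB 0)
  -- an edge containing `p` bounds `u n p`; the sum over all edges is a bound independent of `p`
  obtain ⟨M, hM⟩ : ∃ M : ℝ, ∀ n p, |u n p| ≤ M := by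
    refine ⟨∑ e, √(2 / G.len e + 2 * G.len e * B), fun n p => ?_⟩
    obtain ⟨e, x, hx, rfl⟩ := exists_pt p
    refine le_trans ?_ (Finset.single_le_sum
      (f := fun e => √(2 / G.len e + 2 * G.len e * B)) (fun _ _ => Real.sqrt_nonneg _)
      (Finset.mem_univ e))
    refine Real.abs_le_sqrt ((sq_le (hu1 n) hx).trans ?_)
    rw [huN, mul_one]
    have := mul_le_mul_of_nonneg_left (hAB n) (by linarith [G.len_pos e] : 0 ≤ 2 * G.len e)
    linarith
  obtain ⟨w, φ, hφ, hlim⟩ := exists_tendstoUniformly_subseq hu1 hM hAB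
  have haφ : Tendsto (fun n => G.form (u (φ n)) (u (φ n))) atTop (𝓝 m) := by
    simp only [huA]
    exact ha.comp hφ.tendsto_atTop
  have hcauchy : ∀ ε > 0, ∃ N, ∀ k ≥ N, ∀ n ≥ N,
      G.form (u (φ k) - u (φ n)) (u (φ k) - u (φ n)) < ε := by
    intro ε hε
    -- the differences tend to zero in `L²`, being small uniformly
    let T : ℝ := ∑ e, G.len e
    have hT : 0 ≤ T := Finset.sum_nonneg fun e _ => (G.len_pos e).le
    obtain ⟨δ, hδ, hδ2⟩ : ∃ δ > 0, m * (T * (2 * δ) ^ 2) < ε / 2 := by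
      have hc : Continuous fun δ : ℝ => m * (T * (2 * δ) ^ 2) := by fun_prop
      have : ∀ᶠ δ in 𝓝[>] (0 : ℝ), m * (T * (2 * δ) ^ 2) < ε / 2 :=
        (hc.continuousAt.eventually_lt continuousAt_const (by simpa using hε)).filter_mono
          nhdsWithin_le_nhds
      obtain ⟨δ, h1, h2⟩ := (this.and self_mem_nhdsWithin).exists
      exact ⟨δ, h2, h1⟩
    have h1 := Metric.tendstoUniformly_iff.1 hlim δ hδ
    have h2 := haφ.eventually_lt_const (show m < m + ε / 8 by linarith)
    obtain ⟨N, hN⟩ := eventually_atTop.1 (h1.and h2)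
    refine ⟨N, fun k hk n hn => ?_⟩
    set f := u (φ k)
    set g := u (φ n)
    have hf := hu1 (φ k)
    have hg := hu1 (φ n)
    -- the parallelogram identities for the form and for the inner product
    have e1 := form_add_smul_self hf hg (-1)
    have e2 := form_add_smul_self hf hg 1
    have e3 := innerL2_add_smul_self hf.1 hg.1 (-1)
    have e4 := innerL2_add_smul_self hf.1 hg.1 1
    rw [one_smul] at e2 e4
    rw [neg_one_smul, ← sub_eq_add_neg] at e1 e3
    have hsum := hmle (f + g) (V.add_mem (huV _) (huV _))
    have hdiff : G.innerL2 (f - g) (f - g) ≤ T * (2 * δ) ^ 2 := by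
      rw [Finset.sum_mul]
      refine Finset.sum_le_sum fun e _ => ?_
      have hc : Continuous (G.onEdge (f - g) e) := continuous_onEdge (hf.sub hg).1 e
      have h5 := intervalIntegral.integral_mono_on (μ := volume) (G.len_pos e).le
        ((hc.mul hc).intervalIntegrable _ _) (intervalIntegrable_const (c := (2 * δ) ^ 2))
        (fun x _ => ?_)
      · rw [intervalIntegral.integral_const, smul_eq_mul, sub_zero] at h5
        exact h5
      · have h6 := (hN k hk).1 (G.pt e x)
        have h7 := (hN n hn).1 (G.pt e x)
        rw [Real.dist_eq] at h6 h7
        have h8 := abs_lt.1 h6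
        have h9 := abs_lt.1 h7
        change (f (G.pt e x) - g (G.pt e x)) * (f (G.pt e x) - g (G.pt e x)) ≤ _
        rw [← sq]
        exact sq_le_sq' (by linarith) (by linarith)
    have hfN : G.innerL2 f f = 1 := huN (φ k)
    have hgN : G.innerL2 g g = 1 := huN (φ n)
    have hfA := (hN k hk).2
    have hgA := (hN n hn).2
    have hmd := mul_le_mul_of_nonneg_left hdiff hm0
    rw [hfN, hgN] at e3 e4
    nlinarith
  obtain ⟨hw, hwA⟩ := memH1_of_cauchy (fun n => hu1 (φ n)) hlim hcauchy
  have hN1 : G.innerL2 w w = 1 := by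
    have h1 := tendsto_innerL2 (fun n => (hu1 (φ n)).1) hlim
    simp only [huN] at h1
    exact tendsto_nhds_unique h1 tendsto_const_nhds
  refine ⟨m, hm0, hmle, w, hclosed _ w (fun n => huV (φ n)) hw hlim, ?_, ?_⟩
  · rintro rfl
    have : G.innerL2 (0 : G.Point → ℝ) 0 = 0 := by
      have := innerL2_smul_left (G := G) 0 0 0
      simpa using this
    rw [this] at hN1
    exact zero_ne_one hN1
  · rw [hN1, mul_one]
    exact tendsto_nhds_unique hwA haφ

/-- The Euler-Lagrange equation of a minimizer of the Rayleigh quotient. -/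
theorem form_eq_of_isMinimizer {m : ℝ} (V : Submodule ℝ (G.Point → ℝ)) (hV : ∀ v ∈ V, G.MemH1 v)
    (hm : ∀ v ∈ V, m * G.innerL2 v v ≤ G.form v v) (hu : u ∈ V)
    (hum : G.form u u ≤ m * G.innerL2 u u) (hv : v ∈ V) :
    G.form u v = m * G.innerL2 u v := by
  have key : ∀ s : ℝ, 0 ≤ 2 * s * (G.form u v - m * G.innerL2 u v) +
      s ^ 2 * (G.form v v - m * G.innerL2 v v) := by
    intro s
    have h1 := hm _ (V.add_mem hu (V.smul_mem s hv))
    rw [form_add_smul_self (hV u hu) (hV v hv), innerL2_add_smul_self (hV u hu).1 (hV v hv).1] at h1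
    nlinarith
  have hc : 0 ≤ G.form v v - m * G.innerL2 v v := sub_nonneg.2 (hm v hv)
  set b := G.form u v - m * G.innerL2 u v with hb
  set c := G.form v v - m * G.innerL2 v v
  -- a quadratic in `s` that is nonnegative and vanishes at `0` has linear coefficient zero; the
  -- value at `-b / (c + 1)` shows this also for `c = 0`
  have h1 := key (-b / (c + 1))
  have hc1 : 0 < c + 1 := by linarith
  have h2 : 2 * (-b / (c + 1)) * b + (-b / (c + 1)) ^ 2 * c =
      -(b ^ 2 * (c + 2)) / (c + 1) ^ 2 := by
    field_simp
    ring
  rw [h2, le_div_iff₀ (by positivity), zero_mul] at h1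
  have h3 : b ^ 2 ≤ 0 := by nlinarith [sq_nonneg b]
  have h4 : b = 0 := pow_eq_zero_iff two_ne_zero |>.1 (le_antisymm h3 (sq_nonneg b))
  linarith

end MetricGraph

/-! ### Variational characterization of the eigenvalues -/

namespace MetricGraph

variable {G : MetricGraph} {u v w : G.Point → ℝ} {D : Set G.Point}

/-- The space `H¹₀(G; D)` as a subspace of the space of all functions. -/
def h10 (G : MetricGraph) (D : Set G.Point) : Submodule ℝ (G.Point → ℝ) where
  carrier := {u | G.MemH10 D u}
  add_mem' hu hv := ⟨hu.1.add hv.1, fun p hp => by simp [hu.2 p hp, hv.2 p hp]⟩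
  zero_mem' := ⟨MemH1.const 0, fun _ _ => rfl⟩
  smul_mem' c _ hu := ⟨hu.1.const_smul c, fun p hp => by simp [hu.2 p hp]⟩

theorem memH10_empty : G.MemH10 ∅ u ↔ G.MemH1 u :=
  ⟨fun h => h.1, fun h => ⟨h, fun _ hp => absurd hp (notMem_empty _)⟩⟩

theorem eigenvalue_eq_rayleigh {t : ℝ} (h : G.IsEigenfunction D t u) :
    G.form u u = t * G.innerL2 u u := h.2.2 u h.1

/-- A positive bump in the interior of an edge, as an element of `H¹₀(G; D)`. -/
theorem exists_bump (hD : ∀ e, ∀ x ∈ Ioo 0 (G.len e), G.pt e x ∉ D) (e : G.E) :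
    ∃ b, G.MemH10 D b ∧ (∀ a, b (G.vertex a) = 0) ∧ (∀ x ∈ Ioo 0 (G.len e), 0 < b (G.pt e x)) ∧
      ∀ p, 0 ≤ b p := by
  let b := G.onSingleEdge e (fun x => x * (G.len e - x)) (by simp) (by simp)
  have hv : ∀ a, b (G.vertex a) = 0 := fun a => onSingleEdge_vertex a
  refine ⟨b, ⟨MemH1.onSingleEdge (MemH1Interval.of_contDiff (by fun_prop)), ?_⟩,
    hv, ?_, ?_⟩
  · intro p hp
    rcases pt_or_vertex p with ⟨f, x, hx, rfl⟩ | ⟨a, rfl⟩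
    · exact absurd hp (hD f x hx)
    · exact hv a
  · intro x hx
    have : b (G.pt e x) = x * (G.len e - x) := onSingleEdge_self (Ioo_subset_Icc_self hx)
    rw [this]
    exact mul_pos hx.1 (sub_pos.2 hx.2)
  · intro p
    obtain ⟨f, x, hx, rfl⟩ := exists_pt p
    by_cases h : f = e
    · subst h
      have : b (G.pt f x) = x * (G.len f - x) := onSingleEdge_self hx
      rw [this]
      exact mul_nonneg hx.1 (sub_nonneg.2 hx.2)
    · exact (onSingleEdge_of_ne hx h).ge

theorem midpoint_mem (e : G.E) : G.len e / 2 ∈ Ioo 0 (G.len e) := by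
  have := G.len_pos e
  constructor <;> linarith

/-- The first eigenvalue is the minimum of the Rayleigh quotient, and is attained by a nonnegative
eigenfunction: the absolute value of a minimizer is a minimizer. The hypothesis that `D` consists of
vertices makes `H¹₀(G; D)` nonzero. -/
theorem first_eigenvalue [Nonempty G.E] (hD : ∀ e, ∀ x ∈ Ioo 0 (G.len e), G.pt e x ∉ D) :
    (∀ v, G.MemH10 D v → G.eigenvalue D 1 * G.innerL2 v v ≤ G.form v v) ∧
      ∃ ψ, G.IsEigenfunction D (G.eigenvalue D 1) ψ ∧ ∀ p, 0 ≤ ψ p := by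
  obtain ⟨m, hm0, hmle, u, hu, hu0, hum⟩ := exists_minimizer (G.h10 D) (fun v hv => hv.1)
    (fun u w hu hw hlim => ⟨hw, fun p hp => tendsto_nhds_unique (hlim.tendsto_at p)
      (by simp only [(hu _).2 p hp]; exact tendsto_const_nhds)⟩) (by
      obtain ⟨e⟩ := ‹Nonempty G.E›
      obtain ⟨b, hb, -, hb1, -⟩ := exists_bump hD e
      refine ⟨b, hb, fun h => ?_⟩
      have := hb1 _ (midpoint_mem e)
      rw [h] at this
      exact lt_irrefl _ this)
  have habs : G.IsEigenfunction D m (fun p => |u p|) := by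
    have hmem : G.MemH10 D (fun p => |u p|) :=
      ⟨hu.1.abs, fun p hp => by simp [hu.2 p hp]⟩
    refine ⟨hmem, ?_, fun v hv => ?_⟩
    · intro h
      exact hu0 (funext fun p => abs_eq_zero.1 (congrFun h p))
    · refine form_eq_of_isMinimizer (G.h10 D) (fun v hv => hv.1) hmle hmem ?_ hv
      rw [innerL2_abs, ← hum]
      exact form_abs_le hu.1
  have heq : G.eigenvalue D 1 = m := by
    have hmin : ∀ t ∈ {t : ℝ | ∃ u : Fin 1 → G.Point → ℝ, LinearIndependent ℝ u ∧
        ∀ i, ∃ s ≤ t, G.IsEigenfunction D s (u i)}, m ≤ t := by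
      rintro t ⟨f, -, hf⟩
      obtain ⟨s, hst, hs⟩ := hf 0
      refine le_trans ?_ hst
      have h1 := hmle _ hs.1
      rw [eigenvalue_eq_rayleigh hs] at h1
      exact le_of_mul_le_mul_right h1 (innerL2_self_pos hs.1.1.1 hs.2.1)
    refine IsLeast.csInf_eq ⟨⟨fun _ => fun p => |u p|, ?_, fun _ => ⟨m, le_rfl, habs⟩⟩, hmin⟩
    exact linearIndependent_unique_iff.2 habs.2.1
  rw [heq]
  exact ⟨hmle, _, habs, fun p => abs_nonneg _⟩

/-- The constant function `1`. -/
def one (G : MetricGraph) : G.Point → ℝ := fun _ => 1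

theorem memH1_one : G.MemH1 G.one := MemH1.const 1

theorem one_ne_zero' [Nonempty G.Point] : G.one ≠ 0 := fun h => by
  obtain ⟨p⟩ := ‹Nonempty G.Point›
  exact one_ne_zero (congrFun h p)

theorem innerL2_one_self_pos [Nonempty G.Point] : 0 < G.innerL2 G.one G.one :=
  innerL2_self_pos memH1_one.1 one_ne_zero'

/-- The space of functions in `H¹` with mean zero. -/
def h1MeanZero (G : MetricGraph) : Submodule ℝ (G.Point → ℝ) where
  carrier := {u | G.MemH1 u ∧ G.innerL2 G.one u = 0}
  add_mem' hu hv := ⟨hu.1.add hv.1, by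
    rw [innerL2_add_right hu.1.1 hv.1.1 memH1_one.1, hu.2, hv.2, add_zero]⟩
  zero_mem' := ⟨MemH1.const 0, by simp [innerL2, onEdge]⟩
  smul_mem' c _ hu := ⟨hu.1.const_smul c, by rw [innerL2_smul_right, hu.2, mul_zero]⟩

theorem mean_sub_mem [Nonempty G.Point] (hu : G.MemH1 u) :
    u + (-(G.innerL2 G.one u / G.innerL2 G.one G.one)) • G.one ∈ G.h1MeanZero := by
  refine ⟨hu.add (memH1_one.const_smul _), ?_⟩
  rw [innerL2_add_right hu.1 (memH1_one.const_smul _).1 memH1_one.1, innerL2_smul_right]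
  have := (innerL2_one_self_pos (G := G)).ne'
  field_simp
  ring

/-- The second eigenvalue of a connected graph is the minimum of the Rayleigh quotient on the
functions with mean zero, and each minimizer is an eigenfunction. The minimum is positive, since
only constants have zero energy. -/
theorem second_eigenvalue [ConnectedSpace G.Point] :
    0 < G.mu 2 ∧ (∀ v, G.MemH1 v → G.innerL2 G.one v = 0 → G.mu 2 * G.innerL2 v v ≤ G.form v v) ∧
      (∀ v, G.MemH1 v → v ≠ 0 → G.innerL2 G.one v = 0 → G.form v v ≤ G.mu 2 * G.innerL2 v v →
        G.IsEigenfunction ∅ (G.mu 2) v) ∧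
      ∃ ψ, G.IsEigenfunction ∅ (G.mu 2) ψ ∧ G.innerL2 G.one ψ = 0 := by
  have hone := innerL2_one_self_pos (G := G)
  obtain ⟨m, hm0, hmle, u, hu, hu0, hum⟩ := exists_minimizer G.h1MeanZero (fun v hv => hv.1)
    -- by polarization, the mean is continuous under uniform convergence
    (fun u w hu hw hlim => ⟨hw, by
      have h1 := tendsto_innerL2 (fun n => (((hu n).1.add memH1_one).1)) (w := w + G.one) (by
        rw [Metric.tendstoUniformly_iff] at hlim ⊢
        intro ε hε
        filter_upwards [hlim ε hε] with n hn p
        simpa using hn p)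
      have h2 := tendsto_innerL2 (fun n => (hu n).1.1) hlim
      have hpol : ∀ v, G.MemH1 v → G.innerL2 G.one v =
          (G.innerL2 (v + G.one) (v + G.one) - G.innerL2 v v - G.innerL2 G.one G.one) / 2 := by
        intro v hv
        have := innerL2_add_smul_self hv.1 memH1_one.1 1
        rw [one_smul, innerL2_comm v G.one] at this
        linarith
      rw [hpol w hw]
      refine tendsto_nhds_unique (((h1.sub h2).sub_const _).div_const 2) ?_
      refine tendsto_const_nhds.congr fun n => ?_
      rw [← hpol _ (hu n).1, (hu n).2]⟩) (by
      obtain ⟨p⟩ := (inferInstance : Nonempty G.Point)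
      obtain ⟨e, -, -⟩ := exists_pt p
      obtain ⟨b, hb, hb0, hb1, -⟩ := exists_bump (G := G) (D := ∅) (by simp) e
      refine ⟨_, mean_sub_mem hb.1, fun h => ?_⟩
      have h1 := congrFun h (G.pt e (G.len e / 2))
      have h2 := congrFun h (G.vertex (e, false))
      have h3 := hb1 _ (midpoint_mem e)
      simp only [Pi.add_apply, Pi.smul_apply, one, smul_eq_mul, mul_one, Pi.zero_apply,
        hb0] at h1 h2
      linarith)
  -- a minimizer satisfies the weak equation for all test functions: subtract the mean, which
  -- affects neither side
  have hweak : ∀ v, v ∈ G.h1MeanZero → v ≠ 0 → G.form v v ≤ m * G.innerL2 v v →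
      G.IsEigenfunction ∅ m v := by
    intro v hv hv0 hvm
    refine ⟨memH10_empty.2 hv.1, hv0, fun f hf => ?_⟩
    have h1 := form_eq_of_isMinimizer G.h1MeanZero (fun v hv => hv.1) hmle hv hvm
      (mean_sub_mem hf.1)
    have hs := memH1_one.const_smul (G := G) (-(G.innerL2 G.one f / G.innerL2 G.one G.one))
    rw [form_add_right hf.1 hs hv.1, innerL2_add_right hf.1.1 hs.1 hv.1.1, form_smul_right,
      innerL2_smul_right, innerL2_comm v G.one, hv.2, form_comm v G.one] at h1
    have h2 : G.form G.one v = 0 := form_const_left 1 v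
    rw [h2] at h1
    simpa using h1
  -- eigenfunctions with nonzero eigenvalue are orthogonal to constants
  have hmean : ∀ s f, G.IsEigenfunction ∅ s f → s ≠ 0 → f ∈ G.h1MeanZero := by
    intro s f hf hs
    refine ⟨hf.1.1, ?_⟩
    have h1 := hf.2.2 G.one (memH10_empty.2 memH1_one)
    have h2 : G.form G.one f = 0 := form_const_left 1 f
    rw [form_comm, h2, innerL2_comm] at h1
    exact (mul_eq_zero.1 h1.symm).resolve_left hs
  have hconst : ∀ f, G.MemH1 f → G.form f f = 0 → ∃ c : ℝ, f = c • G.one := by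
    intro f hf h
    obtain ⟨p⟩ := (inferInstance : Nonempty G.Point)
    refine ⟨f p, funext fun q => ?_⟩
    simp [one, eq_const_of_form_eq_zero hf h q p]
  have hmpos : 0 < m := by
    refine lt_of_le_of_ne hm0 fun h => hu0 ?_
    rw [← h, zero_mul] at hum
    obtain ⟨c, rfl⟩ := hconst u hu.1 hum
    have h1 := hu.2
    rw [innerL2_smul_right] at h1
    rw [(mul_eq_zero.1 h1).resolve_right hone.ne', zero_smul]
  have hone_eig : G.IsEigenfunction ∅ 0 G.one :=
    ⟨memH10_empty.2 memH1_one, one_ne_zero', fun v _ => by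
      rw [zero_mul]; exact form_const_left 1 v⟩
  have heq : G.mu 2 = m := by
    have hmin : ∀ t ∈ {t : ℝ | ∃ u : Fin 2 → G.Point → ℝ, LinearIndependent ℝ u ∧
        ∀ i, ∃ s ≤ t, G.IsEigenfunction ∅ s (u i)}, m ≤ t := by
      rintro t ⟨f, hf, hfe⟩
      by_contra hlt
      -- eigenvalues less than `m` are zero, so that both eigenfunctions are constant
      have hz : ∀ i, G.form (f i) (f i) = 0 := by
        intro i
        obtain ⟨s, hst, hs⟩ := hfe i
        by_cases hs0 : s = 0
        · rw [eigenvalue_eq_rayleigh hs, hs0, zero_mul]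
        · exfalso
          have h1 := hmle _ (hmean s _ hs hs0)
          rw [eigenvalue_eq_rayleigh hs] at h1
          have := le_of_mul_le_mul_right h1 (innerL2_self_pos hs.1.1.1 hs.2.1)
          exact hlt (this.trans hst)
      have hmem : ∀ i, G.MemH1 (f i) := fun i => by
        obtain ⟨s, -, hs⟩ := hfe i
        exact hs.1.1
      obtain ⟨a, ha⟩ := hconst _ (hmem 0) (hz 0)
      obtain ⟨b, hb⟩ := hconst _ (hmem 1) (hz 1)
      have h2 := (LinearIndependent.pair_iff' (hf.ne_zero 0)).1 (by
        have : ![f 0, f 1] = f := by ext i; fin_cases i <;> rfl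
        rw [this]; exact hf)
      have ha0 : a ≠ 0 := fun h => hf.ne_zero 0 (by rw [ha, h, zero_smul])
      refine h2 (b / a) ?_
      rw [ha, hb, smul_smul, div_mul_cancel₀ _ ha0]
    refine IsLeast.csInf_eq ⟨⟨![G.one, u], ?_, ?_⟩, hmin⟩
    · rw [LinearIndependent.pair_iff' one_ne_zero']
      rintro c rfl
      have h1 := hu.2
      rw [innerL2_smul_right] at h1
      rw [(mul_eq_zero.1 h1).resolve_right hone.ne', zero_smul] at hu0
      exact hu0 rfl
    · intro i
      fin_cases i
      · exact ⟨0, hm0, hone_eig⟩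
      · exact ⟨m, le_rfl, hweak u hu hu0 hum.le⟩
  rw [heq]
  exact ⟨hmpos, fun v hv h => hmle v ⟨hv, h⟩, fun v hv hv0 h h2 => hweak v ⟨hv, h⟩ hv0 h2,
    u, hweak u hu hu0 hum.le, hu.2⟩

end MetricGraph

/-! ### Eigenfunctions on the edges -/

/-- The general solution of `f'' = -ω² f`. -/
noncomputable def trig (ω A B x : ℝ) : ℝ := A * Real.cos (ω * x) + B * Real.sin (ω * x)

/-- The derivative of `trig`. -/
noncomputable def trigDeriv (ω A B x : ℝ) : ℝ :=
  ω * (B * Real.cos (ω * x) - A * Real.sin (ω * x))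

theorem hasDerivAt_trig (ω A B x : ℝ) : HasDerivAt (trig ω A B) (trigDeriv ω A B x) x := by
  have h1 : HasDerivAt (fun x => ω * x) ω x := by simpa using (hasDerivAt_id x).const_mul ω
  have h2 := (h1.cos.const_mul A).add (h1.sin.const_mul B)
  exact h2.congr_deriv (by unfold trigDeriv; ring)

theorem hasDerivAt_trigDeriv (ω A B x : ℝ) :
    HasDerivAt (trigDeriv ω A B) (-(ω ^ 2 * trig ω A B x)) x := by
  have h1 : HasDerivAt (fun x => ω * x) ω x := by simpa using (hasDerivAt_id x).const_mul ω
  have h2 := ((h1.cos.const_mul B).sub (h1.sin.const_mul A)).const_mul ω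
  exact h2.congr_deriv (by unfold trig; ring)

theorem trig_energy (ω A B x : ℝ) :
    ω ^ 2 * trig ω A B x ^ 2 + trigDeriv ω A B x ^ 2 = ω ^ 2 * (A ^ 2 + B ^ 2) := by
  have h := Real.sin_sq_add_cos_sq (ω * x)
  unfold trig trigDeriv
  linear_combination (ω ^ 2 * (A ^ 2 + B ^ 2)) * h

theorem trig_eq_zero_of_double_zero {ω A B x : ℝ} (hω : ω ≠ 0) (h0 : trig ω A B x = 0)
    (h1 : trigDeriv ω A B x = 0) : ∀ y, trig ω A B y = 0 := by
  have h := trig_energy ω A B x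
  rw [h0, h1] at h
  have h2 : A ^ 2 + B ^ 2 = 0 := by
    have : ω ^ 2 * (A ^ 2 + B ^ 2) = 0 := by linarith
    exact (mul_eq_zero.1 this).resolve_left (pow_ne_zero 2 hω)
  have hA : A = 0 := by nlinarith [sq_nonneg A, sq_nonneg B]
  have hB : B = 0 := by nlinarith [sq_nonneg A, sq_nonneg B]
  intro y
  simp [trig, hA, hB]

theorem finite_zeros_trig (ω A B a b : ℝ) (h : ∃ x, trig ω A B x ≠ 0) :
    {x | x ∈ Icc a b ∧ trig ω A B x = 0}.Finite := by
  by_contra hinf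
  obtain ⟨x, -, hx⟩ := Set.Infinite.exists_accPt_of_subset_isCompact hinf
    (isCompact_Icc (a := a) (b := b)) fun x hx => hx.1
  have han : AnalyticOnNhd ℝ (trig ω A B) univ := by
    intro y _
    unfold trig
    fun_prop
  rw [accPt_iff_frequently_nhdsNE] at hx
  have h2 := han.eqOn_zero_of_preconnected_of_frequently_eq_zero isPreconnected_univ (mem_univ x)
    (hx.mono fun y hy => hy.2)
  obtain ⟨y, hy⟩ := h
  exact hy (h2 (mem_univ y))

theorem integral_trigDeriv_mul_affine (ω A B L p q : ℝ) :
    ∫ x in (0 : ℝ)..L, trigDeriv ω A B x * q =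
      (trigDeriv ω A B L * (p + q * L) - trigDeriv ω A B 0 * p) +
        ω ^ 2 * ∫ x in (0 : ℝ)..L, trig ω A B x * (p + q * x) := by
  have hc1 : Continuous (trig ω A B) := by unfold trig; fun_prop
  have hc2 : Continuous (trigDeriv ω A B) := by unfold trigDeriv; fun_prop
  have h1 : ∀ x, HasDerivAt (fun x => trigDeriv ω A B x * (p + q * x))
      (trigDeriv ω A B x * q - ω ^ 2 * (trig ω A B x * (p + q * x))) x := by
    intro x
    have h2 : HasDerivAt (fun x => p + q * x) q x := by
      simpa using ((hasDerivAt_id x).const_mul q).const_add p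
    exact ((hasDerivAt_trigDeriv ω A B x).mul h2).congr_deriv (by ring)
  have h3 := intervalIntegral.integral_eq_sub_of_hasDerivAt (a := 0) (b := L) (fun x _ => h1 x)
    (Continuous.intervalIntegrable (by fun_prop) _ _)
  rw [intervalIntegral.integral_sub (Continuous.intervalIntegrable (by fun_prop) _ _)
    (Continuous.intervalIntegrable (by fun_prop) _ _), intervalIntegral.integral_const_mul] at h3
  rw [mul_zero, add_zero] at h3
  linarith

/-- The du Bois-Reymond lemma for the equation `f'' = -t f`: its weak solutions are the classical
ones. -/
theorem exists_trig_of_weak {L t : ℝ} (hL : 0 < L) (ht : 0 < t) {f : ℝ → ℝ} (hfc : Continuous f)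
    (hf : MemH1Interval L f)
    (hweak : ∀ g, MemH1Interval L g → g 0 = 0 → g L = 0 →
      ∫ x in (0 : ℝ)..L, deriv f x * deriv g x = t * ∫ x in (0 : ℝ)..L, f x * g x) :
    ∃ A B, ∀ x ∈ Icc 0 L, f x = trig (√t) A B x := by
  set F : ℝ → ℝ := fun x => ∫ s in (0 : ℝ)..x, f s with hF
  have hFd : ∀ x, HasDerivAt F (f x) x := fun x => hfc.integral_hasStrictDerivAt 0 x |>.hasDerivAt
  have hFdiff : Differentiable ℝ F := fun x => (hFd x).differentiableAt
  have hFderiv : deriv F = f := funext fun x => (hFd x).deriv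
  have hFc : Continuous F := hFdiff.continuous
  have hF1 : MemH1Interval L F := MemH1Interval.of_contDiff
    (contDiff_one_iff_deriv.2 ⟨hFdiff, by rwa [hFderiv]⟩)
  -- the first integral `w` of the weak equation is constant
  set w : ℝ → ℝ := fun x => deriv f x + t * F x with hw
  have hw2 : MemLp w 2 (volume.restrict (Ioo 0 L)) :=
    hf.2.add ((MemH1Interval.memLp hFc.continuousOn).const_mul t)
  have hwi := hw2.intervalIntegrable_of_Ioo hL.le
  set c : ℝ := (∫ x in (0 : ℝ)..L, w x) / L with hc
  set r : ℝ → ℝ := fun x => w x - c with hr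
  have hr2 : MemLp r 2 (volume.restrict (Ioo 0 L)) := hw2.sub (memLp_const c)
  have hr0 : ∫ x in (0 : ℝ)..L, r x = 0 := by
    rw [hr, intervalIntegral.integral_sub hwi intervalIntegrable_const,
      intervalIntegral.integral_const, smul_eq_mul, hc]
    field_simp
    ring
  -- the primitive of the deviation of `w` from its mean vanishes at both endpoints, and is used as
  -- a test function
  set g : ℝ → ℝ := fun x => ∫ s in (0 : ℝ)..x, r s with hg
  have hg0 : g 0 = 0 := by simp [hg]
  have hgL : g L = 0 := hr0
  obtain ⟨hg1, hgr⟩ := MemH1Interval.of_integral (f := g) hL hr2 (by simp [hg])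
  have hprod : ∀ {u v : ℝ → ℝ}, MemLp u 2 (volume.restrict (Ioo 0 L)) →
      MemLp v 2 (volume.restrict (Ioo 0 L)) →
      IntervalIntegrable (fun x => u x * v x) volume 0 L := by
    intro u v hu hv
    rw [intervalIntegrable_iff_integrableOn_Ioo_of_le hL.le]
    exact hu.integrable_mul hv
  have hwg : ∫ x in (0 : ℝ)..L, w x * deriv g x = 0 := by
    have h1 := hweak g hg1 hg0 hgL
    have h2 := hF1.1.integral_mul_deriv_eq_deriv_mul hg1.1
    rw [hg0, hgL, hFderiv] at h2
    have h3 : ∫ x in (0 : ℝ)..L, w x * deriv g x =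
        (∫ x in (0 : ℝ)..L, deriv f x * deriv g x) + t * ∫ x in (0 : ℝ)..L, F x * deriv g x := by
      rw [← intervalIntegral.integral_const_mul, ← intervalIntegral.integral_add
        (hprod hf.2 hg1.2)
        ((hprod (MemH1Interval.memLp hFc.continuousOn) hg1.2).const_mul t)]
      refine intervalIntegral.integral_congr fun x _ => ?_
      simp only [hw]
      ring
    rw [h3, h1, h2]
    ring
  have hrr : ∫ x in Ioo 0 L, r x * r x = 0 := by
    have h1 : ∫ x in Ioo 0 L, w x * deriv g x = ∫ x in Ioo 0 L, (r x * r x + c * r x) := by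
      refine integral_congr_ae ?_
      filter_upwards [hgr] with x hx
      rw [hx]
      simp only [hr]
      ring
    rw [integral_eq_integral_Ioo hL.le] at hwg hr0
    have h2 := integral_add (μ := volume.restrict (Ioo 0 L)) (f := fun x => r x * r x)
      (g := fun x => c * r x) (hr2.integrable_mul hr2)
      ((hr2.integrable (by norm_num)).const_mul c)
    rw [hwg, h2, integral_const_mul, hr0] at h1
    linarith
  have hae : ∀ᵐ x ∂(volume.restrict (Ioo 0 L)), deriv f x = c - t * F x := by
    have h1 := (integral_eq_zero_iff_of_nonneg (fun x => mul_self_nonneg (r x))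
      (hr2.integrable_mul hr2)).1 hrr
    filter_upwards [h1] with x hx
    have h2 : r x = 0 := mul_self_eq_zero.1 hx
    simp only [hr, hw] at h2
    linarith
  -- the derivative of `f` has the smooth representative `p`, so that `f` agrees with the smooth
  -- function `k`
  set p : ℝ → ℝ := fun x => c - t * F x with hp
  have hpc : Continuous p := by fun_prop
  have hpd : ∀ x, HasDerivAt p (-(t * f x)) x := fun x => by
    simpa using ((hFd x).const_mul t).const_sub c
  set k : ℝ → ℝ := fun x => f 0 + ∫ s in (0 : ℝ)..x, p s with hk
  have hkd : ∀ x, HasDerivAt k (p x) x := fun x =>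
    ((hpc.integral_hasStrictDerivAt 0 x).hasDerivAt).const_add (f 0)
  have hfk : ∀ x ∈ Icc 0 L, f x = k x := by
    intro x hx
    have h1 := hf.integral_deriv ⟨le_rfl, hL.le⟩ hx
    have h2 : ∫ s in (0 : ℝ)..x, deriv f s = ∫ s in (0 : ℝ)..x, p s := by
      rw [integral_eq_integral_Ioo hx.1, integral_eq_integral_Ioo hx.1]
      refine integral_congr_ae ?_
      exact ae_restrict_of_ae_restrict_of_subset (Ioo_subset_Ioo_right hx.2) hae
    simp only [hk]
    linarith
  set ω := √t with hω
  have hω0 : 0 < ω := Real.sqrt_pos.2 ht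
  have hω2 : ω ^ 2 = t := Real.sq_sqrt ht.le
  have hcos : ∀ x, HasDerivAt (fun x => Real.cos (ω * x)) (-(ω * Real.sin (ω * x))) x := by
    intro x
    have h1 : HasDerivAt (fun x => ω * x) ω x := by simpa using (hasDerivAt_id x).const_mul ω
    exact h1.cos.congr_deriv (by ring)
  have hsin : ∀ x, HasDerivAt (fun x => Real.sin (ω * x)) (ω * Real.cos (ω * x)) x := by
    intro x
    have h1 : HasDerivAt (fun x => ω * x) ω x := by simpa using (hasDerivAt_id x).const_mul ω
    exact h1.sin.congr_deriv (by ring)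
  -- the coefficients of `k` with respect to the solutions `cos (ω x)` and `sin (ω x)`
  have hk1 := constant_of_has_deriv_right_zero (a := 0) (b := L)
    (f := fun x => ω * (k x * Real.cos (ω * x)) - p x * Real.sin (ω * x))
    (fun x _ => (((((hkd x).mul (hcos x)).const_mul ω).sub
      ((hpd x).mul (hsin x))).continuousAt).continuousWithinAt) (fun x hx => by
      have := ((((hkd x).mul (hcos x)).const_mul ω).sub ((hpd x).mul (hsin x)))
      rw [hfk x ⟨hx.1, hx.2.le⟩, ← hω2] at this
      exact (this.congr_deriv (by ring)).hasDerivWithinAt)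
  have hk2 := constant_of_has_deriv_right_zero (a := 0) (b := L)
    (f := fun x => ω * (k x * Real.sin (ω * x)) + p x * Real.cos (ω * x))
    (fun x _ => (((((hkd x).mul (hsin x)).const_mul ω).add
      ((hpd x).mul (hcos x))).continuousAt).continuousWithinAt) (fun x hx => by
      have := ((((hkd x).mul (hsin x)).const_mul ω).add ((hpd x).mul (hcos x)))
      rw [hfk x ⟨hx.1, hx.2.le⟩, ← hω2] at this
      exact (this.congr_deriv (by ring)).hasDerivWithinAt)
  refine ⟨k 0, p 0 / ω, fun x hx => ?_⟩
  have e1 := hk1 x hx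
  have e2 := hk2 x hx
  simp only [mul_zero, Real.cos_zero, Real.sin_zero, mul_one, sub_zero, zero_add] at e1 e2
  have h := Real.sin_sq_add_cos_sq (ω * x)
  rw [hfk x hx, trig]
  field_simp
  linear_combination (-ω * k x) * h + Real.cos (ω * x) * e1 + Real.sin (ω * x) * e2

namespace MetricGraph

variable {G : MetricGraph} {u v w : G.Point → ℝ} {D : Set G.Point} {t : ℝ}

theorem form_onSingleEdge (u : G.Point → ℝ) {e : G.E} {g : ℝ → ℝ} {h0 : g 0 = 0}
    {h1 : g (G.len e) = 0} : G.form u (G.onSingleEdge e g h0 h1) =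
      ∫ x in (0 : ℝ)..G.len e, deriv (G.onEdge u e) x * deriv g x := by
  rw [form_eq, Finset.sum_eq_single e]
  · rw [integral_eq_integral_Ioo (G.len_pos e).le]
    refine setIntegral_congr_fun measurableSet_Ioo fun x hx => ?_
    have h2 : EqOn (G.onEdge (G.onSingleEdge e g h0 h1) e) g (Icc 0 (G.len e)) :=
      fun y hy => onSingleEdge_self hy
    simp only [MemH1Interval.deriv_eqOn h2 hx]
  · intro f _ hf
    refine setIntegral_eq_zero_of_forall_eq_zero fun x hx => ?_
    have h2 : EqOn (G.onEdge (G.onSingleEdge e g h0 h1) f) (fun _ => 0) (Icc 0 (G.len f)) :=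
      fun y hy => onSingleEdge_of_ne hy hf
    rw [MemH1Interval.deriv_eqOn h2 hx, deriv_const, mul_zero]
  · intro h
    exact absurd (Finset.mem_univ e) h

theorem innerL2_onSingleEdge (u : G.Point → ℝ) {e : G.E} {g : ℝ → ℝ} {h0 : g 0 = 0}
    {h1 : g (G.len e) = 0} : G.innerL2 u (G.onSingleEdge e g h0 h1) =
      ∫ x in (0 : ℝ)..G.len e, G.onEdge u e x * g x := by
  rw [innerL2_eq, Finset.sum_eq_single e]
  · rw [integral_eq_integral_Ioo (G.len_pos e).le]
    refine setIntegral_congr_fun measurableSet_Ioo fun x hx => ?_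
    have h2 : G.onEdge (G.onSingleEdge e g h0 h1) e x = g x :=
      onSingleEdge_self (Ioo_subset_Icc_self hx)
    simp only [h2]
  · intro f _ hf
    refine setIntegral_eq_zero_of_forall_eq_zero fun x hx => ?_
    have h2 : G.onEdge (G.onSingleEdge e g h0 h1) f x = 0 :=
      onSingleEdge_of_ne (Ioo_subset_Icc_self hx) hf
    rw [h2, mul_zero]
  · intro h
    exact absurd (Finset.mem_univ e) h

namespace IsEigenfunction

/-- On every edge, an eigenfunction is a classical solution of `f'' = -t f`; test functions
supported on a single edge suffice. -/
theorem exists_trig (hD : ∀ e, ∀ x ∈ Ioo 0 (G.len e), G.pt e x ∉ D)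
    (h : G.IsEigenfunction D t u) (ht : 0 < t) (e : G.E) :
    ∃ A B, ∀ x ∈ Icc 0 (G.len e), u (G.pt e x) = trig (√t) A B x := by
  refine exists_trig_of_weak (G.len_pos e) ht (continuous_onEdge h.1.1.1 e) (h.1.1.2 e) ?_
  intro g hg h0 h1
  have h2 := h.2.2 (G.onSingleEdge e g h0 h1) ⟨MemH1.onSingleEdge hg, fun p hp => by
    rcases pt_or_vertex p with ⟨f, x, hx, rfl⟩ | ⟨a, rfl⟩
    · exact absurd hp (hD f x hx)
    · exact onSingleEdge_vertex a⟩
  rwa [form_onSingleEdge, innerL2_onSingleEdge] at h2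

/-- On every edge, an eigenfunction vanishes identically or has finitely many zeros. -/
theorem zeros (hD : ∀ e, ∀ x ∈ Ioo 0 (G.len e), G.pt e x ∉ D)
    (h : G.IsEigenfunction D t u) (ht : 0 < t) (e : G.E) :
    (∀ x ∈ Icc 0 (G.len e), u (G.pt e x) = 0) ∨
      {x | x ∈ Icc 0 (G.len e) ∧ u (G.pt e x) = 0}.Finite := by
  obtain ⟨A, B, hAB⟩ := h.exists_trig hD ht e
  by_cases hz : ∃ x, trig (√t) A B x ≠ 0
  · right
    refine (finite_zeros_trig _ A B 0 (G.len e) hz).subset fun x hx => ⟨hx.1, ?_⟩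
    rw [← hAB x hx.1, hx.2]
  · left
    push Not at hz
    exact fun x hx => by rw [hAB x hx, hz]

theorem neg (h : G.IsEigenfunction D t u) : G.IsEigenfunction D t (-u) := by
  refine ⟨(G.h10 D).neg_mem h.1, neg_ne_zero.2 h.2.1, fun v hv => ?_⟩
  rw [← neg_one_smul ℝ u, form_smul_left, innerL2_smul_left, h.2.2 v hv]
  ring

/-- The derivative of an eigenfunction at an edge endpoint `a` in the direction into the edge, in
terms of the coefficients on the edges. -/
noncomputable def _root_.MetricGraph.outDeriv (G : MetricGraph) (ω : ℝ) (A B : G.E → ℝ)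
    (a : G.E × Bool) : ℝ :=
  if a.2 then -trigDeriv ω (A a.1) (B a.1) (G.len a.1) else trigDeriv ω (A a.1) (B a.1) 0

/-- The Kirchhoff condition: the outgoing derivatives at a vertex add up to zero, tested against an
arbitrary function `α` of the vertices. -/
theorem kirchhoff (h : G.IsEigenfunction ∅ t u) (ht : 0 < t) {A B : G.E → ℝ}
    (hAB : ∀ e, ∀ x ∈ Icc 0 (G.len e), u (G.pt e x) = trig (√t) (A e) (B e) x)
    {α : G.E × Bool → ℝ} (hα : ∀ a b, G.glue a b → α a = α b) :
    ∑ a, G.outDeriv (√t) A B a * α a = 0 := by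
  have h1 := h.2.2 (G.affine α hα) (memH10_empty.2 MemH1.affine)
  have hL : ∀ e, G.len e ≠ 0 := fun e => (G.len_pos e).ne'
  have h2 : ∀ e, ∫ x in (0 : ℝ)..G.len e, deriv (G.onEdge u e) x *
      deriv (G.onEdge (G.affine α hα) e) x =
      -(∑ b, G.outDeriv (√t) A B (e, b) * α (e, b)) +
        t * ∫ x in (0 : ℝ)..G.len e, G.onEdge u e x * G.onEdge (G.affine α hα) e x := by
    intro e
    set q := (α (e, true) - α (e, false)) / G.len e with hq
    have h3 := integral_trigDeriv_mul_affine (√t) (A e) (B e) (G.len e) (α (e, false)) q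
    have h4 : ∫ x in (0 : ℝ)..G.len e, deriv (G.onEdge u e) x *
        deriv (G.onEdge (G.affine α hα) e) x =
        ∫ x in (0 : ℝ)..G.len e, trigDeriv (√t) (A e) (B e) x * q := by
      rw [integral_eq_integral_Ioo (G.len_pos e).le, integral_eq_integral_Ioo (G.len_pos e).le]
      refine setIntegral_congr_fun measurableSet_Ioo fun x hx => ?_
      have h5 : EqOn (G.onEdge u e) (trig (√t) (A e) (B e)) (Icc 0 (G.len e)) := hAB e
      have h6 : EqOn (G.onEdge (G.affine α hα) e) (fun x => α (e, false) + q * x)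
        (Icc 0 (G.len e)) := fun y hy => affine_pt hy
      have h7 : HasDerivAt (fun x => α (e, false) + q * x) q x := by
        simpa using ((hasDerivAt_id x).const_mul q).const_add (α (e, false))
      simp only [MemH1Interval.deriv_eqOn h5 hx, MemH1Interval.deriv_eqOn h6 hx,
        (hasDerivAt_trig _ _ _ x).deriv, h7.deriv]
    have h8 : ∫ x in (0 : ℝ)..G.len e, G.onEdge u e x * G.onEdge (G.affine α hα) e x =
        ∫ x in (0 : ℝ)..G.len e, trig (√t) (A e) (B e) x * (α (e, false) + q * x) := by
      refine intervalIntegral.integral_congr fun x hx => ?_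
      rw [uIcc_of_le (G.len_pos e).le] at hx
      simp only [onEdge, hAB e x hx, affine_pt hx, hq]
    have h9 : q * G.len e = α (e, true) - α (e, false) := div_mul_cancel₀ _ (hL e)
    rw [h4, h3, h8, Real.sq_sqrt ht.le, h9, Fintype.sum_bool]
    simp only [outDeriv, if_true, Bool.false_eq_true, if_false]
    ring
  rw [form, innerL2, Finset.mul_sum, Finset.sum_congr rfl fun e _ => h2 e,
    Finset.sum_add_distrib, Finset.sum_neg_distrib] at h1
  rw [Fintype.sum_prod_type]
  linarith

open Classical in
/-- If an eigenfunction does not change its sign near one of its zeros, it vanishes on all edges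
through that point.

In the interior of an edge, such a zero is a local minimum and thus a double zero. At a vertex, all
outgoing derivatives are nonnegative, and add up to zero by the Kirchhoff condition; hence all of
them vanish. -/
theorem eq_zero_of_nonneg (h : G.IsEigenfunction ∅ t u) (ht : 0 < t) {p : G.Point} (hp : u p = 0)
    (hpos : ∀ᶠ q in 𝓝 p, 0 ≤ u q) {e : G.E} (he : p ∈ G.edgeSet e) :
    ∀ q ∈ G.edgeSet e, u q = 0 := by
  choose A B hAB using h.exists_trig (by simp) ht
  have hω : √t ≠ 0 := (Real.sqrt_pos.2 ht).ne'
  suffices hs : ∀ y, trig (√t) (A e) (B e) y = 0 by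
    rintro _ ⟨x, hx, rfl⟩
    rw [hAB e x hx, hs]
  obtain ⟨x, hx, rfl⟩ := he
  have hx0 : trig (√t) (A e) (B e) x = 0 := by rw [← hAB e x hx, hp]
  by_cases hxi : x ∈ Ioo 0 (G.len e)
  · have hmin : IsLocalMin (trig (√t) (A e) (B e)) x := by
      have h1 := ((G.continuous_pt e).continuousAt (x := x)).eventually hpos
      filter_upwards [h1, Ioo_mem_nhds hxi.1 hxi.2] with y hy hy2
      rw [hx0, ← hAB e y (Ioo_subset_Icc_self hy2)]
      exact hy
    exact trig_eq_zero_of_double_zero hω hx0 (hmin.hasDerivAt_eq_zero (hasDerivAt_trig _ _ _ x))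
  obtain ⟨b, rfl⟩ := eq_pos_of_notMem_Ioo hx hxi
  -- all outgoing derivatives at the vertex are nonnegative
  have hnn : ∀ a : G.E × Bool, G.glue (e, b) a → 0 ≤ G.outDeriv (√t) A B a := by
    rintro ⟨f, c⟩ ha
    have hv : G.vertex (f, c) = G.pt e (G.pos (e, b)) := (vertex_eq_of_glue ha).symm
    have h1 : Tendsto (G.pt f) (𝓝 (G.pos (f, c))) (𝓝 (G.pt e (G.pos (e, b)))) := by
      rw [← hv]
      exact (G.continuous_pt f).continuousAt
    have h2 := h1.eventually hpos
    have h0 : trig (√t) (A f) (B f) (G.pos (f, c)) = 0 := by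
      rw [← hAB f _ (pos_mem _)]
      exact (congrArg u hv).trans hp
    have hd := hasDerivAt_trig (√t) (A f) (B f) (G.pos (f, c))
    have hLf := G.len_pos f
    cases c
    · refine ge_of_tendsto hd.tendsto_slope_zero_right ?_
      have h3 : ∀ᶠ s in 𝓝 (0 : ℝ), 0 ≤ u (G.pt f (0 + s)) := by
        have : Tendsto (fun s : ℝ => 0 + s) (𝓝 0) (𝓝 (0 : ℝ)) := by
          simp only [zero_add]; exact tendsto_id
        exact this.eventually h2
      filter_upwards [h3.filter_mono nhdsWithin_le_nhds, self_mem_nhdsWithin,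
        nhdsWithin_le_nhds (Iio_mem_nhds hLf)] with s hs hs0 hsL
      rw [h0, sub_zero, pos_false]
      rw [hAB f _ ⟨by linarith [show (0 : ℝ) < s from hs0],
        by linarith [show s < _ from hsL]⟩] at hs
      exact smul_nonneg (inv_nonneg.2 (le_of_lt hs0)) hs
    · rw [outDeriv, if_pos rfl]
      refine neg_nonneg.2 (le_of_tendsto hd.tendsto_slope_zero_left ?_)
      have h3 : ∀ᶠ s in 𝓝 (0 : ℝ), 0 ≤ u (G.pt f (G.len f + s)) := by
        have : Tendsto (fun s : ℝ => G.len f + s) (𝓝 0) (𝓝 (G.len f)) := by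
          have h4 : Continuous fun s : ℝ => G.len f + s := by fun_prop
          simpa using h4.tendsto 0
        exact this.eventually h2
      filter_upwards [h3.filter_mono nhdsWithin_le_nhds, self_mem_nhdsWithin,
        nhdsWithin_le_nhds (Ioi_mem_nhds (neg_lt_zero.2 hLf))] with s hs hs0 hsL
      rw [h0, sub_zero, pos_true]
      rw [hAB f _ ⟨by linarith [show -G.len f < s from hsL],
        by linarith [show s < 0 from hs0]⟩] at hs
      exact smul_nonpos_of_nonpos_of_nonneg (inv_nonpos.2 (le_of_lt hs0)) hs
  -- test with the indicator function of the vertex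
  have hK := h.kirchhoff ht hAB (α := fun a => if G.glue (e, b) a then 1 else 0) (by
    intro c d hcd
    have : G.glue (e, b) c ↔ G.glue (e, b) d :=
      ⟨fun h => G.glue.trans h hcd, fun h => G.glue.trans h (G.glue.symm hcd)⟩
    simp [this])
  rw [Finset.sum_eq_zero_iff_of_nonneg] at hK
  · have h1 := hK (e, b) (Finset.mem_univ _)
    rw [if_pos (G.glue.refl _), mul_one] at h1
    refine trig_eq_zero_of_double_zero hω hx0 ?_
    cases b
    · exact h1
    · exact neg_eq_zero.1 h1
  · intro a _
    by_cases ha : G.glue (e, b) a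
    · simp [ha, hnn a ha]
    · simp [ha]

end IsEigenfunction

end MetricGraph

/-! ### Tilings of an interval -/

/-- A finite family of intervals `[o i, o i + l i]` that tile `[0, L]`. -/
structure IsTiling {ι : Type*} (s : Finset ι) (o l : ι → ℝ) (L : ℝ) : Prop where
  pos : ∀ i ∈ s, 0 < l i
  nonneg : ∀ i ∈ s, 0 ≤ o i
  le : ∀ i ∈ s, o i + l i ≤ L
  cover : ∀ x ∈ Icc 0 L, ∃ i ∈ s, x ∈ Icc (o i) (o i + l i)
  disjoint : (s : Set ι).Pairwise fun i j =>
    Disjoint (Ioo (o i) (o i + l i)) (Ioo (o j) (o j + l j))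

namespace IsTiling

variable {ι : Type*} {s : Finset ι} {o l : ι → ℝ} {L : ℝ}

theorem subset (h : IsTiling s o l L) {i : ι} (hi : i ∈ s) :
    Ioo (o i) (o i + l i) ⊆ Ioo 0 L := Ioo_subset_Ioo (h.nonneg i hi) (h.le i hi)

theorem iUnion_ae_eq (h : IsTiling s o l L) :
    (⋃ i ∈ s, Ioo (o i) (o i + l i)) =ᵐ[volume] Ioo 0 L := by
  have hsub : (⋃ i ∈ s, Ioo (o i) (o i + l i)) ⊆ Ioo 0 L := iUnion₂_subset fun i hi => h.subset hi
  refine EventuallyLE.antisymm hsub.eventuallyLE ?_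
  have hfin : (⋃ i ∈ s, ({o i, o i + l i} : Set ℝ)).Finite :=
    s.finite_toSet.biUnion fun i _ => by simp
  have hnull : ∀ᵐ x : ℝ, x ∉ ⋃ i ∈ s, ({o i, o i + l i} : Set ℝ) :=
    measure_eq_zero_iff_ae_notMem.1 (hfin.measure_zero volume)
  filter_upwards [hnull] with x hx hxL
  obtain ⟨i, hi, hxi⟩ := h.cover x (Ioo_subset_Icc_self hxL)
  have h1 : x ≠ o i := fun h => hx (mem_iUnion₂.2 ⟨i, hi, by simp [h]⟩)
  have h2 : x ≠ o i + l i := fun h => hx (mem_iUnion₂.2 ⟨i, hi, by simp [h]⟩)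
  exact mem_iUnion₂.2 ⟨i, hi, lt_of_le_of_ne hxi.1 h1.symm, lt_of_le_of_ne hxi.2 h2⟩

theorem integrableOn_iff (h : IsTiling s o l L) {f : ℝ → ℝ} :
    IntegrableOn f (Ioo 0 L) ↔ ∀ i ∈ s, IntegrableOn f (Ioo (o i) (o i + l i)) := by
  rw [← integrableOn_congr_set_ae h.iUnion_ae_eq, integrableOn_finset_iUnion]

theorem integral_eq (h : IsTiling s o l L) (hL : 0 ≤ L) {f : ℝ → ℝ}
    (hf : IntegrableOn f (Ioo 0 L)) :
    ∫ x in (0 : ℝ)..L, f x = ∑ i ∈ s, ∫ x in (0 : ℝ)..l i, f (o i + x) := by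
  rw [integral_eq_integral_Ioo hL, ← setIntegral_congr_set h.iUnion_ae_eq,
    integral_biUnion_finset s (fun i _ => measurableSet_Ioo) h.disjoint (h.integrableOn_iff.1 hf)]
  refine Finset.sum_congr rfl fun i hi => ?_
  rw [intervalIntegral.integral_comp_add_left, add_zero,
    intervalIntegral.integral_of_le (by linarith [h.pos i hi]), integral_Ioc_eq_integral_Ioo]

theorem measurePreserving_add (a b : ℝ) :
    MeasurePreserving (fun x => a + x) (volume.restrict (Ioo 0 b))
      (volume.restrict (Ioo a (a + b))) := by
  have := (measurePreserving_add_left volume a).restrict_preimage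
    (measurableSet_Ioo (a := a) (b := a + b))
  simpa using this

end IsTiling

namespace MemH1Interval

variable {L : ℝ} {f : ℝ → ℝ}

theorem deriv_shift (f : ℝ → ℝ) (a x : ℝ) :
    deriv (fun x => f (a + x)) x = deriv f (a + x) := deriv_comp_const_add f a x

theorem shift (hf : MemH1Interval L f) {a b : ℝ} (ha : 0 ≤ a) (hb : 0 < b) (hab : a + b ≤ L) :
    MemH1Interval b (fun x => f (a + x)) := by
  have h1 : MemLp (deriv f) 2 (volume.restrict (Ioo a (a + b))) :=
    hf.2.mono_measure (Measure.restrict_mono (Ioo_subset_Ioo ha hab) le_rfl)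
  refine (of_integral hb (h1.comp_measurePreserving (IsTiling.measurePreserving_add a b))
    fun x hx => ?_).1
  have h2 := hf.integral_deriv (x := a) (y := a + x) ⟨ha, by linarith⟩
    ⟨by linarith [hx.1], by linarith [hx.2]⟩
  simp only [Function.comp_def, intervalIntegral.integral_comp_add_left, add_zero, h2]
  ring

/-- A continuous function on an interval is in `H¹` if it is in `H¹` on every tile of a tiling. -/
theorem of_tiling {ι : Type*} {s : Finset ι} {o l : ι → ℝ} (h : IsTiling s o l L) (hL : 0 < L)
    (hfc : ContinuousOn f (Icc 0 L)) (hf : ∀ i ∈ s, MemH1Interval (l i) (fun x => f (o i + x))) :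
    MemH1Interval L f := by
  have hm : MemLp (deriv f) 2 (volume.restrict (Ioo 0 L)) := by
    rw [memLp_two_iff_integrable_sq (measurable_deriv f).aestronglyMeasurable]
    refine h.integrableOn_iff.2 fun i hi => ?_
    have h1 := (hf i hi).2
    rw [memLp_two_iff_integrable_sq (measurable_deriv _).aestronglyMeasurable] at h1
    simp only [deriv_shift] at h1
    exact ((IsTiling.measurePreserving_add (o i) (l i)).integrable_comp_emb
      (measurableEmbedding_addLeft (o i)) (g := fun x => deriv f x ^ 2)).1 h1
  have hint := hm.intervalIntegrable_of_Ioo hL.le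
  have hsub : ∀ {x y : ℝ}, x ∈ Icc 0 L → y ∈ Icc 0 L → IntervalIntegrable (deriv f) volume x y :=
    fun hx hy => hint.mono_set (uIcc_subset_of_mem_Icc hx hy)
  refine (of_integral hL hm fun x hx => ?_).1
  -- the difference of `f` and the primitive of its derivative takes finitely many values
  let k : ℝ → ℝ := fun x => f x - ∫ t in (0 : ℝ)..x, deriv f t
  have hkc : ContinuousOn k (Icc 0 L) := by
    refine hfc.sub ?_
    have := intervalIntegral.continuousOn_primitive_interval' hint (a := 0) (by simp)
    rwa [uIcc_of_le hL.le] at this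
  have hkt : ∀ i ∈ s, ∀ x ∈ Icc (o i) (o i + l i), k x = k (o i) := by
    intro i hi x hx
    have hoi : o i ∈ Icc 0 L := ⟨h.nonneg i hi, by linarith [h.le i hi, h.pos i hi]⟩
    have hxL : x ∈ Icc 0 L := ⟨hoi.1.trans hx.1, hx.2.trans (h.le i hi)⟩
    have h1 := (hf i hi).integral_deriv (x := 0) (y := x - o i) ⟨le_rfl, (h.pos i hi).le⟩
      ⟨by linarith [hx.1], by linarith [hx.2]⟩
    simp only [deriv_shift, intervalIntegral.integral_comp_add_left, add_zero,
      add_sub_cancel] at h1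
    have h2 := intervalIntegral.integral_add_adjacent_intervals
      (hsub ⟨le_rfl, hL.le⟩ hoi) (hsub hoi hxL)
    simp only [k]
    linarith
  have hfin : (k '' Icc 0 L).Finite := by
    refine (s.finite_toSet.image fun i => k (o i)).subset ?_
    rintro _ ⟨x, hx, rfl⟩
    obtain ⟨i, hi, hxi⟩ := h.cover x hx
    exact ⟨i, hi, (hkt i hi x hxi).symm⟩
  have hk0 : k x = k 0 := by
    by_contra hne
    exact (isPreconnected_Icc.image k hkc).infinite_of_nontrivial
      ⟨_, ⟨x, hx, rfl⟩, _, ⟨0, ⟨le_rfl, hL.le⟩, rfl⟩, hne⟩ hfin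
  simp only [k, intervalIntegral.integral_same, sub_zero] at hk0
  linarith

end MemH1Interval

/-! ### Functions on a cut graph -/

namespace MetricGraph

variable {G : MetricGraph} {u v w : G.Point → ℝ}

theorem Subdivision.add_mem (S : G.Subdivision) {e : S.E} {x : ℝ} (hx : x ∈ Icc 0 (S.len e)) :
    S.offset e + x ∈ Icc 0 (G.len (S.parent e)) :=
  ⟨add_nonneg (S.offset_nonneg e) hx.1, by linarith [hx.2, S.offset_add_len_le e]⟩

theorem Subdivision.add_mem_Ioo (S : G.Subdivision) {e : S.E} {x : ℝ} (hx : x ∈ Ioo 0 (S.len e)) :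
    S.offset e + x ∈ Ioo 0 (G.len (S.parent e)) :=
  ⟨add_pos_of_nonneg_of_pos (S.offset_nonneg e) hx.1, by linarith [hx.2, S.offset_add_len_le e]⟩

open Classical in
theorem Subdivision.isTiling (S : G.Subdivision) (e : G.E) :
    IsTiling (Finset.univ.filter fun e₁ => S.parent e₁ = e) S.offset S.len (G.len e) where
  pos i _ := S.len_pos i
  nonneg i _ := S.offset_nonneg i
  le i hi := by
    have h := (Finset.mem_filter.1 hi).2
    rw [← h]
    exact S.offset_add_len_le i
  cover x hx := by
    obtain ⟨i, hi, hx⟩ := S.cover e x hx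
    exact ⟨i, Finset.mem_filter.2 ⟨Finset.mem_univ _, hi⟩, hx⟩
  disjoint i hi j hj hij := S.disjoint i j hij (by
    rw [(Finset.mem_filter.1 hi).2, (Finset.mem_filter.1 hj).2])

/-- Distinct tiles of an edge meet at most in their endpoints. -/
theorem Subdivision.eq_of_mem_Ioo (S : G.Subdivision) {e f : S.E} (hp : S.parent e = S.parent f)
    {x y : ℝ} (hx : x ∈ Ioo 0 (S.len e)) (hy : y ∈ Icc 0 (S.len f))
    (hxy : S.offset e + x = S.offset f + y) : e = f ∧ x = y := by
  by_cases hef : e = f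
  · subst hef
    exact ⟨rfl, add_left_cancel hxy⟩
  · exfalso
    have hd := S.disjoint e f hef hp
    have h1 : Disjoint (Ioo (S.offset e) (S.offset e + S.len e))
        (closure (Ioo (S.offset f) (S.offset f + S.len f))) := hd.closure_right isOpen_Ioo
    rw [closure_Ioo (by linarith [S.len_pos f])] at h1
    have h2 : S.offset e + x ∈ Ioo (S.offset e) (S.offset e + S.len e) :=
      ⟨by linarith [hx.1], by linarith [hx.2]⟩
    refine disjoint_left.1 h1 h2 ?_
    rw [hxy]
    exact ⟨by linarith [hy.1], by linarith [hy.2]⟩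

namespace Cut

variable (C : G.Cut)

theorem proj_pt {e : C.graph.E} {x : ℝ} (hx : x ∈ Icc 0 (C.graph.len e)) :
    C.proj (C.graph.pt e x) = G.pt (C.parent e) (C.offset e + x) := by
  rw [pt_of_mem hx]
  rfl

theorem proj_vertex (a : C.graph.E × Bool) :
    C.proj (C.graph.vertex a) = C.endpointImage a :=
  C.proj_pt (pos_mem a)

theorem continuous_proj : Continuous C.proj := by
  refine continuous_of_continuousOn_pt fun e => ?_
  refine ContinuousOn.congr (f := fun x => G.pt (C.parent e) (C.offset e + x)) ?_
    fun x hx => C.proj_pt hx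
  exact ((G.continuous_pt _).comp (by fun_prop)).continuousOn

theorem surjective_proj : Function.Surjective C.proj := by
  intro p
  obtain ⟨e, x, hx, rfl⟩ := exists_pt p
  obtain ⟨e₁, rfl, hx1⟩ := C.cover e x hx
  have h2 : x - C.offset e₁ ∈ Icc 0 (C.graph.len e₁) :=
    ⟨by linarith [hx1.1], by
      have := hx1.2
      change x - C.offset e₁ ≤ C.len e₁
      linarith⟩
  exact ⟨C.graph.pt e₁ (x - C.offset e₁), by rw [C.proj_pt h2, add_sub_cancel]⟩

theorem isClosedMap_proj : IsClosedMap C.proj := C.continuous_proj.isClosedMap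

/-- The map to the original graph is injective over the interiors of the new edges. -/
theorem eq_of_proj_eq {e : C.graph.E} {x : ℝ} (hx : x ∈ Ioo 0 (C.graph.len e)) {q : C.graph.Point}
    (h : C.proj q = C.proj (C.graph.pt e x)) : q = C.graph.pt e x := by
  obtain ⟨f, y, hy, rfl⟩ := exists_pt q
  rw [C.proj_pt hy, C.proj_pt (Ioo_subset_Icc_self hx)] at h
  obtain ⟨h1, h2⟩ := pt_eq_pt_of_mem_Ioo (C.add_mem_Ioo hx) (C.add_mem hy) h.symm
  obtain ⟨rfl, rfl⟩ := C.eq_of_mem_Ioo h1 hx hy h2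
  rfl

theorem not_isCutVertex {e : C.graph.E} {x : ℝ} (hx : x ∈ Ioo 0 (C.graph.len e)) :
    ¬ C.IsCutVertex (C.graph.pt e x) := fun ⟨_, hq, hq2⟩ => hq (C.eq_of_proj_eq hx hq2)

theorem onEdge_comp_proj (u : G.Point → ℝ) (e : C.graph.E) :
    EqOn (C.graph.onEdge (fun p => u (C.proj p)) e)
      (fun x => G.onEdge u (C.parent e) (C.offset e + x)) (Icc 0 (C.graph.len e)) := by
  intro x hx
  simp only [onEdge, C.proj_pt hx]

/-- A function on the graph is in `H¹` if and only if it is in `H¹` as a function on the cut graph.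
Continuity descends, since `C.proj` is a quotient map. -/
theorem memH1_comp_proj : C.graph.MemH1 (fun p => u (C.proj p)) ↔ G.MemH1 u := by
  classical
  constructor
  · intro h
    have hq : IsQuotientMap C.proj :=
      C.isClosedMap_proj.isQuotientMap C.continuous_proj C.surjective_proj
    have huc : Continuous u := hq.continuous_iff.2 h.1
    refine ⟨huc, fun e => ?_⟩
    refine MemH1Interval.of_tiling (C.isTiling e) (G.len_pos e)
      (continuous_onEdge huc e).continuousOn fun i hi => ?_
    have h1 := MemH1Interval.congr (C.len_pos i).le (h.2 i) (C.onEdge_comp_proj u i)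
    rwa [(Finset.mem_filter.1 hi).2] at h1
  · intro h
    refine ⟨h.1.comp C.continuous_proj, fun e => ?_⟩
    exact ((h.interval (C.parent e)).shift (C.offset_nonneg e) (C.len_pos e)
      (C.offset_add_len_le e)).congr (C.len_pos e).le (C.onEdge_comp_proj u e).symm

theorem sum_integral (f : G.E → ℝ → ℝ) (hf : ∀ e, IntegrableOn (f e) (Ioo 0 (G.len e))) :
    ∑ e, ∫ x in (0 : ℝ)..G.len e, f e x =
      ∑ e : C.graph.E, ∫ x in (0 : ℝ)..C.graph.len e, f (C.parent e) (C.offset e + x) := by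
  classical
  have h1 : ∀ e, ∫ x in (0 : ℝ)..G.len e, f e x =
      ∑ i with C.parent i = e, ∫ x in (0 : ℝ)..C.len i, f (C.parent i) (C.offset i + x) := by
    intro e
    rw [(C.isTiling e).integral_eq (G.len_pos e).le (hf e)]
    refine Finset.sum_congr rfl fun i hi => ?_
    rw [(Finset.mem_filter.1 hi).2]
  rw [Finset.sum_congr rfl fun e _ => h1 e]
  exact Finset.sum_fiberwise Finset.univ C.parent _

theorem form_comp_proj (hu : G.MemH1 u) (hv : G.MemH1 v) :
    C.graph.form (fun p => u (C.proj p)) (fun p => v (C.proj p)) = G.form u v := by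
  rw [form, form, C.sum_integral _ fun e => MemH1Interval.integrable_mul (hu.2 e).2 (hv.2 e).2]
  refine Finset.sum_congr rfl fun e _ => ?_
  rw [integral_eq_integral_Ioo (C.graph.len_pos e).le,
    integral_eq_integral_Ioo (C.graph.len_pos e).le]
  refine setIntegral_congr_fun measurableSet_Ioo fun x hx => ?_
  simp only [MemH1Interval.deriv_eqOn (C.onEdge_comp_proj u e) hx,
    MemH1Interval.deriv_eqOn (C.onEdge_comp_proj v e) hx, MemH1Interval.deriv_shift]

theorem innerL2_comp_proj (hu : Continuous u) (hv : Continuous v) :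
    C.graph.innerL2 (fun p => u (C.proj p)) (fun p => v (C.proj p)) = G.innerL2 u v := by
  rw [innerL2, innerL2, C.sum_integral _ fun e =>
    MemH1Interval.integrable_mul (memLp_onEdge hu e) (memLp_onEdge hv e)]
  refine Finset.sum_congr rfl fun e _ => ?_
  rw [integral_eq_integral_Ioo (C.graph.len_pos e).le,
    integral_eq_integral_Ioo (C.graph.len_pos e).le]
  refine setIntegral_congr_fun measurableSet_Ioo fun x hx => ?_
  simp only [C.onEdge_comp_proj u e (Ioo_subset_Icc_self hx),
    C.onEdge_comp_proj v e (Ioo_subset_Icc_self hx)]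

end Cut

end MetricGraph

/-! ### Clusters of a partition -/

namespace MetricGraph

variable {G : MetricGraph}

theorem inclRestrict_pt (S : Set G.E) (e : (G.restrict S).E) {x : ℝ}
    (hx : x ∈ Icc 0 ((G.restrict S).len e)) :
    G.inclRestrict S ((G.restrict S).pt e x) = G.pt (Subtype.val e) x := by
  rw [pt_of_mem hx]
  rfl

theorem continuous_inclRestrict (S : Set G.E) : Continuous (G.inclRestrict S) := by
  refine continuous_of_continuousOn_pt fun e => ?_
  exact (G.continuous_pt (Subtype.val e)).continuousOn.congr fun x hx => inclRestrict_pt S e hx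

theorem injective_inclRestrict (S : Set G.E) : Function.Injective (G.inclRestrict S) := by
  intro p q h
  obtain ⟨e, x, hx, rfl⟩ := exists_pt p
  obtain ⟨f, y, hy, rfl⟩ := exists_pt q
  rw [inclRestrict_pt S e hx, inclRestrict_pt S f hy] at h
  rcases pt_eq_pt (e := Subtype.val e) (f := Subtype.val f) hx hy h with
    ⟨h1, rfl⟩ | ⟨b, c, h1, rfl, rfl⟩
  · rw [show e = f from Subtype.ext h1]
  · exact vertex_eq_of_glue (G := G.restrict S) (a := (e, b)) (b := (f, c)) h1

theorem isClosedEmbedding_inclRestrict (S : Set G.E) :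
    IsClosedEmbedding (G.inclRestrict S) :=
  (continuous_inclRestrict S).isClosedEmbedding (injective_inclRestrict S)

theorem range_inclRestrict (S : Set G.E) : range (G.inclRestrict S) = G.edgesSet S := by
  ext p
  rw [mem_edgesSet]
  constructor
  · rintro ⟨q, rfl⟩
    obtain ⟨e, x, hx, rfl⟩ := exists_pt q
    exact ⟨e.1, e.2, x, hx, (inclRestrict_pt S e hx).symm⟩
  · rintro ⟨e, he, x, hx, rfl⟩
    exact ⟨(G.restrict S).pt ⟨e, he⟩ x, inclRestrict_pt S ⟨e, he⟩ hx⟩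

end MetricGraph

namespace GraphPartition

open MetricGraph

variable {G : MetricGraph} {k : ℕ} (P : GraphPartition G k)

theorem range_clusterIncl (i : Fin k) : range (P.clusterIncl i) = P.clusterSet i := by
  rw [clusterSet, componentSet_eq]
  exact range_inclRestrict _

theorem isClosedEmbedding_clusterIncl (i : Fin k) : IsClosedEmbedding (P.clusterIncl i) :=
  isClosedEmbedding_inclRestrict _

theorem clusterIncl_pt {i : Fin k} {e : (P.clusterGraph i).E} {x : ℝ}
    (hx : x ∈ Icc 0 ((P.clusterGraph i).len e)) :
    P.clusterIncl i ((P.clusterGraph i).pt e x) = P.cut.graph.pt (Subtype.val e) x :=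
  inclRestrict_pt _ e hx

theorem continuous_clusterProj (i : Fin k) : Continuous (P.clusterProj i) :=
  P.cut.continuous_proj.comp (P.isClosedEmbedding_clusterIncl i).continuous

theorem clusterProj_pt {i : Fin k} {e : (P.clusterGraph i).E} {x : ℝ}
    (hx : x ∈ Icc 0 ((P.clusterGraph i).len e)) :
    P.clusterProj i ((P.clusterGraph i).pt e x) =
      G.pt (P.cut.parent (Subtype.val e)) (P.cut.offset (Subtype.val e) + x) := by
  rw [clusterProj, P.clusterIncl_pt hx]
  exact P.cut.proj_pt hx

theorem clusterSupport_eq_range (i : Fin k) : P.clusterSupport i = range (P.clusterProj i) := by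
  rw [clusterSupport, ← P.range_clusterIncl, ← range_comp]
  rfl

theorem clusterIncl_ne {i j : Fin k} (hij : i ≠ j) (p : (P.clusterGraph i).Point)
    (q : (P.clusterGraph j).Point) : P.clusterIncl i p ≠ P.clusterIncl j q := by
  intro h
  have h1 : P.clusterIncl i p ∈ P.clusterSet i := by
    rw [← P.range_clusterIncl]; exact mem_range_self p
  have h2 : P.clusterIncl j q ∈ P.clusterSet j := by
    rw [← P.range_clusterIncl]; exact mem_range_self q
  rw [h] at h1
  exact hij (P.cluster_injective (h1.symm.trans h2))

instance (i : Fin k) : Nonempty (P.clusterGraph i).E := by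
  obtain ⟨p, hp⟩ := componentSet_nonempty (P.cluster i)
  obtain ⟨e, x, -, rfl⟩ := exists_pt p
  exact ⟨⟨e, mem_componentSet_pt.1 hp⟩⟩

theorem pt_notMem_dirichletVertices {i : Fin k} (e : (P.clusterGraph i).E) (x : ℝ)
    (hx : x ∈ Ioo 0 ((P.clusterGraph i).len e)) :
    (P.clusterGraph i).pt e x ∉ P.dirichletVertices i := by
  intro h
  change P.cut.IsCutVertex (P.clusterIncl i _) at h
  rw [P.clusterIncl_pt (Ioo_subset_Icc_self hx)] at h
  exact P.cut.not_isCutVertex hx h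

/-- Two different points of clusters over the same point of the graph are cut points. -/
theorem mem_dirichletVertices_of_ne {i j : Fin k} {p : (P.clusterGraph i).Point}
    {q : (P.clusterGraph j).Point} (h : P.clusterProj i p = P.clusterProj j q)
    (hne : P.clusterIncl i p ≠ P.clusterIncl j q) : p ∈ P.dirichletVertices i :=
  ⟨P.clusterIncl j q, hne.symm, h.symm⟩

variable {P}

theorem exists_clusterIncl (hP : P.IsExhaustive) (q : P.cut.graph.Point) :
    ∃ i p, P.clusterIncl i p = q := by
  obtain ⟨i, hi⟩ := hP (ConnectedComponents.mk q)
  have : q ∈ range (P.clusterIncl i) := by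
    rw [P.range_clusterIncl]
    exact hi.symm
  obtain ⟨p, hp⟩ := this
  exact ⟨i, p, hp⟩

theorem exists_clusterProj (hP : P.IsExhaustive) (x : G.Point) :
    ∃ i p, P.clusterProj i p = x := by
  obtain ⟨q, rfl⟩ := P.cut.surjective_proj x
  obtain ⟨i, p, rfl⟩ := exists_clusterIncl hP q
  exact ⟨i, p, rfl⟩

/-- Functions on the clusters that satisfy the Dirichlet conditions define a function on the
graph. -/
theorem exists_glue (hP : P.IsExhaustive) {v : ∀ i, (P.clusterGraph i).Point → ℝ}
    (hv : ∀ i, ∀ p ∈ P.dirichletVertices i, v i p = 0) :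
    ∃ u : G.Point → ℝ, ∀ i p, u (P.clusterProj i p) = v i p := by
  choose ι π hπ using exists_clusterProj hP
  have key : ∀ i p j q, P.clusterProj i p = P.clusterProj j q → v i p = v j q := by
    intro i p j q h
    by_cases hne : P.clusterIncl i p = P.clusterIncl j q
    · by_cases hij : i = j
      · subst hij
        rw [(P.isClosedEmbedding_clusterIncl i).injective hne]
      · exact absurd hne (P.clusterIncl_ne hij _ _)
    · rw [hv i p (P.mem_dirichletVertices_of_ne h hne),
        hv j q (P.mem_dirichletVertices_of_ne h.symm (Ne.symm hne))]
  exact ⟨fun x => v (ι x) (π x), fun i p => key _ _ _ _ (hπ _)⟩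

theorem bijective_edges (hP : P.IsExhaustive) :
    Function.Bijective (fun s : Σ i, (P.clusterGraph i).E => (s.2.1 : P.cut.graph.E)) := by
  constructor
  · rintro ⟨i, e, he⟩ ⟨j, f, hf⟩ (h : e = f)
    subst h
    have hij : i = j := P.cluster_injective (he.symm.trans hf)
    subst hij
    rfl
  · intro e
    obtain ⟨i, hi⟩ := hP (ConnectedComponents.mk (P.cut.graph.pt e 0))
    exact ⟨⟨i, e, hi.symm⟩, rfl⟩

theorem onEdge_comp_clusterIncl (w : P.cut.graph.Point → ℝ) {i : Fin k}
    (e : (P.clusterGraph i).E) :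
    EqOn ((P.clusterGraph i).onEdge (fun p => w (P.clusterIncl i p)) e)
      (P.cut.graph.onEdge w (Subtype.val e)) (Icc 0 ((P.clusterGraph i).len e)) := by
  intro x hx
  simp only [onEdge, P.clusterIncl_pt hx]

theorem memH1_iff (hP : P.IsExhaustive) {u : G.Point → ℝ} :
    G.MemH1 u ↔ ∀ i, (P.clusterGraph i).MemH1 (fun p => u (P.clusterProj i p)) := by
  rw [← P.cut.memH1_comp_proj]
  constructor
  · intro h i
    refine ⟨h.1.comp (P.isClosedEmbedding_clusterIncl i).continuous, fun e => ?_⟩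
    exact MemH1Interval.congr ((P.clusterGraph i).len_pos e).le (h.2 (Subtype.val e))
      (onEdge_comp_clusterIncl _ e).symm
  · intro h
    have hc : ∀ e, ∃ i, ∃ he : e ∈ P.cut.graph.componentEdges (P.cluster i), True := fun e => by
      obtain ⟨i, hi⟩ := hP (ConnectedComponents.mk (P.cut.graph.pt e 0))
      exact ⟨i, hi.symm, trivial⟩
    refine ⟨continuous_of_continuousOn_pt fun e => ?_, fun e => ?_⟩
    · obtain ⟨i, he, -⟩ := hc e
      exact (continuous_onEdge (h i).1 ⟨e, he⟩).continuousOn.congr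
        (onEdge_comp_clusterIncl (fun p => u (P.cut.proj p)) ⟨e, he⟩).symm
    · obtain ⟨i, he, -⟩ := hc e
      exact MemH1Interval.congr (P.cut.graph.len_pos e).le ((h i).2 ⟨e, he⟩)
        (onEdge_comp_clusterIncl (fun p => u (P.cut.proj p)) ⟨e, he⟩)

theorem form_eq_sum (hP : P.IsExhaustive) {u v : G.Point → ℝ} (hu : G.MemH1 u) (hv : G.MemH1 v) :
    G.form u v = ∑ i, (P.clusterGraph i).form (fun p => u (P.clusterProj i p))
      (fun p => v (P.clusterProj i p)) := by
  rw [← P.cut.form_comp_proj hu hv, MetricGraph.form_eq, ← (bijective_edges hP).sum_comp,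
    Fintype.sum_sigma]
  refine Finset.sum_congr rfl fun i _ => ?_
  rw [MetricGraph.form_eq]
  refine Finset.sum_congr rfl fun e _ => ?_
  refine setIntegral_congr_fun measurableSet_Ioo fun x hx => ?_
  have h1 := MemH1Interval.deriv_eqOn (onEdge_comp_clusterIncl (fun p => u (P.cut.proj p)) e) hx
  have h2 := MemH1Interval.deriv_eqOn (onEdge_comp_clusterIncl (fun p => v (P.cut.proj p)) e) hx
  exact (congrArg₂ (· * ·) h1 h2).symm

theorem innerL2_eq_sum (hP : P.IsExhaustive) {u v : G.Point → ℝ} (hu : Continuous u)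
    (hv : Continuous v) :
    G.innerL2 u v = ∑ i, (P.clusterGraph i).innerL2 (fun p => u (P.clusterProj i p))
      (fun p => v (P.clusterProj i p)) := by
  rw [← P.cut.innerL2_comp_proj hu hv, MetricGraph.innerL2_eq, ← (bijective_edges hP).sum_comp,
    Fintype.sum_sigma]
  refine Finset.sum_congr rfl fun i _ => ?_
  rw [MetricGraph.innerL2_eq]
  refine Finset.sum_congr rfl fun e _ => ?_
  refine setIntegral_congr_fun measurableSet_Ioo fun x hx => ?_
  have h1 := onEdge_comp_clusterIncl (fun p => u (P.cut.proj p)) e (Ioo_subset_Icc_self hx)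
  have h2 := onEdge_comp_clusterIncl (fun p => v (P.cut.proj p)) e (Ioo_subset_Icc_self hx)
  exact (congrArg₂ (· * ·) h1 h2).symm

theorem lambda1_mul_le (i : Fin k) {v : (P.clusterGraph i).Point → ℝ}
    (hv : (P.clusterGraph i).MemH10 (P.dirichletVertices i) v) :
    P.lambda1 i * (P.clusterGraph i).innerL2 v v ≤ (P.clusterGraph i).form v v :=
  (first_eigenvalue P.pt_notMem_dirichletVertices).1 v hv

theorem exists_nonneg_eigenfunction (i : Fin k) :
    ∃ ψ, (P.clusterGraph i).IsEigenfunction (P.dirichletVertices i) (P.lambda1 i) ψ ∧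
      ∀ p, 0 ≤ ψ p :=
  (first_eigenvalue P.pt_notMem_dirichletVertices).2

theorem lambda1_le_dirichletEnergy (i : Fin k) : P.lambda1 i ≤ P.dirichletEnergy :=
  le_ciSup (finite_range _).bddAbove i

/-! ### The lower bound for the energy -/

/-- Glue the first eigenfunctions of the two clusters to a function with mean zero. It is admissible
in the variational characterization of the second eigenvalue, and has Rayleigh quotient at most the
energy of the partition. If the energy does not exceed the second eigenvalue, that function is a
minimizer, and both first eigenvalues agree with the second eigenvalue of the graph. -/
theorem mu_two_le_and_eq [ConnectedSpace G.Point] {P : GraphPartition G 2} (hP : P.IsExhaustive) :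
    G.mu 2 ≤ P.dirichletEnergy ∧ (P.dirichletEnergy ≤ G.mu 2 →
      (∀ i, P.lambda1 i = G.mu 2) ∧ ∃ (ψ : ∀ i, (P.clusterGraph i).Point → ℝ)
        (φ : G.Point → ℝ) (c : Fin 2 → ℝ),
        (∀ i, (P.clusterGraph i).IsEigenfunction (P.dirichletVertices i) (P.lambda1 i) (ψ i)) ∧
        (∀ i p, 0 ≤ ψ i p) ∧ 0 < c 0 ∧ c 1 < 0 ∧
        (∀ i p, φ (P.clusterProj i p) = c i * ψ i p) ∧ G.IsEigenfunction ∅ (G.mu 2) φ) := by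
  choose ψ hψ hψ0 using P.exists_nonneg_eigenfunction
  let m : Fin 2 → ℝ := fun i => (P.clusterGraph i).innerL2 (P.clusterGraph i).one (ψ i)
  let N : Fin 2 → ℝ := fun i => (P.clusterGraph i).innerL2 (ψ i) (ψ i)
  have hm : ∀ i, 0 < m i := by
    intro i
    refine innerL2_pos memH1_one.1 (hψ i).1.1.1 (fun p => by simpa [one] using hψ0 i p) ?_
    obtain ⟨p, hp⟩ := Function.ne_iff.1 (hψ i).2.1
    exact ⟨p, by simpa [one] using lt_of_le_of_ne (hψ0 i p) (Ne.symm hp)⟩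
  have hN : ∀ i, 0 < N i := fun i => innerL2_self_pos (hψ i).1.1.1 (hψ i).2.1
  let c : Fin 2 → ℝ := ![m 1, -m 0]
  have hc0 : 0 < c 0 := hm 1
  have hc1 : c 1 < 0 := neg_lt_zero.2 (hm 0)
  obtain ⟨φ, hφ⟩ := exists_glue hP (v := fun i p => c i * ψ i p) (fun i p hp => by
    rw [(hψ i).1.2 p hp, mul_zero])
  have hφ' : ∀ i, (fun p => φ (P.clusterProj i p)) = c i • ψ i := fun i => funext fun p => hφ i p
  have hφ1 : G.MemH1 φ := (memH1_iff hP).2 fun i => by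
    rw [hφ']; exact (hψ i).1.1.const_smul _
  have hmean : G.innerL2 G.one φ = 0 := by
    rw [innerL2_eq_sum hP memH1_one.1 hφ1.1, Fin.sum_univ_two, hφ', hφ', innerL2_smul_right,
      innerL2_smul_right]
    change m 1 * m 0 + -m 0 * m 1 = 0
    ring
  have hNφ : G.innerL2 φ φ = c 0 ^ 2 * N 0 + c 1 ^ 2 * N 1 := by
    rw [innerL2_eq_sum hP hφ1.1 hφ1.1, Fin.sum_univ_two, hφ', hφ', innerL2_smul_right,
      innerL2_smul_right, innerL2_smul_left, innerL2_smul_left]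
    simp only [N]
    ring
  have hAφ : G.form φ φ = c 0 ^ 2 * N 0 * P.lambda1 0 + c 1 ^ 2 * N 1 * P.lambda1 1 := by
    rw [form_eq_sum hP hφ1 hφ1, Fin.sum_univ_two, hφ', hφ', form_smul_right, form_smul_right,
      form_smul_left, form_smul_left, eigenvalue_eq_rayleigh (hψ 0), eigenvalue_eq_rayleigh (hψ 1)]
    simp only [N]
    ring
  obtain ⟨hμ, hmin, heq, -⟩ := second_eigenvalue (G := G)
  have h1 := hmin φ hφ1 hmean
  have hw0 : 0 < c 0 ^ 2 * N 0 := mul_pos (pow_pos hc0 2) (hN 0)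
  have hw1 : 0 < c 1 ^ 2 * N 1 := mul_pos (by nlinarith) (hN 1)
  have hl0 := P.lambda1_le_dirichletEnergy 0
  have hl1 := P.lambda1_le_dirichletEnergy 1
  rw [hAφ, hNφ] at h1
  set w0 := c 0 ^ 2 * N 0
  set w1 := c 1 ^ 2 * N 1
  refine ⟨?_, fun hle => ?_⟩
  · by_contra hlt
    rw [not_le] at hlt
    nlinarith [mul_le_mul_of_nonneg_left hl0 hw0.le, mul_le_mul_of_nonneg_left hl1 hw1.le]
  · have hl0' := hl0.trans hle
    have hl1' := hl1.trans hle
    have e0 : P.lambda1 0 = G.mu 2 := by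
      refine le_antisymm hl0' ?_
      by_contra hlt
      rw [not_le] at hlt
      nlinarith [mul_lt_mul_of_pos_left hlt hw0, mul_le_mul_of_nonneg_left hl1' hw1.le]
    have e1 : P.lambda1 1 = G.mu 2 := by
      refine le_antisymm hl1' ?_
      by_contra hlt
      rw [not_le] at hlt
      nlinarith [mul_lt_mul_of_pos_left hlt hw1, mul_le_mul_of_nonneg_left hl0' hw0.le]
    refine ⟨fun i => by fin_cases i; exacts [e0, e1], ψ, φ, c, hψ, hψ0, hc0, hc1, hφ, ?_⟩
    refine heq φ hφ1 ?_ hmean ?_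
    · rintro rfl
      have : G.innerL2 (0 : G.Point → ℝ) 0 = 0 := by simp [innerL2, onEdge]
      rw [this] at hNφ
      linarith
    · rw [hAφ, hNφ, e0, e1]
      linarith

end GraphPartition

/-! ### Subdividing a graph at the zeros of a function -/

namespace MetricGraph

variable {G : MetricGraph}

/-- There is a subdivision whose new vertices include given finitely many points of each edge. -/
theorem exists_subdivision (G : MetricGraph) (Z : G.E → Set ℝ) (hZ : ∀ e, (Z e).Finite) :
    ∃ S : G.Subdivision, ∀ e₁, ∀ x ∈ Ioo 0 (S.len e₁), S.offset e₁ + x ∉ Z (S.parent e₁) := by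
  classical
  -- the tiles of `e` are the intervals from a point `x` of `pts e` to the next point
  let pts : G.E → Finset ℝ := fun e =>
    insert 0 (insert (G.len e) ((hZ e).toFinset.filter fun x => x ∈ Icc 0 (G.len e)))
  have hpts : ∀ e, ∀ x ∈ pts e, x ∈ Icc 0 (G.len e) := by
    intro e x hx
    simp only [pts, Finset.mem_insert, Finset.mem_filter] at hx
    rcases hx with rfl | rfl | hx
    · exact G.zero_mem e
    · exact G.len_mem e
    · exact hx.2
  have h0 : ∀ e, 0 ∈ pts e := fun e => by simp [pts]
  have hL : ∀ e, G.len e ∈ pts e := fun e => by simp [pts]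
  have hgt : ∀ e, ∀ x < G.len e, ((pts e).filter fun y => x < y).Nonempty :=
    fun e x hx => ⟨_, Finset.mem_filter.2 ⟨hL e, hx⟩⟩
  let next : ∀ e, ∀ x < G.len e, ℝ := fun e x hx =>
    ((pts e).filter fun y => x < y).min' (hgt e x hx)
  have hnext : ∀ e x hx, next e x hx ∈ pts e ∧ x < next e x hx := fun e x hx =>
    Finset.mem_filter.1 (Finset.min'_mem _ (hgt e x hx))
  have hnext_le : ∀ e x hx, ∀ y ∈ pts e, x < y → next e x hx ≤ y := fun e x hx y hy hxy =>
    Finset.min'_le _ _ (Finset.mem_filter.2 ⟨hy, hxy⟩)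
  have hdisj : ∀ (e : G.E) (x x' : ℝ) (hx : x < G.len e) (hx' : x' < G.len e), x' ∈ pts e →
      x < x' → Disjoint (Ioo x (x + (next e x hx - x))) (Ioo x' (x' + (next e x' hx' - x'))) := by
    intro e x x' hx hx' hx'p hlt
    rw [disjoint_left]
    rintro y ⟨-, hy1⟩ ⟨hy2, -⟩
    linarith [hnext_le e x hx x' hx'p hlt]
  let S : G.Subdivision :=
    { E := Σ e : G.E, {x // x ∈ (pts e).filter fun x => x < G.len e}
      len := fun s => next s.1 s.2.1 (Finset.mem_filter.1 s.2.2).2 - s.2.1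
      len_pos := fun s => sub_pos.2 (hnext _ _ (Finset.mem_filter.1 s.2.2).2).2
      parent := fun s => s.1
      offset := fun s => s.2.1
      offset_nonneg := fun s => (hpts _ _ (Finset.mem_filter.1 s.2.2).1).1
      offset_add_len_le := fun s => by
        have := (hpts _ _ (hnext s.1 s.2.1 (Finset.mem_filter.1 s.2.2).2).1).2
        linarith
      cover := by
        intro e y hy
        -- the tile starts at the last point before `y`
        have hcase : ∃ x, ∃ hx : x ∈ pts e ∧ x < G.len e, x ≤ y ∧ y ≤ next e x hx.2 := by
          rcases hy.2.lt_or_eq with hyL | hyL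
          · have hne : ((pts e).filter fun x => x ≤ y).Nonempty :=
              ⟨0, Finset.mem_filter.2 ⟨h0 e, hy.1⟩⟩
            obtain ⟨hx1, hx2⟩ := Finset.mem_filter.1 (Finset.max'_mem _ hne)
            refine ⟨_, ⟨hx1, hx2.trans_lt hyL⟩, hx2, ?_⟩
            by_contra! hlt
            have h1 := hnext e _ (hx2.trans_lt hyL)
            exact absurd (Finset.le_max' _ _ (Finset.mem_filter.2 ⟨h1.1, hlt.le⟩)) (not_le.2 h1.2)
          · have hne : ((pts e).filter fun x => x < G.len e).Nonempty :=
              ⟨0, Finset.mem_filter.2 ⟨h0 e, G.len_pos e⟩⟩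
            obtain ⟨hx1, hx2⟩ := Finset.mem_filter.1 (Finset.max'_mem _ hne)
            refine ⟨_, ⟨hx1, hx2⟩, by rw [hyL]; exact hx2.le, ?_⟩
            by_contra! hlt
            have h1 := hnext e _ hx2
            exact absurd (Finset.le_max' _ _ (Finset.mem_filter.2 ⟨h1.1, hyL ▸ hlt⟩))
              (not_le.2 h1.2)
        obtain ⟨x, hx, h1, h2⟩ := hcase
        exact ⟨⟨e, x, Finset.mem_filter.2 hx⟩, rfl, h1, by
          change y ≤ x + (next e x hx.2 - x)
          linarith⟩
      disjoint := by
        rintro ⟨e, x, hx⟩ ⟨e', x', hx'⟩ hne (rfl : e = e')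
        have hxf := Finset.mem_filter.1 hx
        have hxf' := Finset.mem_filter.1 hx'
        rcases lt_trichotomy x x' with h | rfl | h
        · exact hdisj e x x' hxf.2 hxf'.2 hxf'.1 h
        · exact absurd rfl hne
        · exact (hdisj e x' x hxf'.2 hxf.2 hxf.1 h).symm }
  refine ⟨S, ?_⟩
  rintro ⟨e, x, hx⟩ y ⟨hy1, hy2⟩ hz
  have hxf := Finset.mem_filter.1 hx
  change y < next e x hxf.2 - x at hy2
  change x + y ∈ Z e at hz
  have h1 := (hpts e x hxf.1).1
  have h2 := (hpts e _ (hnext e x hxf.2).1).2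
  have hmem : x + y ∈ pts e := by
    simp only [pts, Finset.mem_insert, Finset.mem_filter, Set.Finite.mem_toFinset]
    exact Or.inr (Or.inr ⟨hz, by linarith, by linarith⟩)
  linarith [hnext_le e x hxf.2 _ hmem (by linarith)]

/-- A function that has finitely many zeros on every edge on which it does not vanish identically,
admits a subdivision such that on the interior of each new edge it vanishes nowhere or
everywhere. -/
theorem exists_nodal_subdivision {ψ : G.Point → ℝ}
    (h : ∀ e, (∀ x ∈ Icc 0 (G.len e), ψ (G.pt e x) = 0) ∨
      {x | x ∈ Icc 0 (G.len e) ∧ ψ (G.pt e x) = 0}.Finite) :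
    ∃ S : G.Subdivision, ∀ e,
      (∀ x ∈ Icc 0 (S.len e), ψ (G.pt (S.parent e) (S.offset e + x)) = 0) ∨
      ∀ x ∈ Ioo 0 (S.len e), ψ (G.pt (S.parent e) (S.offset e + x)) ≠ 0 := by
  let Z : G.E → Set ℝ := fun e => {x | (x ∈ Icc 0 (G.len e) ∧ ψ (G.pt e x) = 0) ∧
    ∃ y ∈ Icc 0 (G.len e), ψ (G.pt e y) ≠ 0}
  obtain ⟨S, hS⟩ := exists_subdivision G Z fun e => by
    rcases h e with h | h
    · refine Set.finite_empty.subset ?_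
      rintro x ⟨-, y, hy, hy2⟩
      exact hy2 (h y hy)
    · exact h.subset fun x hx => hx.1
  refine ⟨S, fun e => ?_⟩
  by_cases hz : ∃ y ∈ Icc 0 (G.len (S.parent e)), ψ (G.pt (S.parent e) y) ≠ 0
  · right
    intro x hx h0
    exact hS e x hx ⟨⟨S.add_mem (Ioo_subset_Icc_self hx), h0⟩, hz⟩
  · left
    push Not at hz
    exact fun x hx => hz _ (S.add_mem hx)

/-! ### Bisections -/

/-- Two edges of a subdivision are adjacent if they share a vertex of the graph. -/
def Subdivision.Adj (S : G.Subdivision) (e f : S.E) : Prop :=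
  ∃ b c, S.endpointImage (e, b) = S.endpointImage (f, c)

/-- The cut that separates the edges in `T` from all other edges. -/
def Subdivision.bisect (S : G.Subdivision) (T : Set S.E) : G.Cut where
  toSubdivision := S
  glue :=
    { r := fun a b => S.endpointImage a = S.endpointImage b ∧ (a.1 ∈ T ↔ b.1 ∈ T)
      iseqv := ⟨fun _ => ⟨rfl, Iff.rfl⟩, fun h => ⟨h.1.symm, h.2.symm⟩,
        fun h h2 => ⟨h.1.trans h2.1, h.2.trans h2.2⟩⟩ }
  glue_le := fun _ _ h => h.1

/-- Closed edges are the closures of their interiors. -/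
theorem pt_mem_closure {e : G.E} {x : ℝ} (hx : x ∈ Icc 0 (G.len e)) :
    G.pt e x ∈ closure (G.pt e '' Ioo 0 (G.len e)) := by
  rw [← closure_Ioo (G.len_pos e).ne] at hx
  exact image_closure_subset_closure_image (G.continuous_pt e) ⟨x, hx, rfl⟩

section Bisection

variable {S : G.Subdivision} {T : Set S.E}

theorem bisect_glue_mem (a b : (S.bisect T).graph.E × Bool) (h : (S.bisect T).graph.glue a b)
    (ha : a.1 ∈ T) : b.1 ∈ T := h.2.1 ha

theorem bisect_glue_notMem (a b : (S.bisect T).graph.E × Bool) (h : (S.bisect T).graph.glue a b)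
    (ha : a.1 ∈ Tᶜ) : b.1 ∈ Tᶜ := fun hb => ha (h.2.2 hb)

theorem bisect_mk_eq {e f : S.E}
    (h : Relation.ReflTransGen (fun e f => S.Adj e f ∧ (e ∈ T ↔ f ∈ T)) e f) :
    ConnectedComponents.mk ((S.bisect T).graph.pt e 0) =
      ConnectedComponents.mk ((S.bisect T).graph.pt f 0) := by
  induction h with
  | refl => rfl
  | tail _ h ih =>
    obtain ⟨⟨b, c, hbc⟩, hT⟩ := h
    refine ih.trans ?_
    have h1 : (S.bisect T).graph.vertex (_, b) = (S.bisect T).graph.vertex (_, c) :=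
      vertex_eq_of_glue ⟨hbc, hT⟩
    exact (mk_vertex (G := (S.bisect T).graph) (_, b)).symm.trans
      ((congrArg _ h1).trans (mk_vertex (G := (S.bisect T).graph) (_, c)))

theorem bisect_isCutVertex {p : (S.bisect T).graph.Point} (h : (S.bisect T).IsCutVertex p) :
    ∃ a b : S.E × Bool, a.1 ∈ T ∧ b.1 ∉ T ∧ S.endpointImage a = S.endpointImage b ∧
      (S.bisect T).proj p = S.endpointImage a := by
  obtain ⟨q, hqp, hq⟩ := h
  rcases pt_or_vertex p with ⟨e, x, hx, rfl⟩ | ⟨a, rfl⟩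
  · exact absurd ((S.bisect T).eq_of_proj_eq hx hq) hqp
  rcases pt_or_vertex q with ⟨e, x, hx, rfl⟩ | ⟨b, rfl⟩
  · exact absurd ((S.bisect T).eq_of_proj_eq hx hq.symm) (Ne.symm hqp)
  rw [Cut.proj_vertex, Cut.proj_vertex] at hq
  rw [Cut.proj_vertex]
  have hne : ¬ (b.1 ∈ T ↔ a.1 ∈ T) := fun h => hqp (vertex_eq_of_glue ⟨hq, h⟩)
  by_cases ha : a.1 ∈ T
  · exact ⟨a, b, ha, fun hb => hne ⟨fun _ => ha, fun _ => hb⟩, hq.symm, rfl⟩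
  · exact ⟨b, a, by tauto, ha, hq, hq.symm⟩

theorem pt_mem_bisect {e : S.E} (he : e ∈ T) (x : ℝ) :
    (S.bisect T).graph.pt e x ∈ (S.bisect T).graph.edgesSet T :=
  pt_mem_edgesSet (G := (S.bisect T).graph) he x

theorem pt_mem_bisect_compl {e : S.E} (he : e ∉ T) (x : ℝ) :
    (S.bisect T).graph.pt e x ∈ (S.bisect T).graph.edgesSet Tᶜ :=
  pt_mem_edgesSet (G := (S.bisect T).graph) (T := Tᶜ) he x

theorem isClopen_bisect : IsClopen ((S.bisect T).graph.edgesSet T) :=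
  (isClopen_edgesSet bisect_glue_mem).1

theorem isClopen_bisect_compl : IsClopen ((S.bisect T).graph.edgesSet Tᶜ) :=
  (isClopen_edgesSet bisect_glue_notMem).1

theorem bisect_compl : ((S.bisect T).graph.edgesSet T)ᶜ = (S.bisect T).graph.edgesSet Tᶜ := by
  ext p
  obtain ⟨e, x, hx, rfl⟩ := exists_pt p
  constructor
  · intro h
    by_cases he : e ∈ T
    · exact absurd (pt_mem_bisect he x) h
    · exact pt_mem_bisect_compl he x
  · intro h h2
    exact (isClopen_edgesSet bisect_glue_notMem).2 e x h
      ((isClopen_edgesSet bisect_glue_mem).2 e x h2)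

theorem bisect_mk_ne {e₀ e₁ : S.E} (he₀ : e₀ ∈ T) (he₁ : e₁ ∉ T) :
    ConnectedComponents.mk ((S.bisect T).graph.pt e₀ 0) ≠
      ConnectedComponents.mk ((S.bisect T).graph.pt e₁ 0) := by
  intro h
  rw [ConnectedComponents.coe_eq_coe'] at h
  have h1 := isClopen_bisect_compl.connectedComponent_subset (pt_mem_bisect_compl he₁ 0) h
  rw [← bisect_compl] at h1
  exact h1 (pt_mem_bisect he₀ 0)

/-- The partition given by the edges in `T` and the remaining edges. -/
noncomputable def _root_.GraphPartition.bisection {e₀ e₁ : S.E} (he₀ : e₀ ∈ T) (he₁ : e₁ ∉ T) :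
    GraphPartition G 2 where
  cut := S.bisect T
  cluster := ![ConnectedComponents.mk ((S.bisect T).graph.pt e₀ 0),
    ConnectedComponents.mk ((S.bisect T).graph.pt e₁ 0)]
  cluster_injective := by
    intro i j hij
    fin_cases i <;> fin_cases j
    · rfl
    · exact absurd hij (bisect_mk_ne he₀ he₁)
    · exact absurd hij.symm (bisect_mk_ne he₀ he₁)
    · rfl

theorem bisection_clusterSet_zero {e₀ e₁ : S.E} (he₀ : e₀ ∈ T) (he₁ : e₁ ∉ T)
    (h0 : ∀ f ∈ T, Relation.ReflTransGen (fun e f => S.Adj e f ∧ (e ∈ T ↔ f ∈ T)) e₀ f) :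
    (GraphPartition.bisection he₀ he₁).clusterSet 0 = (S.bisect T).graph.edgesSet T := by
  change (S.bisect T).graph.componentSet (ConnectedComponents.mk ((S.bisect T).graph.pt e₀ 0)) = _
  refine Subset.antisymm ?_ ?_
  · rw [componentSet_mk]
    exact isClopen_bisect.connectedComponent_subset (pt_mem_bisect he₀ 0)
  · intro p hp
    obtain ⟨e, he, x, -, rfl⟩ := mem_edgesSet.1 hp
    exact (mk_pt e x).trans (bisect_mk_eq (h0 e he)).symm

theorem bisection_clusterSet_one {e₀ e₁ : S.E} (he₀ : e₀ ∈ T) (he₁ : e₁ ∉ T)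
    (h1 : ∀ f ∉ T, Relation.ReflTransGen (fun e f => S.Adj e f ∧ (e ∈ T ↔ f ∈ T)) e₁ f) :
    (GraphPartition.bisection he₀ he₁).clusterSet 1 = (S.bisect T).graph.edgesSet Tᶜ := by
  change (S.bisect T).graph.componentSet (ConnectedComponents.mk ((S.bisect T).graph.pt e₁ 0)) = _
  refine Subset.antisymm ?_ ?_
  · rw [componentSet_mk]
    exact isClopen_bisect_compl.connectedComponent_subset (pt_mem_bisect_compl he₁ 0)
  · intro p hp
    obtain ⟨e, he, x, -, rfl⟩ := mem_edgesSet.1 hp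
    exact (mk_pt e x).trans (bisect_mk_eq (h1 e he)).symm

/-- Every point of the cluster on one side is a limit of points not belonging to the other side. -/
theorem mem_closure_compl_of_disjoint (C : G.Cut) {U : Set C.graph.E} {V : Set C.graph.Point}
    (hUV : Disjoint V (C.graph.edgesSet U)) {x : G.Point} (hx : x ∈ C.proj '' C.graph.edgesSet U) :
    x ∈ closure (C.proj '' V)ᶜ := by
  obtain ⟨p, hp, rfl⟩ := hx
  obtain ⟨e, he, x, hx, rfl⟩ := mem_edgesSet.1 hp
  have h2 : C.proj (C.graph.pt e x) ∈ closure (C.proj '' (C.graph.pt e '' Ioo 0 (C.graph.len e))) :=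
    image_closure_subset_closure_image C.continuous_proj ⟨_, pt_mem_closure hx, rfl⟩
  refine closure_mono ?_ h2
  rintro _ ⟨_, ⟨y, hy, rfl⟩, rfl⟩ ⟨q, hq, hq2⟩
  rw [C.eq_of_proj_eq hy hq2] at hq
  exact disjoint_left.1 hUV hq (pt_mem_edgesSet he y)

/-- If both the edges in `T` and the remaining edges are connected, they form an exhaustive rigid
partition. -/
theorem bisection_spec {e₀ e₁ : S.E} (he₀ : e₀ ∈ T) (he₁ : e₁ ∉ T)
    (h0 : ∀ f ∈ T, Relation.ReflTransGen (fun e f => S.Adj e f ∧ (e ∈ T ↔ f ∈ T)) e₀ f)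
    (h1 : ∀ f ∉ T, Relation.ReflTransGen (fun e f => S.Adj e f ∧ (e ∈ T ↔ f ∈ T)) e₁ f) :
    (GraphPartition.bisection he₀ he₁).IsExhaustive ∧
      (GraphPartition.bisection he₀ he₁).IsRigid := by
  have hc0 := bisection_clusterSet_zero he₀ he₁ h0
  have hc1 := bisection_clusterSet_one he₀ he₁ h1
  set P := GraphPartition.bisection he₀ he₁ with hP
  set C := S.bisect T with hC
  have hdisj : Disjoint (C.graph.edgesSet T) (C.graph.edgesSet Tᶜ) := by
    rw [← bisect_compl]; exact disjoint_compl_right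
  have hcompl : ∀ p, p ∈ C.graph.edgesSet T ∨ p ∈ C.graph.edgesSet Tᶜ := fun p => by
    rw [← bisect_compl]; exact em _
  have hex : P.IsExhaustive := by
    intro c
    obtain ⟨p, rfl⟩ := ConnectedComponents.surjective_coe c
    rcases hcompl p with hp | hp
    · rw [← hc0] at hp
      exact ⟨0, Eq.symm hp⟩
    · rw [← hc1] at hp
      exact ⟨1, Eq.symm hp⟩
  have hΩ0 : P.clusterSupport 0 = C.proj '' C.graph.edgesSet T := congrArg _ hc0
  have hΩ1 : P.clusterSupport 1 = C.proj '' C.graph.edgesSet Tᶜ := congrArg _ hc1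
  have hcl0 : IsClosed (P.clusterSupport 0) := by
    rw [hΩ0]; exact C.isClosedMap_proj _ isClopen_bisect.isClosed
  have hcl1 : IsClosed (P.clusterSupport 1) := by
    rw [hΩ1]; exact C.isClosedMap_proj _ isClopen_bisect_compl.isClosed
  have hcov : ∀ x, x ∈ P.clusterSupport 0 ∨ x ∈ P.clusterSupport 1 := by
    intro x
    obtain ⟨p, rfl⟩ := C.surjective_proj x
    rw [hΩ0, hΩ1]
    exact (hcompl p).imp (mem_image_of_mem _) (mem_image_of_mem _)
  have hcut : P.cutSet = P.clusterSupport 0 ∩ P.clusterSupport 1 := by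
    ext x
    constructor
    · rintro ⟨-, p, hp, rfl⟩
      obtain ⟨a, b, ha, hb, hab, hpa⟩ := bisect_isCutVertex hp
      rw [hΩ0, hΩ1]
      refine ⟨⟨C.graph.vertex a, pt_mem_bisect ha _, ?_⟩,
        ⟨C.graph.vertex b, pt_mem_bisect_compl hb _, ?_⟩⟩
      · exact (C.proj_vertex a).trans hpa.symm
      · exact (C.proj_vertex b).trans (hab.symm.trans hpa.symm)
    · rintro ⟨hx0, hx1⟩
      refine ⟨mem_iUnion.2 ⟨0, hx0⟩, ?_⟩
      rw [hΩ0] at hx0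
      rw [hΩ1] at hx1
      obtain ⟨p, hp, rfl⟩ := hx0
      obtain ⟨q, hq, hqp⟩ := hx1
      exact ⟨p, ⟨q, fun h => disjoint_left.1 hdisj hp (h ▸ hq), hqp⟩, rfl⟩
  refine ⟨hex, ?_⟩
  change P.cutSet = ⋃ i, frontier (P.clusterSupport i)
  rw [hcut]
  refine Subset.antisymm ?_ ?_
  · rintro x ⟨hx0, hx1⟩
    refine mem_iUnion.2 ⟨0, ?_⟩
    rw [frontier_eq_closure_inter_closure]
    refine ⟨subset_closure hx0, ?_⟩
    rw [hΩ1] at hx1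
    rw [hΩ0]
    exact mem_closure_compl_of_disjoint C hdisj hx1
  · refine iUnion_subset fun i x hx => ?_
    rw [frontier_eq_closure_inter_closure] at hx
    match i with
    | 0 => exact ⟨hcl0.closure_eq ▸ hx.1, closure_minimal
        (fun y hy => (hcov y).resolve_left hy) hcl1 hx.2⟩
    | 1 => exact ⟨closure_minimal
        (fun y hy => (hcov y).resolve_right hy) hcl0 hx.2, hcl1.closure_eq ▸ hx.1⟩

end Bisection

end MetricGraph

/-! ### The upper bound for the minimal energy -/

namespace MetricGraph

variable {G : MetricGraph}

/-- In a connected graph, a nonempty set of edges of a subdivision that is closed under adjacency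
consists of all edges. -/
theorem Subdivision.eq_univ_of_adj [ConnectedSpace G.Point] (S : G.Subdivision) {T : Set S.E}
    (hne : T.Nonempty) (h : ∀ e f, S.Adj e f → e ∈ T → f ∈ T) : T = univ := by
  by_contra hT
  obtain ⟨f, hf⟩ := (ne_univ_iff_exists_notMem T).1 hT
  obtain ⟨e, he⟩ := hne
  set C := S.bisect T with hC
  have hcl0 : IsClosed (C.proj '' C.graph.edgesSet T) :=
    C.isClosedMap_proj _ isClopen_bisect.isClosed
  have hcl1 : IsClosed (C.proj '' C.graph.edgesSet Tᶜ) :=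
    C.isClosedMap_proj _ isClopen_bisect_compl.isClosed
  obtain ⟨x, -, ⟨p, hp, rfl⟩, q, hq, hqp⟩ := isPreconnected_closed_iff.1 isPreconnected_univ _ _
    hcl0 hcl1 (fun x _ => by
      obtain ⟨p, rfl⟩ := C.surjective_proj x
      by_cases hp : p ∈ C.graph.edgesSet T
      · exact Or.inl ⟨p, hp, rfl⟩
      · exact Or.inr ⟨p, bisect_compl (T := T) ▸ hp, rfl⟩)
    ⟨_, trivial, _, pt_mem_bisect he 0, rfl⟩ ⟨_, trivial, _, pt_mem_bisect_compl hf 0, rfl⟩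
  have hne : q ≠ p := by
    rintro rfl
    rw [← bisect_compl] at hq
    exact hq hp
  obtain ⟨a, b, ha, hb, hab, -⟩ := bisect_isCutVertex ⟨q, hne, hqp⟩
  exact hb (h a.1 b.1 ⟨a.2, b.2, hab⟩ ha)

/-- A function that takes both signs, and vanishes nowhere or everywhere on the interior of each
edge of a subdivision, is subordinate to a bisection of a connected graph.

Let `N` be the positive nodal domain of `e₁`, and let `T` be the component of a negative edge `e₀`
in the complement of `N`. The edges outside `T` are connected as well, since every other component
of the complement of `N` is adjacent to `N`. -/
theorem Subdivision.exists_bisection [ConnectedSpace G.Point] (S : G.Subdivision)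
    {ψ : G.Point → ℝ} (hψ : Continuous ψ)
    (hS : ∀ e, (∀ x ∈ Icc 0 (S.len e), ψ (G.pt (S.parent e) (S.offset e + x)) = 0) ∨
      ∀ x ∈ Ioo 0 (S.len e), ψ (G.pt (S.parent e) (S.offset e + x)) ≠ 0)
    {e₀ e₁ : S.E} {x₀ x₁ : ℝ} (hx₀ : x₀ ∈ Ioo 0 (S.len e₀)) (hx₁ : x₁ ∈ Ioo 0 (S.len e₁))
    (hψ₀ : ψ (G.pt (S.parent e₀) (S.offset e₀ + x₀)) < 0)
    (hψ₁ : 0 < ψ (G.pt (S.parent e₁) (S.offset e₁ + x₁))) :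
    ∃ T : Set S.E, e₀ ∈ T ∧ e₁ ∉ T ∧
      (∀ f ∈ T, Relation.ReflTransGen (fun e f => S.Adj e f ∧ (e ∈ T ↔ f ∈ T)) e₀ f) ∧
      (∀ f ∉ T, Relation.ReflTransGen (fun e f => S.Adj e f ∧ (e ∈ T ↔ f ∈ T)) e₁ f) ∧
      ∀ a b : S.E × Bool, a.1 ∈ T → b.1 ∉ T → S.endpointImage a = S.endpointImage b →
        ψ (S.endpointImage a) = 0 := by
  let N : Set S.E := {f | Relation.ReflTransGen (fun e f => ∃ b c,
    S.endpointImage (e, b) = S.endpointImage (f, c) ∧ ψ (S.endpointImage (e, b)) ≠ 0) e₁ f}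
  let g : S.E → ℝ → ℝ := fun e x => ψ (G.pt (S.parent e) (S.offset e + x))
  have hgc : ∀ e, Continuous (g e) := fun e => hψ.comp ((G.continuous_pt _).comp (by fun_prop))
  have hend : ∀ (e : S.E) (b : Bool), ∃ y ∈ Icc 0 (S.len e),
      ψ (S.endpointImage (e, b)) = g e y := by
    intro e b
    exact ⟨if b then S.len e else 0, by
      have := (S.len_pos e).le
      split_ifs <;> constructor <;> linarith, rfl⟩
  -- the sign is constant on the interior of each edge
  have hsign : ∀ e, (∃ y ∈ Icc 0 (S.len e), 0 < g e y) → ∀ x ∈ Ioo 0 (S.len e), 0 < g e x := by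
    rintro e ⟨y, hy, hy0⟩ x hx
    rcases hS e with h | h
    · exact absurd (h y hy) hy0.ne'
    · obtain ⟨z, hz0, hz⟩ : ∃ z, 0 < g e z ∧ z ∈ Ioo 0 (S.len e) := by
        rw [← closure_Ioo (S.len_pos e).ne] at hy
        exact mem_closure_iff_nhds.1 hy _ ((hgc e).continuousAt.eventually_const_lt hy0)
      by_contra! hxn
      obtain ⟨w, hw, hw0⟩ := isPreconnected_Ioo.intermediate_value hx hz (hgc e).continuousOn
        ⟨hxn, hz0.le⟩
      exact h w hw hw0
  have hNpos : ∀ f ∈ N, ∀ x ∈ Ioo 0 (S.len f), 0 < g f x := by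
    intro f hf
    induction hf with
    | refl => exact hsign _ ⟨x₁, Ioo_subset_Icc_self hx₁, hψ₁⟩
    | @tail e f _ h ih =>
      obtain ⟨b, c, hbc, hne⟩ := h
      obtain ⟨y, hy, hy2⟩ := hend e b
      obtain ⟨z, hz, hz2⟩ := hend f c
      refine hsign _ ⟨z, hz, ?_⟩
      rw [← hz2, ← hbc]
      refine lt_of_le_of_ne ?_ hne.symm
      rw [hy2]
      rw [← closure_Ioo (S.len_pos e).ne] at hy
      exact closure_minimal (fun x hx => (ih x hx).le)
        (isClosed_Ici.preimage (hgc e)) hy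
  have he₀N : e₀ ∉ N := fun h => lt_asymm hψ₀ (hNpos e₀ h x₀ hx₀)
  have he₁N : e₁ ∈ N := Relation.ReflTransGen.refl
  let R : S.E → S.E → Prop := fun e f => S.Adj e f ∧ e ∉ N ∧ f ∉ N
  let T : Set S.E := {f | Relation.ReflTransGen R e₀ f}
  have hTN : ∀ f ∈ T, f ∉ N := by
    intro f hf
    cases hf with
    | refl => exact he₀N
    | tail _ h => exact h.2.2
  have hTadj : ∀ e f, e ∈ T → S.Adj e f → f ∉ N → f ∈ T := fun e f he hef hf =>
    Relation.ReflTransGen.tail he ⟨hef, hTN e he, hf⟩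
  have hsymm : ∀ {e f}, S.Adj e f → S.Adj f e := fun ⟨b, c, h⟩ => ⟨c, b, h.symm⟩
  have hN1 : ∀ f ∈ N, Relation.ReflTransGen (fun e f => S.Adj e f ∧ (e ∈ T ↔ f ∈ T)) e₁ f := by
    intro f hf
    induction hf with
    | refl => exact Relation.ReflTransGen.refl
    | @tail e f he h ih =>
      have heN : e ∈ N := he
      have hfN : f ∈ N := Relation.ReflTransGen.tail he h
      obtain ⟨b, c, hbc, -⟩ := h
      exact ih.tail ⟨⟨b, c, hbc⟩, fun h => absurd heN (hTN e h), fun h => absurd hfN (hTN f h)⟩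
  refine ⟨T, Relation.ReflTransGen.refl, fun h => hTN _ h he₁N, ?_, ?_, ?_⟩
  · intro f hf
    induction hf with
    | refl => exact Relation.ReflTransGen.refl
    | @tail e f he h ih =>
      have heT : e ∈ T := he
      have hfT : f ∈ T := Relation.ReflTransGen.tail he h
      exact ih.tail ⟨h.1, fun _ => hfT, fun _ => heT⟩
  · intro f hfT
    by_cases hfN : f ∈ N
    · exact hN1 f hfN
    -- the component of `f` in the complement of `N` is adjacent to `N`
    let K : Set S.E := {g | Relation.ReflTransGen R f g}
    have hKN : ∀ g ∈ K, g ∉ N := by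
      intro g hg
      cases hg with
      | refl => exact hfN
      | tail _ h => exact h.2.2
    have hKT : ∀ g ∈ K, g ∉ T := by
      intro g hg
      induction hg with
      | refl => exact hfT
      | @tail e g _ h ih => exact fun hg => ih (hTadj g e hg (hsymm h.1) h.2.1)
    obtain ⟨e, g, he, hg, heg⟩ : ∃ e g, e ∈ K ∧ g ∈ N ∧ S.Adj e g := by
      by_contra! hcon
      have := S.eq_univ_of_adj (T := K) ⟨f, Relation.ReflTransGen.refl⟩ fun e g heg he =>
        Relation.ReflTransGen.tail he ⟨heg, hKN e he, fun hg => hcon e g he hg heg⟩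
      exact hKN e₁ (this ▸ mem_univ e₁) he₁N
    have hback : Relation.ReflTransGen (fun e f => S.Adj e f ∧ (e ∈ T ↔ f ∈ T)) e f := by
      have h1 : Relation.ReflTransGen (fun a b => R b a) e f := Relation.reflTransGen_swap.2 he
      have h2 : ∀ g, Relation.ReflTransGen (fun a b => R b a) e g → g ∈ K →
          Relation.ReflTransGen (fun e f => S.Adj e f ∧ (e ∈ T ↔ f ∈ T)) e g := by
        intro g hg
        induction hg with
        | refl => exact fun _ => Relation.ReflTransGen.refl
        | @tail a b hab h ih =>
          intro hb
          have ha : a ∈ K := Relation.ReflTransGen.tail hb h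
          exact (ih ha).tail ⟨hsymm h.1, fun h => absurd h (hKT a ha), fun h => absurd h (hKT b hb)⟩
      exact h2 f h1 Relation.ReflTransGen.refl
    have hgT : g ∉ T := fun h => hTN g h hg
    exact ((hN1 g hg).tail ⟨hsymm heg, fun h => absurd h hgT, fun h => absurd h (hKT e he)⟩).trans
      hback
  · rintro ⟨e, b⟩ ⟨f, c⟩ heT hfT hab
    have hfN : f ∈ N := by
      by_contra hfN
      exact hfT (hTadj e f heT ⟨b, c, hab⟩ hfN)
    by_contra hne
    exact hTN e heT (Relation.ReflTransGen.tail hfN ⟨c, b, hab.symm, hab ▸ hne⟩)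

/-- Every value that a function takes near a point of the graph, it takes in the interior of an edge
of a subdivision. -/
theorem Subdivision.exists_mem_Ioo (S : G.Subdivision) {ψ : G.Point → ℝ} (hψ : Continuous ψ)
    {U : Set ℝ} (hU : IsOpen U) {p : G.Point} (hp : ψ p ∈ U) :
    ∃ e, ∃ x ∈ Ioo 0 (S.len e), ψ (G.pt (S.parent e) (S.offset e + x)) ∈ U := by
  obtain ⟨e, x, hx, rfl⟩ := exists_pt p
  obtain ⟨e₁, rfl, hx1⟩ := S.cover e x hx
  have hgc : Continuous fun x => ψ (G.pt (S.parent e₁) (S.offset e₁ + x)) :=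
    hψ.comp ((G.continuous_pt _).comp (by fun_prop))
  have hy : x - S.offset e₁ ∈ closure (Ioo 0 (S.len e₁)) := by
    rw [closure_Ioo (S.len_pos e₁).ne]
    exact ⟨by linarith [hx1.1], by linarith [hx1.2]⟩
  obtain ⟨z, hz, hz2⟩ := mem_closure_iff.1 hy _ (hU.preimage hgc) (by
    simp only [mem_preimage, add_sub_cancel]
    exact hp)
  exact ⟨e₁, z, hz2, hz⟩

theorem IsEigenfunction.exists_neg_pos {t : ℝ} {ψ : G.Point → ℝ} (h : G.IsEigenfunction ∅ t ψ)
    (hmean : G.innerL2 G.one ψ = 0) : (∃ p, ψ p < 0) ∧ ∃ p, 0 < ψ p := by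
  have key : ∀ φ : G.Point → ℝ, Continuous φ → φ ≠ 0 → G.innerL2 G.one φ = 0 → ∃ p, φ p < 0 := by
    intro φ hφ hφ0 hm
    by_contra! hnn
    obtain ⟨p, hp⟩ := Function.ne_iff.1 hφ0
    have := innerL2_pos memH1_one.1 hφ (fun p => by simpa [one] using hnn p)
      ⟨p, by simpa [one] using lt_of_le_of_ne (hnn p) (Ne.symm hp)⟩
    exact this.ne' hm
  refine ⟨key ψ h.1.1.1 h.2.1 hmean, ?_⟩
  obtain ⟨p, hp⟩ := key (-ψ) h.neg.1.1.1 h.neg.2.1 (by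
    rw [← neg_one_smul ℝ, innerL2_smul_right, hmean, mul_zero])
  exact ⟨p, by simpa using hp⟩

end MetricGraph

namespace GraphPartition

open MetricGraph

variable {G : MetricGraph} {k : ℕ} {P : GraphPartition G k}

/-- The energy of a cluster is at most the eigenvalue of an eigenfunction of the whole graph that
vanishes at the cut points. -/
theorem lambda1_le_of_isEigenfunction (hP : P.IsExhaustive) {t : ℝ} {ψ : G.Point → ℝ}
    (hψ : G.IsEigenfunction ∅ t ψ)
    (hD : ∀ j, ∀ p ∈ P.dirichletVertices j, ψ (P.clusterProj j p) = 0) {i : Fin k}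
    (hne : ∃ p, ψ (P.clusterProj i p) ≠ 0) : P.lambda1 i ≤ t := by
  classical
  have hH := (memH1_iff hP).1 hψ.1.1
  let v : ∀ j, (P.clusterGraph j).Point → ℝ := fun j p => if j = i then ψ (P.clusterProj j p) else 0
  obtain ⟨w, hw⟩ := exists_glue hP (v := v) (fun j p hp => by
    simp only [v]
    split_ifs
    · exact hD j p hp
    · rfl)
  have hwi : (fun p => w (P.clusterProj i p)) = fun p => ψ (P.clusterProj i p) := by
    funext p
    rw [hw]
    simp [v]
  have hwj : ∀ j, j ≠ i → (fun p => w (P.clusterProj j p)) = fun _ => 0 := by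
    intro j hj
    funext p
    rw [hw]
    simp [v, hj]
  have hwH : G.MemH1 w := (memH1_iff hP).2 fun j => by
    by_cases hj : j = i
    · subst hj; rw [hwi]; exact hH j
    · rw [hwj j hj]; exact MemH1.const 0
  have h1 := hψ.2.2 w (memH10_empty.2 hwH)
  rw [form_eq_sum hP hψ.1.1 hwH, innerL2_eq_sum hP hψ.1.1.1 hwH.1, Finset.sum_eq_single i,
    Finset.sum_eq_single i, hwi] at h1
  · have h2 := lambda1_mul_le i (v := fun p => ψ (P.clusterProj i p)) ⟨hH i, hD i⟩
    rw [h1] at h2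
    refine le_of_mul_le_mul_right h2 (innerL2_self_pos (hH i).1 fun h => ?_)
    obtain ⟨p, hp⟩ := hne
    exact hp (congrFun h p)
  · intro j _ hj
    rw [hwj j hj]
    simp [innerL2, onEdge]
  · simp
  · intro j _ hj
    rw [hwj j hj, form_comm]
    exact form_const_left 0 _
  · simp

/-- There is an exhaustive rigid partition with energy at most the second eigenvalue, subordinate to
an eigenfunction `ψ`: as `ψ` vanishes at the cut points, its restrictions to the clusters are test
functions for their first eigenvalues. -/
theorem exists_dirichletEnergy_le [ConnectedSpace G.Point] :
    ∃ P : GraphPartition G 2, P.IsExhaustive ∧ P.IsRigid ∧ P.dirichletEnergy ≤ G.mu 2 := by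
  obtain ⟨hμ, -, -, ψ, hψ, hmean⟩ := second_eigenvalue (G := G)
  have hψc : Continuous ψ := hψ.1.1.1
  obtain ⟨S, hS⟩ := exists_nodal_subdivision (hψ.zeros (by simp) hμ)
  obtain ⟨⟨p₀, hp₀⟩, p₁, hp₁⟩ := hψ.exists_neg_pos hmean
  obtain ⟨e₀, x₀, hx₀, hψ₀⟩ := S.exists_mem_Ioo hψc isOpen_Iio hp₀
  obtain ⟨e₁, x₁, hx₁, hψ₁⟩ := S.exists_mem_Ioo hψc isOpen_Ioi hp₁
  obtain ⟨T, he₀, he₁, h0, h1, hz⟩ := S.exists_bisection hψc hS hx₀ hx₁ hψ₀ hψ₁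
  obtain ⟨hex, hrig⟩ := bisection_spec he₀ he₁ h0 h1
  refine ⟨bisection he₀ he₁, hex, hrig, ciSup_le fun i => ?_⟩
  refine lambda1_le_of_isEigenfunction hex hψ ?_ ?_
  · intro j p hp
    obtain ⟨a, b, ha, hb, hab, hpa⟩ := bisect_isCutVertex hp
    have h2 : (bisection he₀ he₁).clusterProj j p = S.endpointImage a := hpa
    rw [h2]
    exact hz a b ha hb hab
  · have hmem : ∀ (e : S.E) (x : ℝ), x ∈ Icc 0 (S.len e) →
        (S.bisect T).graph.pt e x ∈ (bisection he₀ he₁).clusterSet i →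
        G.pt (S.parent e) (S.offset e + x) ∈ range ((bisection he₀ he₁).clusterProj i) := by
      intro e x hx h
      rw [← clusterSupport_eq_range]
      exact ⟨_, h, (S.bisect T).proj_pt hx⟩
    match i with
    | 0 =>
      obtain ⟨p, hp⟩ := hmem e₀ x₀ (Ioo_subset_Icc_self hx₀) (mk_pt (G := (S.bisect T).graph) e₀ x₀)
      exact ⟨p, by rw [hp]; exact hψ₀.ne⟩
    | 1 =>
      obtain ⟨p, hp⟩ := hmem e₁ x₁ (Ioo_subset_Icc_self hx₁) (mk_pt (G := (S.bisect T).graph) e₁ x₁)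
      exact ⟨p, by rw [hp]; exact hψ₁.ne'⟩

/-- The second eigenvalue is the minimal energy of exhaustive rigid `2`-partitions. -/
theorem mu_two_eq_dirichletOptEnergy (G : MetricGraph) [ConnectedSpace G.Point] :
    G.mu 2 = G.dirichletOptEnergy 2 := by
  obtain ⟨P, hex, hrig, hle⟩ := exists_dirichletEnergy_le (G := G)
  symm
  refine IsLeast.csInf_eq ⟨⟨P, hex, hrig, le_antisymm hle (mu_two_le_and_eq hex).1⟩, ?_⟩
  rintro _ ⟨Q, hQ, -, rfl⟩
  exact (mu_two_le_and_eq hQ).1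

end GraphPartition

/-! ### Cutting along the zero set of a function -/

/-- A closed map that is injective over a set respects the components of that set. -/
theorem image_connectedComponentIn_preimage {X Y : Type*} [TopologicalSpace X] [TopologicalSpace Y]
    {f : X → Y} (hf : Continuous f) (hcl : IsClosedMap f) (hs : Function.Surjective f) {U : Set Y}
    (hinj : InjOn f (f ⁻¹' U)) {p : X} (hp : f p ∈ U) :
    f '' connectedComponentIn (f ⁻¹' U) p = connectedComponentIn U (f p) := by
  refine Subset.antisymm ?_ ?_
  · exact (isPreconnected_connectedComponentIn.image f hf.continuousOn).subset_connectedComponentIn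
      ⟨p, mem_connectedComponentIn hp, rfl⟩
      ((image_mono (connectedComponentIn_subset _ _)).trans (image_preimage_subset _ _))
  · set B := connectedComponentIn U (f p)
    have hBU : B ⊆ U := connectedComponentIn_subset _ _
    have hB : IsPreconnected ((Subtype.val : U → Y) ⁻¹' B) := by
      rw [← IsInducing.subtypeVal.isPreconnected_image, Subtype.image_preimage_coe,
        inter_eq_self_of_subset_right hBU]
      exact isPreconnected_connectedComponentIn
    have h1 := hB.preimage_of_isClosedMap (f := U.restrictPreimage f)
      (fun x y h => Subtype.ext (hinj x.2 y.2 (congrArg Subtype.val h)))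
      (hcl.restrictPreimage U) (by
        rintro ⟨y, hy⟩ -
        obtain ⟨x, rfl⟩ := hs y
        exact ⟨⟨x, hy⟩, rfl⟩)
    rw [← IsInducing.subtypeVal.isPreconnected_image] at h1
    have h2 := h1.subset_connectedComponentIn (x := p) (F := f ⁻¹' U)
      ⟨⟨p, hp⟩, mem_connectedComponentIn hp, rfl⟩ (by rintro _ ⟨x, -, rfl⟩; exact x.2)
    intro y hy
    obtain ⟨x, rfl⟩ := hs y
    exact ⟨x, h2 ⟨⟨x, hBU hy⟩, hy, rfl⟩, rfl⟩

namespace MetricGraph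

variable {G : MetricGraph}

/-- The cut of a subdivided graph through all vertices at which `ψ` vanishes, which separates all
edges at such a vertex from each other. -/
def Subdivision.nodalCut (S : G.Subdivision) (ψ : G.Point → ℝ) : G.Cut where
  toSubdivision := S
  glue :=
    { r := fun a b => a = b ∨ (S.endpointImage a = S.endpointImage b ∧ ψ (S.endpointImage a) ≠ 0)
      iseqv := by
        refine ⟨fun a => Or.inl rfl, ?_, ?_⟩
        · rintro a b (h | ⟨h, h2⟩)
          · exact Or.inl h.symm
          · exact Or.inr ⟨h.symm, h ▸ h2⟩
        · rintro a b c (rfl | ⟨h, h2⟩) (rfl | ⟨h3, h4⟩)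
          · exact Or.inl rfl
          · exact Or.inr ⟨h3, h4⟩
          · exact Or.inr ⟨h, h2⟩
          · exact Or.inr ⟨h.trans h3, h2⟩ }
  glue_le := by
    rintro a b (rfl | ⟨h, -⟩)
    · exact rfl
    · exact h

/-- The cut along the zero set of `ψ` separates points only over zeros of `ψ`. -/
theorem Subdivision.nodalCut_eq_zero (S : G.Subdivision) (ψ : G.Point → ℝ)
    {p q : (S.nodalCut ψ).graph.Point} (hpq : p ≠ q)
    (h : (S.nodalCut ψ).proj p = (S.nodalCut ψ).proj q) : ψ ((S.nodalCut ψ).proj p) = 0 := by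
  rcases pt_or_vertex p with ⟨e, x, hx, rfl⟩ | ⟨a, rfl⟩
  · exact absurd ((S.nodalCut ψ).eq_of_proj_eq hx h.symm).symm hpq
  rcases pt_or_vertex q with ⟨e, x, hx, rfl⟩ | ⟨b, rfl⟩
  · exact absurd ((S.nodalCut ψ).eq_of_proj_eq hx h) hpq
  by_contra hne
  have ha : (S.nodalCut ψ).proj ((S.nodalCut ψ).graph.vertex a) = S.endpointImage a :=
    (S.nodalCut ψ).proj_vertex a
  have hb : (S.nodalCut ψ).proj ((S.nodalCut ψ).graph.vertex b) = S.endpointImage b :=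
    (S.nodalCut ψ).proj_vertex b
  refine hpq (vertex_eq_of_glue (G := (S.nodalCut ψ).graph) (Or.inr ⟨?_, ?_⟩))
  · exact ha.symm.trans (h.trans hb)
  · exact ha ▸ hne

/-- If the subdivision is fine enough, the components of the cut along the zero set of `ψ` on which
`ψ` does not vanish identically are closed nodal domains of `ψ`.

The edges that meet the nodal domain of `p` in the cut graph are glued only to each other, hence
they form the component of `p`, and the nodal domain is dense in their union. -/
theorem Subdivision.isClosedNodalDomain_nodalCut (S : G.Subdivision) {ψ : G.Point → ℝ}
    (hS : ∀ e, (∀ x ∈ Icc 0 (S.len e), ψ (G.pt (S.parent e) (S.offset e + x)) = 0) ∨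
      ∀ x ∈ Ioo 0 (S.len e), ψ (G.pt (S.parent e) (S.offset e + x)) ≠ 0)
    {p : (S.nodalCut ψ).graph.Point} (hp : ψ ((S.nodalCut ψ).proj p) ≠ 0) :
    GraphPartition.IsClosedNodalDomain G ψ ((S.nodalCut ψ).proj ''
      (S.nodalCut ψ).graph.componentSet (ConnectedComponents.mk p)) := by
  let C : G.Cut := S.nodalCut ψ
  change GraphPartition.IsClosedNodalDomain G ψ
    (C.proj '' C.graph.componentSet (ConnectedComponents.mk p))
  change ψ (C.proj p) ≠ 0 at hp
  set U : Set G.Point := {y | ψ y ≠ 0}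
  set N := connectedComponentIn (C.proj ⁻¹' U) p
  have hNU : N ⊆ C.proj ⁻¹' U := connectedComponentIn_subset _ _
  have hpt : ∀ e, ∀ x ∈ Icc 0 (C.graph.len e),
      C.proj (C.graph.pt e x) = G.pt (S.parent e) (S.offset e + x) := fun e x hx => C.proj_pt hx
  -- an edge on which `ψ` is not identically zero lies in `N`, up to endpoints, if it meets `N`
  have hedge : ∀ e, ∀ x ∈ Icc 0 (C.graph.len e), C.graph.pt e x ∈ N →
      ∀ y ∈ Icc 0 (C.graph.len e), C.graph.pt e y ∈ C.proj ⁻¹' U → C.graph.pt e y ∈ N := by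
    intro e x hx hxN y hy hyU
    have hne : ∀ z ∈ Ioo 0 (C.graph.len e), C.graph.pt e z ∈ C.proj ⁻¹' U := by
      intro z hz
      rcases hS e with h | h
      · exact absurd ((congrArg ψ (hpt e x hx)).trans (h x hx)) (hNU hxN)
      · exact fun h0 => h z hz ((congrArg ψ (hpt e z (Ioo_subset_Icc_self hz))).symm.trans h0)
    let I : Set ℝ := {z | z ∈ Icc 0 (C.graph.len e) ∧ C.graph.pt e z ∈ C.proj ⁻¹' U}
    have hI : IsPreconnected I :=
      isPreconnected_Ioo.subset_closure (fun z hz => ⟨Ioo_subset_Icc_self hz, hne z hz⟩)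
        (fun z hz => by rw [closure_Ioo (C.graph.len_pos e).ne]; exact hz.1)
    have h1 := (hI.image (C.graph.pt e) (C.graph.continuous_pt e).continuousOn)
      |>.subset_connectedComponentIn (F := C.proj ⁻¹' U) (x := C.graph.pt e x)
        ⟨x, ⟨hx, hNU hxN⟩, rfl⟩ (by rintro _ ⟨z, hz, rfl⟩; exact hz.2)
    rw [← connectedComponentIn_eq hxN] at h1
    exact h1 ⟨y, ⟨hy, hyU⟩, rfl⟩
  let T : Set C.graph.E := {e | ∃ x ∈ Icc 0 (C.graph.len e), C.graph.pt e x ∈ N}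
  have hT : ∀ a b : C.graph.E × Bool, C.graph.glue a b → a.1 ∈ T → b.1 ∈ T := by
    rintro a b hab ⟨x, hx, hxN⟩
    rcases hab with rfl | ⟨hab, hne⟩
    · exact ⟨x, hx, hxN⟩
    · refine ⟨C.graph.pos b, pos_mem b, ?_⟩
      have h1 : C.graph.vertex a = C.graph.vertex b := vertex_eq_of_glue (Or.inr ⟨hab, hne⟩)
      change C.graph.vertex b ∈ N
      rw [← h1]
      refine hedge a.1 x hx hxN _ (pos_mem a) ?_
      have h2 : C.proj (C.graph.vertex a) = S.endpointImage a := C.proj_vertex a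
      exact fun h0 => hne (h2 ▸ h0)
  have hTN : C.graph.edgesSet T ⊆ closure N := by
    intro q hq
    obtain ⟨e, ⟨x, hx, hxN⟩, y, hy, rfl⟩ := mem_edgesSet.1 hq
    refine closure_mono ?_ (pt_mem_closure hy)
    rintro _ ⟨z, hz, rfl⟩
    refine hedge e x hx hxN z (Ioo_subset_Icc_self hz) ?_
    rcases hS e with h | h
    · exact absurd ((congrArg ψ (hpt e x hx)).trans (h x hx)) (hNU hxN)
    · exact fun h0 => h z hz ((congrArg ψ (hpt e z (Ioo_subset_Icc_self hz))).symm.trans h0)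
  have hpN : p ∈ N := mem_connectedComponentIn hp
  have hpT : p ∈ C.graph.edgesSet T := by
    obtain ⟨e, x, hx, rfl⟩ := exists_pt p
    exact pt_mem_edgesSet (show e ∈ T from ⟨x, hx, hpN⟩) x
  have hcomp : C.graph.componentSet (ConnectedComponents.mk p) = closure N := by
    rw [componentSet_mk]
    refine Subset.antisymm
      (((isClopen_edgesSet hT).1.connectedComponent_subset hpT).trans hTN) ?_
    exact closure_minimal (isPreconnected_connectedComponentIn.subset_connectedComponent hpN)
      isClosed_connectedComponent
  refine ⟨C.proj p, hp, ?_⟩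
  rw [hcomp, ← C.isClosedMap_proj.closure_image_eq_of_continuous C.continuous_proj,
    image_connectedComponentIn_preimage C.continuous_proj C.isClosedMap_proj C.surjective_proj
      (fun x hx y _ hxy => by
        by_contra hne
        exact hx (S.nodalCut_eq_zero ψ hne hxy)) hp]

end MetricGraph

/-! ### Cuts of the clusters of a partition -/

namespace GraphPartition

open MetricGraph

variable {G : MetricGraph} {k : ℕ} {P : GraphPartition G k}

theorem clusterProj_endpointImage {i : Fin k} (S : (P.clusterGraph i).Subdivision)
    (a : S.E × Bool) : P.clusterProj i (S.endpointImage a) =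
      G.pt (P.cut.parent (Subtype.val (S.parent a.1)))
        (P.cut.offset (Subtype.val (S.parent a.1)) + S.offset a.1 +
          if a.2 then S.len a.1 else 0) := by
  rw [Subdivision.endpointImage, P.clusterProj_pt, add_assoc]
  refine S.add_mem ?_
  have := (S.len_pos a.1).le
  split_ifs <;> constructor <;> linarith

/-- Cuts of all clusters of an exhaustive partition, as one cut of the graph. -/
def combine (hP : P.IsExhaustive) (C : ∀ i, (P.clusterGraph i).Cut) : G.Cut where
  E := Σ i, (C i).E
  len s := (C s.1).len s.2
  len_pos s := (C s.1).len_pos s.2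
  parent s := P.cut.parent (Subtype.val ((C s.1).parent s.2))
  offset s := P.cut.offset (Subtype.val ((C s.1).parent s.2)) + (C s.1).offset s.2
  offset_nonneg s := add_nonneg (P.cut.offset_nonneg _) ((C s.1).offset_nonneg _)
  offset_add_len_le s := by
    have h1 := P.cut.offset_add_len_le (Subtype.val ((C s.1).parent s.2))
    have h2 : (C s.1).offset s.2 + (C s.1).len s.2 ≤
      P.cut.len (Subtype.val ((C s.1).parent s.2)) := (C s.1).offset_add_len_le s.2
    linarith
  cover e x hx := by
    obtain ⟨f, rfl, hf⟩ := P.cut.cover e x hx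
    obtain ⟨⟨i, f'⟩, rfl⟩ := (bijective_edges hP).2 f
    obtain ⟨e₁, h1, h2⟩ := (C i).cover f' (x - P.cut.offset f'.1)
      ⟨by linarith [hf.1], by
        have := hf.2
        change x - P.cut.offset f'.1 ≤ P.cut.len f'.1
        linarith⟩
    refine ⟨⟨i, e₁⟩, ?_, ?_⟩
    · simp only [h1]
    · simp only [h1]
      exact ⟨by linarith [h2.1], by linarith [h2.2]⟩
  disjoint := by
    rintro ⟨i, e⟩ ⟨j, f⟩ hne hp
    refine disjoint_left.2 fun y hy hy2 => hne ?_
    have hx1 : y - P.cut.offset (Subtype.val ((C i).parent e)) - (C i).offset e ∈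
      Ioo 0 ((C i).len e) := ⟨by linarith [hy.1], by linarith [hy.2]⟩
    have hx2 : y - P.cut.offset (Subtype.val ((C j).parent f)) - (C j).offset f ∈
      Ioo 0 ((C j).len f) := ⟨by linarith [hy2.1], by linarith [hy2.2]⟩
    have h1 := (C i).add_mem_Ioo hx1
    have h2 := (C j).add_mem_Ioo hx2
    rw [add_sub_cancel] at h1 h2
    obtain ⟨h3, h4⟩ := P.cut.eq_of_mem_Ioo hp h1 (Ioo_subset_Icc_self h2)
      (by rw [add_sub_cancel, add_sub_cancel])
    have h5 := (bijective_edges hP).1 (a₁ := ⟨i, (C i).parent e⟩) (a₂ := ⟨j, (C j).parent f⟩) h3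
    obtain ⟨rfl, h6⟩ := Sigma.mk.inj h5
    obtain ⟨rfl, -⟩ := (C i).eq_of_mem_Ioo (eq_of_heq h6) hx1 (Ioo_subset_Icc_self hx2)
      (by rw [add_sub_cancel, add_sub_cancel, h4])
    rfl
  glue := Setoid.ker fun a =>
    (⟨a.1.1, Quotient.mk (C a.1.1).glue (a.1.2, a.2)⟩ : Σ i, Quotient (C i).glue)
  glue_le := by
    rintro ⟨⟨i, e⟩, b⟩ ⟨⟨j, f⟩, c⟩ h
    obtain ⟨rfl, h⟩ := Sigma.mk.inj h
    have h1 := congrArg (P.clusterProj i) ((C i).glue_le (Quotient.exact (eq_of_heq h)))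
    rw [clusterProj_endpointImage, clusterProj_endpointImage] at h1
    exact h1

variable (hP : P.IsExhaustive) (C : ∀ i, (P.clusterGraph i).Cut)

theorem combine_glue_iff {i : Fin k} {a b : (C i).E × Bool} :
    (combine hP C).graph.glue (⟨i, a.1⟩, a.2) (⟨i, b.1⟩, b.2) ↔ (C i).glue a b := by
  constructor
  · intro h
    obtain ⟨-, h⟩ := Sigma.mk.inj h
    exact Quotient.exact (eq_of_heq h)
  · intro h
    exact Sigma.ext rfl (heq_of_eq (Quotient.sound h))

/-- The inclusion of the cut of the `i`-th cluster. -/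
noncomputable def combineIncl (i : Fin k) : (C i).graph.Point → (combine hP C).graph.Point :=
  (C i).graph.edgewise (fun e x => (combine hP C).graph.pt ⟨i, e⟩ x) fun _ _ hab =>
    vertex_eq_of_glue (G := (combine hP C).graph) ((combine_glue_iff hP C).2 hab)

theorem combineIncl_pt {i : Fin k} {e : (C i).graph.E} {x : ℝ}
    (hx : x ∈ Icc 0 ((C i).graph.len e)) :
    combineIncl hP C i ((C i).graph.pt e x) = (combine hP C).graph.pt ⟨i, e⟩ x :=
  edgewise_pt hx

theorem continuous_combineIncl (i : Fin k) : Continuous (combineIncl hP C i) :=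
  continuous_edgewise fun _ => (MetricGraph.continuous_pt _ _).continuousOn

theorem injective_combineIncl (i : Fin k) : Function.Injective (combineIncl hP C i) := by
  intro p q h
  obtain ⟨e, x, hx, rfl⟩ := exists_pt p
  obtain ⟨f, y, hy, rfl⟩ := exists_pt q
  rw [combineIncl_pt hP C hx, combineIncl_pt hP C hy] at h
  rcases pt_eq_pt (G := (combine hP C).graph) (e := ⟨i, e⟩) (f := ⟨i, f⟩) hx hy h with
    ⟨h1, rfl⟩ | ⟨b, c, h1, rfl, rfl⟩
  · rw [eq_of_heq (Sigma.mk.inj h1).2]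
  · exact vertex_eq_of_glue (G := (C i).graph) (a := (e, b)) (b := (f, c))
      ((combine_glue_iff hP C).1 h1)

theorem isClosedEmbedding_combineIncl (i : Fin k) : IsClosedEmbedding (combineIncl hP C i) :=
  (continuous_combineIncl hP C i).isClosedEmbedding (injective_combineIncl hP C i)

theorem proj_combineIncl {i : Fin k} (p : (C i).graph.Point) :
    (combine hP C).proj (combineIncl hP C i p) = P.clusterProj i ((C i).proj p) := by
  obtain ⟨e, x, hx, rfl⟩ := exists_pt p
  have h1 : (combine hP C).proj (combineIncl hP C i ((C i).graph.pt e x)) = _ :=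
    (congrArg _ (combineIncl_pt hP C hx)).trans ((combine hP C).proj_pt (e := ⟨i, e⟩) hx)
  have h2 := (congrArg (P.clusterProj i) ((C i).proj_pt hx)).trans
    (P.clusterProj_pt ((C i).add_mem hx))
  rw [h1, h2, ← add_assoc]
  rfl

theorem exists_combineIncl (p : (combine hP C).graph.Point) :
    ∃ i q, combineIncl hP C i q = p := by
  obtain ⟨⟨i, e⟩, x, hx, rfl⟩ := exists_pt p
  exact ⟨i, (C i).graph.pt e x, combineIncl_pt hP C hx⟩

/-- The set of all points that stem from the `i`-th cluster is open and closed. -/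
theorem isClopen_range_combineIncl (i : Fin k) : IsClopen (range (combineIncl hP C i)) ∧
    ∀ j p, combineIncl hP C j p ∈ range (combineIncl hP C i) → j = i := by
  have h := isClopen_edgesSet (G := (combine hP C).graph) (T := {s | s.1 = i}) (by
    intro a b hab (ha : a.1.1 = i)
    exact (Sigma.mk.inj hab).1.symm.trans ha)
  have hr : range (combineIncl hP C i) = (combine hP C).graph.edgesSet {s | s.1 = i} := by
    ext p
    constructor
    · rintro ⟨q, rfl⟩
      obtain ⟨e, x, hx, rfl⟩ := exists_pt q
      rw [combineIncl_pt hP C hx]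
      exact pt_mem_edgesSet (G := (combine hP C).graph) (T := {s | s.1 = i}) (e := ⟨i, e⟩) rfl x
    · intro hp
      obtain ⟨⟨j, e⟩, rfl, x, hx, rfl⟩ := mem_edgesSet.1 hp
      exact ⟨(C j).graph.pt e x, combineIncl_pt hP C hx⟩
  rw [hr]
  refine ⟨h.1, fun j p hp => ?_⟩
  obtain ⟨e, x, hx, rfl⟩ := exists_pt p
  rw [combineIncl_pt hP C hx] at hp
  exact h.2 _ _ hp

/-- The component of the combined cut that is a given component of the cut of a cluster. -/
noncomputable def combineComponent (s : Σ i, ConnectedComponents (C i).graph.Point) :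
    ConnectedComponents (combine hP C).graph.Point :=
  (continuous_combineIncl hP C s.1).connectedComponentsMap s.2

/-- The inclusions are homeomorphisms onto clopen sets, so they map components onto components. -/
theorem componentSet_combineComponent (s : Σ i, ConnectedComponents (C i).graph.Point) :
    (combine hP C).graph.componentSet (combineComponent hP C s) =
      combineIncl hP C s.1 '' (C s.1).graph.componentSet s.2 := by
  obtain ⟨i, c⟩ := s
  obtain ⟨p, rfl⟩ := ConnectedComponents.surjective_coe c
  change (combine hP C).graph.componentSet (ConnectedComponents.mk (combineIncl hP C i p)) = _
  rw [componentSet_mk]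
  change _ = combineIncl hP C i '' (C i).graph.componentSet (ConnectedComponents.mk p)
  rw [componentSet_mk]
  refine Subset.antisymm ?_ ?_
  · have h1 : connectedComponent (combineIncl hP C i p) ⊆ range (combineIncl hP C i) :=
      (isClopen_range_combineIncl hP C i).1.connectedComponent_subset ⟨p, rfl⟩
    have h2 := isPreconnected_connectedComponent.preimage_of_isClosedMap
      (injective_combineIncl hP C i) (isClosedEmbedding_combineIncl hP C i).isClosedMap h1
    intro y hy
    obtain ⟨q, rfl⟩ := h1 hy
    exact ⟨q, h2.subset_connectedComponent (x := p) mem_connectedComponent hy, rfl⟩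
  · exact (continuous_combineIncl hP C i).image_connectedComponent_subset p

theorem injective_combineComponent : Function.Injective (combineComponent hP C) := by
  rintro ⟨i, c⟩ ⟨j, d⟩ h
  have h1 := componentSet_combineComponent hP C ⟨i, c⟩
  rw [h, componentSet_combineComponent] at h1
  obtain ⟨p, hp⟩ := componentSet_nonempty d
  have h2 : combineIncl hP C j p ∈ combineIncl hP C i '' (C i).graph.componentSet c :=
    h1 ▸ ⟨p, hp, rfl⟩
  obtain rfl : j = i := (isClopen_range_combineIncl hP C i).2 j p (image_subset_range _ _ h2)
  obtain ⟨q, hq, hqp⟩ := h2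
  rw [injective_combineIncl hP C j hqp] at hq
  rw [show c = d from hq.symm.trans hp]

end GraphPartition

/-! ### A criterion for nodal partitions -/

namespace GraphPartition

open MetricGraph

variable {G : MetricGraph} {k : ℕ} {Q : GraphPartition G k} {φ : G.Point → ℝ} {t : ℝ}

theorem isClosed_clusterSupport (j : Fin k) : IsClosed (Q.clusterSupport j) :=
  Q.cut.isClosedMap_proj _ (isClopen_componentSet _).isClosed

/-- A partition by the closures of nodal domains, cut only at zeros, is nodal. The point is that, by
the Kirchhoff conditions, an eigenfunction changes its sign at every zero that lies on an edge on
which it does not vanish identically, so that clusters of different signs meet there. -/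
theorem isNodalFor_of_closed_nodal_domains (hφ : G.IsEigenfunction ∅ t φ) (ht : 0 < t)
    (hcut : ∀ p q, p ≠ q → Q.cut.proj p = Q.cut.proj q → φ (Q.cut.proj p) = 0)
    (hcover : ∀ p, φ (Q.cut.proj p) ≠ 0 → ∃ j, p ∈ Q.clusterSet j)
    (hdom : ∀ j, ∃ B, IsConnected B ∧ (∀ x ∈ B, φ x ≠ 0) ∧ B ⊆ Q.clusterSupport j ∧
      Q.clusterSupport j ⊆ closure B)
    (hsign : ∀ j, (∀ x ∈ Q.clusterSupport j, 0 ≤ φ x) ∨ ∀ x ∈ Q.clusterSupport j, φ x ≤ 0) :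
    Q.IsNodalFor φ := by
  have hφc : Continuous φ := hφ.1.1.1
  set U : Set G.Point := {x | φ x ≠ 0} with hU
  have hUo : IsOpen U := isOpen_ne.preimage hφc
  choose B hBc hB0 hBΩ hΩB using hdom
  have hΩ : ∀ x ∈ U, ∃ j, x ∈ Q.clusterSupport j := by
    intro x hx
    obtain ⟨p, rfl⟩ := Q.cut.surjective_proj x
    obtain ⟨j, hj⟩ := hcover p hx
    exact ⟨j, p, hj, rfl⟩
  have huniq : ∀ x ∈ U, ∀ i j, x ∈ Q.clusterSupport i → x ∈ Q.clusterSupport j → i = j := by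
    rintro _ hx i j ⟨p, hp, rfl⟩ ⟨q, hq, hqp⟩
    have : p = q := by
      by_contra hne
      exact hx (hcut p q hne hqp.symm)
    subst this
    exact Q.cluster_injective (hp.symm.trans hq)
  have hclosed : ∀ s : Set (Fin k), IsClosed (⋃ j ∈ s, Q.clusterSupport j) := fun s =>
    s.toFinite.isClosed_biUnion fun j _ => isClosed_clusterSupport j
  -- the support is the closure of the set where `φ` does not vanish
  have hsupp : Q.support = closure U := by
    refine Subset.antisymm (iUnion_subset fun j => (hΩB j).trans (closure_mono (hB0 j))) ?_
    refine closure_minimal (fun x hx => mem_iUnion.2 (hΩ x hx)) ?_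
    exact isClosed_iUnion_of_finite isClosed_clusterSupport
  set W : Set G.Point := ⋃ e ∈ {e : G.E | ∃ p ∈ G.edgeSet e, φ p ≠ 0}, G.edgeSet e with hW
  have hUW : closure U = W := by
    refine Subset.antisymm (closure_minimal (fun x hx => ?_) ?_) ?_
    · obtain ⟨e, y, -, rfl⟩ := exists_pt x
      exact mem_iUnion₂.2 ⟨e, ⟨_, G.pt_mem_edgeSet e y, hx⟩, G.pt_mem_edgeSet e y⟩
    · exact (toFinite _).isClosed_biUnion fun e _ => (isCompact_edgeSet e).isClosed
    · intro x hx
      obtain ⟨e, ⟨p, hp, hp0⟩, hxe⟩ := mem_iUnion₂.1 hx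
      by_contra hxU
      have h1 : ∀ᶠ q in 𝓝 x, φ q = 0 := by
        filter_upwards [isClosed_closure.isOpen_compl.mem_nhds hxU] with q hq
        by_contra h0
        exact hq (subset_closure h0)
      exact hp0 (hφ.eq_zero_of_nonneg ht h1.self_of_nhds (h1.mono fun q hq => hq.ge) hxe p hp)
  have hneg : ∀ {u : G.Point → ℝ}, G.IsEigenfunction ∅ t u → (∀ x, u x ≠ 0 → φ x ≠ 0) →
      (∀ x, φ x ≠ 0 → u x ≠ 0) →
      (∀ j, (∀ x ∈ Q.clusterSupport j, 0 ≤ u x) ∨ ∀ x ∈ Q.clusterSupport j, u x ≤ 0) →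
      ∀ x ∈ W, u x = 0 → ∃ j, x ∈ Q.clusterSupport j ∧ ∀ y ∈ Q.clusterSupport j, u y ≤ 0 := by
    intro u hu h1 h2 hs x hx hx0
    obtain ⟨e, ⟨p, hp, hp0⟩, hxe⟩ := mem_iUnion₂.1 hx
    have h3 : ¬ ∀ᶠ q in 𝓝 x, 0 ≤ u q := fun h =>
      h2 p hp0 (hu.eq_zero_of_nonneg ht hx0 h hxe p hp)
    have h4 : x ∈ closure {q | u q < 0} := by
      rw [mem_closure_iff_frequently]
      exact (not_eventually.1 h3).mono fun q hq => not_le.1 hq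
    have h5 : x ∈ ⋃ j ∈ {j | ∀ y ∈ Q.clusterSupport j, u y ≤ 0}, Q.clusterSupport j := by
      refine closure_minimal (fun q (hq : u q < 0) => ?_) (hclosed _) h4
      obtain ⟨j, hj⟩ := hΩ q (h1 q hq.ne)
      refine mem_iUnion₂.2 ⟨j, ?_, hj⟩
      exact (hs j).resolve_left fun h => absurd (h q hj) (not_le.2 hq)
    obtain ⟨j, hj, hxj⟩ := mem_iUnion₂.1 h5
    exact ⟨j, hxj, hj⟩
  -- clusters of different signs meet in every zero
  have hmeet : ∀ x ∈ Q.support, φ x = 0 →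
      ∃ i j, i ≠ j ∧ x ∈ Q.clusterSupport i ∧ x ∈ Q.clusterSupport j := by
    intro x hx hx0
    rw [hsupp, hUW] at hx
    obtain ⟨i, hi, hi0⟩ := hneg hφ (fun _ h => h) (fun _ h => h) hsign x hx hx0
    obtain ⟨j, hj, hj0⟩ := hneg (u := -φ) hφ.neg (fun _ h => neg_ne_zero.1 h)
      (fun _ h => neg_ne_zero.2 h)
      (fun j => (hsign j).symm.imp (fun h y hy => neg_nonneg.2 (h y hy))
        fun h y hy => neg_nonpos.2 (h y hy)) x hx (neg_eq_zero.2 hx0)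
    refine ⟨i, j, ?_, hi, hj⟩
    rintro rfl
    obtain ⟨y, hy⟩ := (hBc i).nonempty
    exact hB0 i y hy (le_antisymm (hi0 y (hBΩ i hy)) (neg_nonpos.1 (hj0 y (hBΩ i hy))))
  have hcutSet : Q.cutSet = {x | x ∈ Q.support ∧ φ x = 0} := by
    ext x
    constructor
    · rintro ⟨hx, p, ⟨q, hqp, hq⟩, rfl⟩
      exact ⟨hx, hcut p q hqp.symm hq.symm⟩
    · rintro ⟨hx, hx0⟩
      obtain ⟨i, j, hij, ⟨p, hp, rfl⟩, q, hq, hqp⟩ := hmeet x hx hx0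
      refine ⟨hx, p, ⟨q, ?_, hqp⟩, rfl⟩
      rintro rfl
      exact hij (Q.cluster_injective (hp.symm.trans hq))
  have hfr : ∀ j, ∀ x ∈ frontier (Q.clusterSupport j), φ x = 0 := by
    intro j x hx
    by_contra h0
    rw [frontier_eq_closure_inter_closure, (isClosed_clusterSupport j).closure_eq] at hx
    have h1 : x ∈ closure ((Q.clusterSupport j)ᶜ ∩ U) := by
      rw [inter_comm]
      exact hUo.inter_closure ⟨h0, hx.2⟩
    have h2 : x ∈ ⋃ i ∈ {i | i ≠ j}, Q.clusterSupport i := by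
      refine closure_minimal (fun y hy => ?_) (hclosed _) h1
      obtain ⟨i, hi⟩ := hΩ y hy.2
      exact mem_iUnion₂.2 ⟨i, fun h => hy.1 (h ▸ hi), hi⟩
    obtain ⟨i, hi, hxi⟩ := mem_iUnion₂.1 h2
    exact hi (huniq x h0 i j hxi hx.1)
  refine ⟨⟨?_, fun j => ?_⟩, hsupp.trans hUW, hcutSet⟩
  · rw [IsRigid, hcutSet]
    ext x
    constructor
    · rintro ⟨hx, hx0⟩
      obtain ⟨i, j, hij, hi, hj⟩ := hmeet x hx hx0
      refine mem_iUnion.2 ⟨i, ?_⟩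
      rw [frontier_eq_closure_inter_closure]
      refine ⟨subset_closure hi, closure_mono (fun y hy hyi => ?_) (hΩB j hj)⟩
      exact hij (huniq y (hB0 j y hy) i j hyi (hBΩ j hy))
    · intro hx
      obtain ⟨j, hj⟩ := mem_iUnion.1 hx
      exact ⟨mem_iUnion.2 ⟨j, (isClosed_clusterSupport j).frontier_subset hj⟩, hfr j x hj⟩
  · refine (hBc j).subset_closure (fun x hx => ?_) (interior_subset.trans (hΩB j))
    by_contra hxi
    exact hB0 j x hx (hfr j x ⟨subset_closure (hBΩ j hx), hxi⟩)

end GraphPartition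

/-! ### Optimal partitions are generalised nodal partitions -/

namespace GraphPartition

open MetricGraph

variable {G : MetricGraph} {k : ℕ} {P : GraphPartition G k}

/-- If nonnegative first eigenfunctions of the clusters, multiplied by suitable constants, fit
together to an eigenfunction `φ` of the graph, the partition is a generalised nodal partition: cut
every cluster along the zero set of its eigenfunction. -/
theorem isGeneralisedNodalFor_of_glued (hP : P.IsExhaustive) {t : ℝ} (ht : 0 < t)
    (hl : ∀ i, P.lambda1 i = t) {ψ : ∀ i, (P.clusterGraph i).Point → ℝ} {φ : G.Point → ℝ}
    {c : Fin k → ℝ}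
    (hψ : ∀ i, (P.clusterGraph i).IsEigenfunction (P.dirichletVertices i) (P.lambda1 i) (ψ i))
    (hψ0 : ∀ i p, 0 ≤ ψ i p) (hc : ∀ i, c i ≠ 0)
    (hφψ : ∀ i p, φ (P.clusterProj i p) = c i * ψ i p) (hφ : G.IsEigenfunction ∅ t φ) :
    P.IsGeneralisedNodalFor t := by
  choose S hS using fun i => exists_nodal_subdivision (ψ := ψ i)
    (IsEigenfunction.zeros P.pt_notMem_dirichletVertices (hψ i) (by rw [hl]; exact ht))
  let C : ∀ i, (P.clusterGraph i).Cut := fun i => (S i).nodalCut (ψ i)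
  let σ := (Finite.equivFin (P.NonzeroComponent ψ C)).symm
  let Q : GraphPartition G (Nat.card (P.NonzeroComponent ψ C)) :=
    { cut := combine hP C
      cluster := fun j => combineComponent hP C (σ j).1
      cluster_injective :=
        (injective_combineComponent hP C).comp (Subtype.val_injective.comp σ.injective) }
  have hQset : ∀ j, Q.clusterSet j =
      combineIncl hP C (σ j).1.1 '' (C (σ j).1.1).graph.componentSet (σ j).1.2 := fun j =>
    componentSet_combineComponent hP C (σ j).1
  have hQproj : ∀ i p, Q.cut.proj (combineIncl hP C i p) = P.clusterProj i ((C i).proj p) :=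
    fun i p => proj_combineIncl hP C p
  have hQφ : ∀ i p, φ (Q.cut.proj (combineIncl hP C i p)) = c i * ψ i ((C i).proj p) :=
    fun i p => (congrArg φ (hQproj i p)).trans (hφψ i _)
  have hdomain : ∀ i, ∀ d : ConnectedComponents (C i).graph.Point,
      ∀ p ∈ (C i).graph.componentSet d, ψ i ((C i).proj p) ≠ 0 →
      IsClosedNodalDomain (P.clusterGraph i) (ψ i) ((C i).proj '' (C i).graph.componentSet d) := by
    rintro i _ p rfl hp
    exact (S i).isClosedNodalDomain_nodalCut (hS i) hp
  refine ⟨ψ, C, hψ, fun i d => ?_, _, Q, σ, ?_, fun j => ?_, φ, hφ, ?_⟩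
  · by_cases h : ∃ p ∈ (C i).graph.componentSet d, ψ i ((C i).proj p) ≠ 0
    · obtain ⟨p, hp, hp0⟩ := h
      exact Or.inr (hdomain i d p hp hp0)
    · push Not at h
      exact Or.inl h
  · have h1 : ∀ i, ∃ q, ψ i ((C i).proj q) ≠ 0 := fun i => by
      obtain ⟨p, hp⟩ := Function.ne_iff.1 (hψ i).2.1
      obtain ⟨q, rfl⟩ := (C i).surjective_proj p
      exact ⟨q, hp⟩
    choose q hq using h1
    let f : Fin k → P.NonzeroComponent ψ C := fun i =>
      ⟨⟨i, ConnectedComponents.mk (q i)⟩, q i, rfl, hq i⟩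
    have hf : Function.Injective f := fun i j h =>
      congrArg (fun s : P.NonzeroComponent ψ C => s.1.1) h
    simpa using Nat.card_le_card_of_injective f hf
  · let e := (isClosedEmbedding_combineIncl hP C (σ j).1.1).isEmbedding.homeomorphImage
      ((C (σ j).1.1).graph.componentSet (σ j).1.2)
    refine ⟨(Homeomorph.setCongr (hQset j)).trans e.symm, fun p => ?_⟩
    have h1 := hQproj (σ j).1.1 (e.symm (Homeomorph.setCongr (hQset j) p))
    have h2 : combineIncl hP C (σ j).1.1 (e.symm (Homeomorph.setCongr (hQset j) p)).1 = p.1 :=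
      congrArg Subtype.val (e.apply_symm_apply (Homeomorph.setCongr (hQset j) p))
    rw [h2] at h1
    exact h1.symm
  · refine isNodalFor_of_closed_nodal_domains hφ ht ?_ ?_ (fun j => ?_) (fun j => ?_)
    · intro p q hpq h
      obtain ⟨i, p, rfl⟩ := exists_combineIncl hP C p
      obtain ⟨j, q, rfl⟩ := exists_combineIncl hP C q
      rw [hQφ]
      suffices hz : ψ i ((C i).proj p) = 0 by rw [hz, mul_zero]
      have h' : P.clusterProj i ((C i).proj p) = P.clusterProj j ((C j).proj q) :=
        (hQproj i p).symm.trans (h.trans (hQproj j q))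
      by_cases hne : P.clusterIncl i ((C i).proj p) = P.clusterIncl j ((C j).proj q)
      · obtain rfl : i = j := by
          by_contra hij
          exact P.clusterIncl_ne hij _ _ hne
        exact (S i).nodalCut_eq_zero (ψ i) (fun h => hpq (congrArg _ h))
          ((P.isClosedEmbedding_clusterIncl i).injective hne)
      · exact (hψ i).1.2 _ (P.mem_dirichletVertices_of_ne h' hne)
    · intro p hp
      obtain ⟨i, p, rfl⟩ := exists_combineIncl hP C p
      rw [hQφ] at hp
      refine ⟨σ.symm ⟨⟨i, ConnectedComponents.mk p⟩, p, rfl, right_ne_zero_of_mul hp⟩, ?_⟩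
      rw [hQset, Equiv.apply_symm_apply]
      exact ⟨p, rfl, rfl⟩
    · obtain ⟨⟨⟨i, d⟩, p, hp, hp0⟩, hj⟩ : ∃ s, σ j = s := ⟨_, rfl⟩
      obtain ⟨x, hx, hxd⟩ := hdomain i d p hp hp0
      have hΩ : Q.clusterSupport j =
          P.clusterProj i '' closure (connectedComponentIn {y | ψ i y ≠ 0} x) := by
        rw [clusterSupport, hQset, hj, ← hxd, image_image, image_image]
        exact image_congr fun p _ => hQproj i p
      refine ⟨P.clusterProj i '' connectedComponentIn {y | ψ i y ≠ 0} x, ?_, ?_, ?_, ?_⟩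
      · exact (isConnected_connectedComponentIn_iff.2 hx).image _
          (P.continuous_clusterProj i).continuousOn
      · rintro _ ⟨y, hy, rfl⟩
        rw [hφψ]
        exact mul_ne_zero (hc i) (connectedComponentIn_subset _ _ hy)
      · rw [hΩ]
        exact image_mono subset_closure
      · rw [hΩ]
        exact image_closure_subset_closure_image (P.continuous_clusterProj i)
    · have h1 : ∀ x ∈ Q.clusterSupport j, ∃ y, φ x = c (σ j).1.1 * ψ (σ j).1.1 y := by
        rintro _ ⟨p, hp, rfl⟩
        rw [hQset] at hp
        obtain ⟨q, -, rfl⟩ := hp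
        exact ⟨_, hQφ _ q⟩
      rcases lt_or_gt_of_ne (hc (σ j).1.1) with h | h
      · right
        intro x hx
        obtain ⟨y, hy⟩ := h1 x hx
        rw [hy]
        exact mul_nonpos_of_nonpos_of_nonneg h.le (hψ0 _ y)
      · left
        intro x hx
        obtain ⟨y, hy⟩ := h1 x hx
        rw [hy]
        exact mul_nonneg h.le (hψ0 _ y)

end GraphPartition

theorem mainTheorem5 (G : MetricGraph) [ConnectedSpace G.Point] :
    G.mu 2 = G.dirichletOptEnergy 2 ∧
    ∀ P : GraphPartition G 2, P.IsExhaustive → P.IsRigid →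
      P.dirichletEnergy = G.dirichletOptEnergy 2 →
      P.IsGeneralisedNodal ∧ P.IsDirichletEquipartition ∧ P.IsGeneralisedNodalFor (G.mu 2) := by
  refine ⟨(GraphPartition.mu_two_eq_dirichletOptEnergy G), fun P hP _ hE => ?_⟩
  rw [← (GraphPartition.mu_two_eq_dirichletOptEnergy G)] at hE
  obtain ⟨hl, ψ, φ, c, hψ, hψ0, hc0, hc1, hφψ, hφ⟩ := (GraphPartition.mu_two_le_and_eq hP).2 hE.le
  have h : P.IsGeneralisedNodalFor (G.mu 2) :=
    GraphPartition.isGeneralisedNodalFor_of_glued hP MetricGraph.second_eigenvalue.1 hl hψ hψ0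
      (Fin.forall_fin_two.2 ⟨hc0.ne', hc1.ne⟩) hφψ hφ
  exact ⟨⟨_, h⟩, fun i j => (hl i).trans (hl j).symm, h⟩
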